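/- Conventions. A polyhedron is a subset $P\subset\mathbb{R}^N$ each of whose points $x$ has a conical neighbourhood $xK$ in $P$ with $K$ compact. For $0\le k\le n$ let $\Pi^n_k=\mathrm{Cone}(\Delta^{k+1}_{k-1})\times I^{n-k}$, where $\Delta^{k+1}_{k-1}$ is the $(k-1)$-skeleton of the $(k+1)$-simplex, $\mathrm{Cone}(\emptyset)$ is a point and $I=[-1,1]$; its centre is the cone point times the centre of the cube. A compact $n$-singular manifold is a compact polyhedron each of whose points has a neighbourhood PL isomorphic to some $\Pi^n_k$, $0\le k\le n$, with the point corresponding to the centre. A compact $n$-singular manifold with boundary is a compact polyhedron $W$ each of whose points $x$ either has such a neighbourhood or has a neighbourhood PL isomorphic to some $\Pi^{n-1}_k\times[0,1]$, $0\le k\le n-1$, with $x$ corresponding to $(\text{centre},0)$; its boundary $\partial W$ is the set of points of the second kind. A finite trivalent graph is (as a polyhedron) a compact $1$-singular manifold: every point has a neighbourhood that is an interval or a tripod (loops, multiple edges and circle components are allowed). A fake surface with boundary is a compact $2$-singular manifold with (possibly empty) boundary. Lemma. Every finite trivalent graph $T$ is the boundary of a fake surface with boundary: there is a fake surface with boundary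 $F$ such that $\partial F$ is PL isomorphic to $T$. Consequently the one-dimensional bordism group of singular manifolds is trivial, in the sense that any two finite trivalent graphs $T_1,T_2$ are bordant: there is a fake surface with boundary whose boundary is PL isomorphic to the disjoint union $T_1\sqcup T_2$. -/

import Mathlib

open Set Topology

namespace PLTop

section

variable {E F : Type*} [NormedAddCommGroup E] [NormedSpace ℝ E]
  [NormedAddCommGroup F] [NormedSpace ℝ F]

/-! ### Cones, polyhedra and piecewise linear isomorphisms -/

/-- The union of the point `x` and of all segments from `x` to points of `K`.
(If `K` is empty, this is the single point `x`.) -/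
def coneSet (x : E) (K : Set E) : Set E :=
  insert x {z | ∃ y ∈ K, z ∈ segment ℝ x y}

/-- `xK` is a genuine cone: every point of it other than the apex `x` lies on
exactly one of the segments from `x` to points of `K`. -/
def IsCone (x : E) (K : Set E) : Prop :=
  x ∉ K ∧ ∀ y ∈ K, ∀ y' ∈ K, ∀ z, z ≠ x → z ∈ segment ℝ x y → z ∈ segment ℝ x y' → y = y'

/-- A polyhedron: every point `x` has a conical neighbourhood `xK` in `P`, with `K` compact. -/
def IsPolyhedron (P : Set E) : Prop :=
  ∀ x ∈ P, ∃ K : Set E, IsCompact K ∧ IsCone x K ∧ coneSet x K ⊆ P ∧ coneSet x K ∈ 𝓝[P] x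

/-- A (compact, convex) polytope: the convex hull of a finite set of points. -/
def IsPolytope (C : Set E) : Prop :=
  ∃ s : Finset E, C = convexHull ℝ (s : Set E)

/-- `f` is piecewise linear on the compact set `P`: `P` is a finite union of polytopes, on each of
which `f` agrees with an affine map. (Such an `f` is continuous on `P`.) -/
def IsPLOn (f : E → F) (P : Set E) : Prop :=
  ∃ 𝒞 : Set (Set E), 𝒞.Finite ∧ ⋃₀ 𝒞 = P ∧
    ∀ C ∈ 𝒞, IsPolytope C ∧ ∃ A : E →ᵃ[ℝ] F, EqOn f A C

/-- Two compact polyhedra are PL isomorphic. (The inverse of a piecewise linear bijection between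
compact polyhedra is again piecewise linear.) -/
def PLIsomorphic (P : Set E) (Q : Set F) : Prop :=
  ∃ f : E → F, IsPLOn f P ∧ BijOn f P Q

/-- PL isomorphism of pointed compact polyhedra. -/
def PointedPLIsomorphic (P : Set E) (x : E) (Q : Set F) (y : F) : Prop :=
  ∃ f : E → F, IsPLOn f P ∧ BijOn f P Q ∧ f x = y

/-- The point `x` of `P` has a neighbourhood in `P` that is PL isomorphic to the model `Q`,
with `x` corresponding to the base point `y` of the model. -/
def HasModelNhd (P : Set E) (x : E) (Q : Set F) (y : F) : Prop :=
  ∃ N : Set E, N ⊆ P ∧ N ∈ 𝓝[P] x ∧ PointedPLIsomorphic N x Q y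

end

/-! ### The local models -/

/-- The codimension two skeleton (the `(k-1)`-skeleton) of the standard `(k+1)`-simplex, that is,
the points with at most `k` nonzero barycentric coordinates. It is empty for `k = 0`, the three
vertices of a triangle for `k = 1`, and the `1`-skeleton of a tetrahedron for `k = 2`. -/
def codimTwoSkeleton (k : ℕ) : Set (Fin (k + 2) → ℝ) :=
  {x | x ∈ stdSimplex ℝ (Fin (k + 2)) ∧ {i | x i ≠ 0}.ncard ≤ k}

/-- The barycentre of the standard `(k+1)`-simplex. -/
noncomputable def barycentre (k : ℕ) : Fin (k + 2) → ℝ := fun _ => 1 / ((k : ℝ) + 2)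

/-- The model `Π^n_k`, for `k ≤ n`: the cone on the codimension two skeleton of the
`(k+1)`-simplex (with the barycentre as cone point) times the cube `I^(n-k)`, `I = [-1, 1]`. -/
def model (n k : ℕ) : Set ((Fin (k + 2) → ℝ) × (Fin (n - k) → ℝ)) :=
  coneSet (barycentre k) (codimTwoSkeleton k) ×ˢ Icc (fun _ => -1) (fun _ => 1)

/-- The centre of `Π^n_k`: the cone point times the centre of the cube. -/
noncomputable def modelCentre (n k : ℕ) : (Fin (k + 2) → ℝ) × (Fin (n - k) → ℝ) :=
  (barycentre k, 0)

section

variable {E F : Type*} [NormedAddCommGroup E] [NormedSpace ℝ E]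
  [NormedAddCommGroup F] [NormedSpace ℝ F]

/-- `x` is a manifold point (`k = 0`) or a singularity of type `k` (`1 ≤ k ≤ n`) of `P`. -/
def IsPointOfType (n k : ℕ) (P : Set E) (x : E) : Prop :=
  HasModelNhd P x (model n k) (modelCentre n k)

/-- `x` is a boundary point of type `k` of `P`: it has a neighbourhood of the form
`Π^(n-1)_k × [0, 1]`, in which it is the point `(centre, 0)`. -/
def IsBoundaryPointOfType (n k : ℕ) (P : Set E) (x : E) : Prop :=
  HasModelNhd P x (model (n - 1) k ×ˢ Icc (0 : ℝ) 1) (modelCentre (n - 1) k, (0 : ℝ))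

/-! ### Singular manifolds, fake surfaces and bordism -/

/-- A generic `n`-polyhedron (without boundary), which represents an `n`-singular manifold. -/
def IsSingularManifold (n : ℕ) (P : Set E) : Prop :=
  IsPolyhedron P ∧ ∀ x ∈ P, ∃ k ≤ n, IsPointOfType n k P x

/-- A generic `n`-polyhedron with (possibly empty) boundary, which represents an `n`-singular
manifold with boundary. -/
def IsSingularManifoldWithBoundary (n : ℕ) (P : Set E) : Prop :=
  IsPolyhedron P ∧
    ∀ x ∈ P, (∃ k ≤ n, IsPointOfType n k P x) ∨ (∃ k < n, IsBoundaryPointOfType n k P x)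

/-- The boundary of an `n`-singular manifold with boundary. -/
def singularBoundary (n : ℕ) (P : Set E) : Set E :=
  {x | x ∈ P ∧ ∃ k < n, IsBoundaryPointOfType n k P x}

/-- A finite trivalent graph, as a polyhedron: a compact `1`-singular manifold. Each point has
an interval or a tripod as neighbourhood; loops, multiple edges and circle components
are allowed. -/
def IsFiniteTrivalentGraph (T : Set E) : Prop :=
  IsCompact T ∧ IsSingularManifold 1 T

/-- A fake surface with boundary: a compact `2`-singular manifold with boundary. -/
def IsFakeSurfaceWithBoundary (S : Set E) : Prop :=
  IsCompact S ∧ IsSingularManifoldWithBoundary 2 S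

/-- Two compact `n`-singular manifolds are bordant: their disjoint union is the boundary of a
compact `(n+1)`-singular manifold with boundary. -/
def Bordant (n : ℕ) (P : Set E) (Q : Set F) : Prop :=
  ∃ (N : ℕ) (W A B : Set (EuclideanSpace ℝ (Fin N))),
    IsCompact W ∧ IsSingularManifoldWithBoundary (n + 1) W ∧
    singularBoundary (n + 1) W = A ∪ B ∧ Disjoint A B ∧
    PLIsomorphic A P ∧ PLIsomorphic B Q

end

end PLTop

/-! A trivalent graph `T` embeds in a closed surface, and a closed surface with a collar `T × [0,
1]` attached along `T` is a fake surface with boundary `T × {1}`.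

The surface comes from a cyclic order of the two or three edges at each vertex
(`exists_isRotation`). It thickens the graph to a ribbon surface (`ribbon`) carrying a height
function with values in `[0, 1/2]`; the graph is the locus of height zero, and doubling along height
`1/2` gives a closed surface. `collaredDouble` describes double and collar together: it consists of
the pairs `(X, z)` with `-2 ≤ z ≤ 1` and height of `X` equal to `bump z`. The ranges `[-2, -1]` and
`[-1, 0]` of `z` give the two copies, `[0, 1]` gives the collar. Off the attaching curve the local
structure is a disc or a graph times an interval. At an interior point of an edge, or at a vertex of
degree two, the two sides of the surface and the collar form a tripod times an interval. At a vertex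
of degree three, a disc with three fins is the cone on the 1-skeleton of a tetrahedron: the triangle
bounds the disc and the edges to the fourth vertex bound the fins (`isLeg_two_iff`).
`fills_collaredDouble` collects these cases.

The graph is given only through local models, so it first has to be made combinatorial. Its corners
are the points at which it is not a straight segment; compactness makes them finite in number. A
straight segment in `T` extends until it meets a corner, so `T` is a union of segments between
corners, even on circle components. Such edges form a simple graph with degrees two and three
(`exists_neighbours`), and a linear map carries its realization onto `T`
(`exists_bijOn_zeroSection`).

That the boundary is exactly `T × {1}` requires that an interior point is never a boundary point
(`not_isBoundaryPointOfType_of_isPointOfType`). The arc transverse to the boundary separates the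
boundary model locally. A piecewise linear chart turns its germ into a straight ray from the centre
of the interior model, and no ray separates a two-dimensional model
(`isPreconnected_model_diff_ray`).

Charts are global formulas in `max` and `min`, and their inverses are automatically piecewise linear
(`IsPLOn.leftInverse`). The bordism statement follows by taking disjoint copies of two such
surfaces. -/

namespace PLTop

/-! ### Polytopes and piecewise linear maps. -/

section PLCalculus

variable {E F H : Type*} [NormedAddCommGroup E] [NormedSpace ℝ E]
  [NormedAddCommGroup F] [NormedSpace ℝ F] [NormedAddCommGroup H] [NormedSpace ℝ H]

/-! ### Polytopes -/

lemma IsPolytope.isCompact {C : Set E} (hC : IsPolytope C) : IsCompact C := by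
  obtain ⟨s, rfl⟩ := hC
  exact s.finite_toSet.isCompact_convexHull ℝ

lemma IsPolytope.convex {C : Set E} (hC : IsPolytope C) : Convex ℝ C := by
  obtain ⟨s, rfl⟩ := hC
  exact convex_convexHull ℝ _

lemma isPolytope_convexHull {s : Set E} (hs : s.Finite) : IsPolytope (convexHull ℝ s) :=
  ⟨hs.toFinset, by simp⟩

lemma isPolytope_singleton (x : E) : IsPolytope {x} :=
  ⟨{x}, by simp⟩

lemma isPolytope_segment (x y : E) : IsPolytope (segment ℝ x y) := by
  rw [← convexHull_pair]
  exact isPolytope_convexHull (by simp)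

lemma isPolytope_Icc (a b : ℝ) : IsPolytope (Icc a b) := by
  rcases le_total a b with h | h
  · rw [← segment_eq_Icc h]
    exact isPolytope_segment a b
  · rcases h.lt_or_eq with h | h
    · exact ⟨∅, by simp [h]⟩
    · subst h
      simpa using isPolytope_singleton b

lemma IsPolytope.image {C : Set E} (hC : IsPolytope C) (A : E →ᵃ[ℝ] F) : IsPolytope (A '' C) := by
  obtain ⟨s, rfl⟩ := hC
  rw [AffineMap.image_convexHull]
  exact isPolytope_convexHull (s.finite_toSet.image _)

lemma IsPolytope.prod {C : Set E} {D : Set F} (hC : IsPolytope C) (hD : IsPolytope D) :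
    IsPolytope (C ×ˢ D) := by
  obtain ⟨s, rfl⟩ := hC
  obtain ⟨t, rfl⟩ := hD
  rw [← convexHull_prod]
  exact isPolytope_convexHull (s.finite_toSet.prod t.finite_toSet)

lemma isPolytope_Icc_pi {ι : Type*} [Fintype ι] (a b : ι → ℝ) (h : a ≤ b) :
    IsPolytope (Icc a b) := by
  have : Icc a b = convexHull ℝ (univ.pi fun i => ({a i, b i} : Set ℝ)) := by
    rw [convexHull_pi, ← pi_univ_Icc]
    congr 1
    ext i : 1
    rw [convexHull_pair, segment_eq_Icc (h i)]
  rw [this]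
  exact isPolytope_convexHull (Set.Finite.pi fun i => by simp)

/-- Inside a polytope one can move slightly away from a point `y` beyond `x`, provided the support
of the weights of `y` is contained in that of `x`. -/
lemma exists_extend_weights (s : Finset E) (w v : E → ℝ) (hw : ∀ p ∈ s, 0 ≤ w p)
    (hw1 : ∑ p ∈ s, w p = 1) (hv : ∀ p ∈ s, 0 ≤ v p) (hv1 : ∑ p ∈ s, v p = 1)
    (hsupp : s.filter (fun p => 0 < w p) = s.filter (fun p => 0 < v p)) :
    ∃ δ : ℝ, 0 < δ ∧ ∀ ε : ℝ, 0 ≤ ε → ε ≤ δ →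
      (∑ p ∈ s, w p • p) + ε • ((∑ p ∈ s, w p • p) - ∑ p ∈ s, v p • p) ∈
        convexHull ℝ (s : Set E) := by
  -- The least positive weight works: since `v p ≤ 1`, subtracting `ε * v p` with `ε ≤ δ` keeps a
  -- positive weight nonnegative, and a zero weight stays zero because the supports agree.
  obtain ⟨δ, hδ, hδw⟩ : ∃ δ : ℝ, 0 < δ ∧ ∀ p ∈ s, 0 < w p → δ ≤ w p := by
    have hne : (s.filter (fun p => 0 < w p)).Nonempty := by
      by_contra hcon
      rw [Finset.not_nonempty_iff_eq_empty, Finset.filter_eq_empty_iff] at hcon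
      have : ∑ p ∈ s, w p ≤ 0 := Finset.sum_nonpos fun p hp => not_lt.1 (hcon hp)
      linarith
    obtain ⟨q, hq, hmin⟩ := Finset.exists_min_image _ w hne
    refine ⟨w q, (Finset.mem_filter.1 hq).2, fun p hp hpw => hmin p ?_⟩
    simp [hp, hpw]
  refine ⟨δ, hδ, fun ε hε hεδ => ?_⟩
  rw [Finset.mem_convexHull']
  refine ⟨fun p => w p + ε * (w p - v p), fun p hp => ?_, ?_, ?_⟩
  · have hvle : v p ≤ 1 := hv1 ▸ Finset.single_le_sum hv hp
    have hmem : 0 < w p ↔ 0 < v p := by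
      have := Finset.ext_iff.1 hsupp p
      simpa [hp] using this
    have h1 := hw p hp
    have h2 := hv p hp
    by_cases hp0 : 0 < w p
    · have := hδw p hp hp0
      nlinarith
    · have h3 : w p = 0 := le_antisymm (not_lt.1 hp0) h1
      have h4 : v p = 0 := le_antisymm (not_lt.1 fun h => hp0 (hmem.2 h)) h2
      simp [h3, h4]
  · rw [Finset.sum_add_distrib, ← Finset.mul_sum, Finset.sum_sub_distrib, hw1, hv1]
    simp
  · simp only [add_smul, mul_smul, sub_smul, Finset.sum_add_distrib, ← Finset.smul_sum,
      Finset.sum_sub_distrib]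

/-- The intersection of a polytope with the preimage of another one is a polytope. -/
lemma IsPolytope.inter_preimage [FiniteDimensional ℝ E] {C : Set E} {D : Set F}
    (hC : IsPolytope C) (hD : IsPolytope D) (A : E →ᵃ[ℝ] F) : IsPolytope (C ∩ A ⁻¹' D) := by
  classical
  have hA : Continuous A := A.continuous_of_finiteDimensional
  have hcpt : IsCompact (C ∩ A ⁻¹' D) :=
    hC.isCompact.inter_right (hD.isCompact.isClosed.preimage hA)
  have hconv : Convex ℝ (C ∩ A ⁻¹' D) := hC.convex.inter (hD.convex.affine_preimage A)
  -- By Krein–Milman it suffices that there are finitely many extreme points. An extreme point is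
  -- determined by the supports of chosen convex weights of it and of its image: if `x` and `y` had
  -- equal supports, the segment from `y` to `x` could be prolonged beyond `x` inside both
  -- polytopes.
  have hfin : (extremePoints ℝ (C ∩ A ⁻¹' D)).Finite := by
    obtain ⟨s, rfl⟩ := hC
    obtain ⟨t, rfl⟩ := hD
    have h1 : ∀ x, ∃ w : E → ℝ, x ∈ convexHull ℝ (s : Set E) →
        (∀ y ∈ s, 0 ≤ w y) ∧ ∑ y ∈ s, w y = 1 ∧ ∑ y ∈ s, w y • y = x := by
      intro x
      by_cases hx : x ∈ convexHull ℝ (s : Set E)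
      · obtain ⟨w, hw⟩ := Finset.mem_convexHull'.1 hx
        exact ⟨w, fun _ => hw⟩
      · exact ⟨0, fun h => absurd h hx⟩
    have h2 : ∀ x, ∃ w : F → ℝ, x ∈ convexHull ℝ (t : Set F) →
        (∀ y ∈ t, 0 ≤ w y) ∧ ∑ y ∈ t, w y = 1 ∧ ∑ y ∈ t, w y • y = x := by
      intro x
      by_cases hx : x ∈ convexHull ℝ (t : Set F)
      · obtain ⟨w, hw⟩ := Finset.mem_convexHull'.1 hx
        exact ⟨w, fun _ => hw⟩
      · exact ⟨0, fun h => absurd h hx⟩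
    choose w hw using h1
    choose v hv using h2
    refine Set.Finite.of_injOn (f := fun x => (s.filter (fun p => 0 < w x p),
      t.filter (fun p => 0 < v (A x) p))) (t := ((s.powerset ×ˢ t.powerset : Finset _) : Set _))
      (fun x _ => by
        simp only [Finset.coe_product, mem_prod, Finset.mem_coe, Finset.mem_powerset]
        exact ⟨Finset.filter_subset _ _, Finset.filter_subset _ _⟩) ?_ (Finset.finite_toSet _)
    intro x hx y hy hxy
    by_contra hne
    simp only [Prod.mk.injEq] at hxy
    rw [mem_extremePoints] at hx hy
    obtain ⟨hx0, hx1⟩ := hx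
    have hy0 := hy.1
    obtain ⟨a1, a2, a3⟩ := hw x hx0.1
    obtain ⟨b1, b2, b3⟩ := hw y hy0.1
    obtain ⟨c1, c2, c3⟩ := hv (A x) hx0.2
    obtain ⟨d1, d2, d3⟩ := hv (A y) hy0.2
    obtain ⟨δ, hδ, h⟩ := exists_extend_weights s (w x) (w y) a1 a2 b1 b2 hxy.1
    obtain ⟨δ', hδ', h'⟩ := exists_extend_weights t (v (A x)) (v (A y)) c1 c2 d1 d2 hxy.2
    rw [a3, b3] at h
    rw [c3, d3] at h'
    set ε := min δ δ' with hεdef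
    have hε : 0 < ε := lt_min hδ hδ'
    have hmem : x + ε • (x - y) ∈ convexHull ℝ (s : Set E) ∩ A ⁻¹' convexHull ℝ (t : Set F) := by
      refine ⟨h ε hε.le (min_le_left _ _), ?_⟩
      have : A (x + ε • (x - y)) = A x + ε • (A x - A y) := by
        have e1 : x + ε • (x - y) = ε • (x - y) +ᵥ x := by rw [vadd_eq_add, add_comm]
        rw [e1, A.map_vadd, map_smul, ← vsub_eq_sub x y, A.linearMap_vsub, vadd_eq_add, add_comm,
          vsub_eq_sub]
      rw [mem_preimage, this]
      exact h' ε hε.le (min_le_right _ _)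
    have hseg : x ∈ openSegment ℝ (x + ε • (x - y)) y := by
      refine ⟨1 / (1 + ε), ε / (1 + ε), by positivity, by positivity, by field_simp, ?_⟩
      have : (1 / (1 + ε)) • (x + ε • (x - y)) + (ε / (1 + ε)) • y
          = ((1 / (1 + ε)) * (1 + ε)) • x := by
        rw [div_eq_mul_one_div ε]
        module
      rw [this, one_div_mul_cancel (by positivity), one_smul]
    exact hne (hx1 _ hmem _ hy0 hseg).2.symm
  refine ⟨hfin.toFinset, ?_⟩
  have := closure_convexHull_extremePoints hcpt hconv
  rw [(hfin.isCompact_convexHull ℝ).isClosed.closure_eq] at this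
  simpa using this.symm

lemma IsPolytope.inter [FiniteDimensional ℝ E] {C D : Set E} (hC : IsPolytope C)
    (hD : IsPolytope D) : IsPolytope (C ∩ D) := by
  simpa using hC.inter_preimage hD (AffineMap.id ℝ E)

/-! ### Finite unions of polytopes -/

/-- A finite union of polytopes. -/
def IsPolytopal (P : Set E) : Prop :=
  ∃ 𝒞 : Set (Set E), 𝒞.Finite ∧ ⋃₀ 𝒞 = P ∧ ∀ C ∈ 𝒞, IsPolytope C

lemma IsPolytope.isPolytopal {C : Set E} (hC : IsPolytope C) : IsPolytopal C :=
  ⟨{C}, by simp, by simp, by simpa⟩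

lemma IsPolytopal.isCompact {P : Set E} (hP : IsPolytopal P) : IsCompact P := by
  obtain ⟨𝒞, hfin, rfl, h⟩ := hP
  exact hfin.isCompact_sUnion fun C hC => (h C hC).isCompact

lemma IsPolytopal.biUnion {ι : Type*} {s : Set ι} (hs : s.Finite) {P : ι → Set E}
    (h : ∀ i ∈ s, IsPolytopal (P i)) : IsPolytopal (⋃ i ∈ s, P i) := by
  choose! 𝒞 hfin hU hp using h
  refine ⟨⋃ i ∈ s, 𝒞 i, hs.biUnion hfin, ?_, ?_⟩
  · rw [sUnion_iUnion]
    refine iUnion_congr fun i => ?_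
    rw [sUnion_iUnion]
    exact iUnion_congr fun hi => hU i hi
  · intro C hC
    obtain ⟨i, hi, hCi⟩ := mem_iUnion₂.1 hC
    exact hp i hi C hCi

lemma IsPolytopal.iUnion {ι : Type*} [Finite ι] {P : ι → Set E}
    (h : ∀ i, IsPolytopal (P i)) : IsPolytopal (⋃ i, P i) := by
  have := IsPolytopal.biUnion (s := univ) finite_univ (P := P) fun i _ => h i
  simpa using this

lemma IsPolytopal.union {P Q : Set E} (hP : IsPolytopal P) (hQ : IsPolytopal Q) :
    IsPolytopal (P ∪ Q) := by
  rw [union_eq_iUnion]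
  exact IsPolytopal.iUnion fun b => by cases b <;> simpa

lemma IsPolytopal.image {P : Set E} (hP : IsPolytopal P) (A : E →ᵃ[ℝ] F) :
    IsPolytopal (A '' P) := by
  obtain ⟨𝒞, hfin, rfl, h⟩ := hP
  rw [sUnion_eq_biUnion, image_iUnion₂]
  exact IsPolytopal.biUnion hfin fun C hC => ((h C hC).image A).isPolytopal

lemma IsPolytopal.prod {P : Set E} {Q : Set F} (hP : IsPolytopal P) (hQ : IsPolytopal Q) :
    IsPolytopal (P ×ˢ Q) := by
  obtain ⟨𝒞, hfin, rfl, h⟩ := hP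
  obtain ⟨𝒟, hfin', rfl, h'⟩ := hQ
  have : (⋃₀ 𝒞) ×ˢ (⋃₀ 𝒟) = ⋃ C ∈ 𝒞, ⋃ D ∈ 𝒟, C ×ˢ D := by
    ext ⟨x, y⟩
    simp only [mem_prod, mem_sUnion, mem_iUnion, exists_prop]
    constructor
    · rintro ⟨⟨C, hC, hx⟩, ⟨D, hD, hy⟩⟩
      exact ⟨C, hC, D, hD, hx, hy⟩
    · rintro ⟨C, hC, D, hD, hx, hy⟩
      exact ⟨⟨C, hC, hx⟩, ⟨D, hD, hy⟩⟩
  rw [this]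
  exact IsPolytopal.biUnion hfin fun C hC => IsPolytopal.biUnion hfin' fun D hD =>
    ((h C hC).prod (h' D hD)).isPolytopal

/-! ### Piecewise linear maps on polytopal sets -/

lemma IsPLOn.isPolytopal {f : E → F} {P : Set E} (hf : IsPLOn f P) : IsPolytopal P := by
  obtain ⟨𝒞, h1, h2, h3⟩ := hf
  exact ⟨𝒞, h1, h2, fun C hC => (h3 C hC).1⟩

lemma IsPolytope.isPLOn {C : Set E} (hC : IsPolytope C) {f : E → F} (A : E →ᵃ[ℝ] F)
    (h : EqOn f A C) : IsPLOn f C :=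
  ⟨{C}, by simp, by simp, by simpa using ⟨hC, A, h⟩⟩

lemma IsPLOn.biUnion {ι : Type*} {s : Set ι} (hs : s.Finite) {P : ι → Set E} {f : E → F}
    (h : ∀ i ∈ s, IsPLOn f (P i)) : IsPLOn f (⋃ i ∈ s, P i) := by
  choose! 𝒞 hfin hU hp using h
  refine ⟨⋃ i ∈ s, 𝒞 i, hs.biUnion hfin, ?_, ?_⟩
  · rw [sUnion_iUnion]
    refine iUnion_congr fun i => ?_
    rw [sUnion_iUnion]
    exact iUnion_congr fun hi => hU i hi
  · intro C hC
    obtain ⟨i, hi, hCi⟩ := mem_iUnion₂.1 hC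
    exact hp i hi C hCi

lemma IsPLOn.sUnion {𝒞 : Set (Set E)} (hs : 𝒞.Finite) {f : E → F}
    (h : ∀ C ∈ 𝒞, IsPLOn f C) : IsPLOn f (⋃₀ 𝒞) := by
  rw [sUnion_eq_biUnion]
  exact IsPLOn.biUnion hs h

lemma IsPLOn.union {P Q : Set E} {f : E → F} (hP : IsPLOn f P) (hQ : IsPLOn f Q) :
    IsPLOn f (P ∪ Q) := by
  rw [← sUnion_pair]
  exact IsPLOn.sUnion (by simp) (by simp [hP, hQ])

lemma IsPLOn.continuousOn [FiniteDimensional ℝ E] {f : E → F} {P : Set E} (hf : IsPLOn f P) :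
    ContinuousOn f P := by
  obtain ⟨𝒞, h1, rfl, h3⟩ := hf
  rw [sUnion_eq_iUnion]
  have : Finite 𝒞 := h1
  refine (locallyFinite_of_finite _).continuousOn_iUnion
    (fun C => (h3 C C.2).1.isCompact.isClosed) fun C => ?_
  obtain ⟨A, hA⟩ := (h3 C C.2).2
  exact A.continuous_of_finiteDimensional.continuousOn.congr hA

lemma IsPLOn.mono [FiniteDimensional ℝ E] {f : E → F} {P Q : Set E} (hf : IsPLOn f P)
    (hQ : IsPolytopal Q) (hQP : Q ⊆ P) : IsPLOn f Q := by
  obtain ⟨𝒞, h1, rfl, h3⟩ := hf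
  obtain ⟨𝒟, h1', rfl, h3'⟩ := hQ
  refine ⟨image2 (fun C D => C ∩ D) 𝒞 𝒟, h1.image2 _ h1', ?_, ?_⟩
  · ext x
    simp only [mem_sUnion, mem_image2]
    constructor
    · rintro ⟨_, ⟨C, hC, D, hD, rfl⟩, hx⟩
      exact ⟨D, hD, hx.2⟩
    · rintro ⟨D, hD, hx⟩
      obtain ⟨C, hC, hxC⟩ := hQP ⟨D, hD, hx⟩
      exact ⟨_, ⟨C, hC, D, hD, rfl⟩, hxC, hx⟩
  · rintro _ ⟨C, hC, D, hD, rfl⟩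
    obtain ⟨A, hA⟩ := (h3 C hC).2
    exact ⟨(h3 C hC).1.inter (h3' D hD), A, hA.mono inter_subset_left⟩

/-- The pieces of the composite are the sets `C ∩ A ⁻¹' D`, which are polytopes by
`IsPolytope.inter_preimage`. -/
lemma IsPLOn.comp [FiniteDimensional ℝ E] {g : F → H} {f : E → F} {P : Set E} {Q : Set F}
    (hg : IsPLOn g Q) (hf : IsPLOn f P) (hPQ : MapsTo f P Q) : IsPLOn (g ∘ f) P := by
  obtain ⟨𝒞, h1, rfl, h3⟩ := hf
  obtain ⟨𝒟, h1', rfl, h3'⟩ := hg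
  choose! hp A hA using h3
  choose! hp' B hB using h3'
  refine ⟨image2 (fun C D => C ∩ A C ⁻¹' D) 𝒞 𝒟, h1.image2 _ h1', ?_, ?_⟩
  · ext x
    simp only [mem_sUnion, mem_image2]
    constructor
    · rintro ⟨_, ⟨C, hC, D, hD, rfl⟩, hx⟩
      exact ⟨C, hC, hx.1⟩
    · rintro ⟨C, hC, hx⟩
      obtain ⟨D, hD, hxD⟩ := hPQ ⟨C, hC, hx⟩
      refine ⟨_, ⟨C, hC, D, hD, rfl⟩, hx, ?_⟩
      rwa [mem_preimage, ← hA C hC hx]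
  · rintro _ ⟨C, hC, D, hD, rfl⟩
    refine ⟨(hp C hC).inter_preimage (hp' D hD) (A C), (B D).comp (A C), fun x hx => ?_⟩
    rw [AffineMap.comp_apply, Function.comp_apply, hA C hC hx.1, hB D hD hx.2]

lemma IsPLOn.image_isPolytopal {f : E → F} {P : Set E} (hf : IsPLOn f P) :
    IsPolytopal (f '' P) := by
  obtain ⟨𝒞, h1, rfl, h3⟩ := hf
  rw [sUnion_eq_biUnion, image_iUnion₂]
  refine IsPolytopal.biUnion h1 fun C hC => ?_
  obtain ⟨A, hA⟩ := (h3 C hC).2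
  rw [hA.image_eq]
  exact ((h3 C hC).1.image A).isPolytopal

lemma IsPLOn.prodMk [FiniteDimensional ℝ E] {f : E → F} {g : E → H} {P : Set E}
    (hf : IsPLOn f P) (hg : IsPLOn g P) : IsPLOn (fun x => (f x, g x)) P := by
  obtain ⟨𝒞, h1, rfl, h3⟩ := hf
  obtain ⟨𝒟, h1', h2', h3'⟩ := hg
  refine ⟨image2 (fun C D => C ∩ D) 𝒞 𝒟, h1.image2 _ h1', ?_, ?_⟩
  · ext x
    simp only [mem_sUnion, mem_image2]
    constructor
    · rintro ⟨_, ⟨C, hC, D, hD, rfl⟩, hx⟩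
      exact ⟨C, hC, hx.1⟩
    · rintro ⟨C, hC, hx⟩
      obtain ⟨D, hD, hxD⟩ : x ∈ ⋃₀ 𝒟 := h2' ▸ ⟨C, hC, hx⟩
      exact ⟨_, ⟨C, hC, D, hD, rfl⟩, hx, hxD⟩
  · rintro _ ⟨C, hC, D, hD, rfl⟩
    obtain ⟨A, hA⟩ := (h3 C hC).2
    obtain ⟨B, hB⟩ := (h3' D hD).2
    exact ⟨(h3 C hC).1.inter (h3' D hD).1, A.prod B, fun x hx => by
      simp [hA hx.1, hB hx.2]⟩

/-- In the span of the differences of a convex set every vector is a multiple of a difference. -/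
lemma exists_smul_sub_of_mem_vectorSpan {C : Set E} (hC : Convex ℝ C) (hne : C.Nonempty) {v : E}
    (hv : v ∈ vectorSpan ℝ C) : ∃ t : ℝ, 0 ≤ t ∧ ∃ c ∈ C, ∃ d ∈ C, v = t • (c - d) := by
  obtain ⟨x, hx⟩ := hne
  rw [vectorSpan_def] at hv
  induction hv using Submodule.span_induction with
  | mem v hv =>
    obtain ⟨c, hc, d, hd, rfl⟩ := hv
    exact ⟨1, zero_le_one, c, hc, d, hd, by simp⟩
  | zero => exact ⟨0, le_rfl, x, hx, x, hx, by simp⟩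
  | add v w _ _ hv hw =>
    obtain ⟨t, ht, c, hc, d, hd, rfl⟩ := hv
    obtain ⟨t', ht', c', hc', d', hd', rfl⟩ := hw
    rcases (add_nonneg ht ht').eq_or_lt with h0 | hpos
    · have h1 : t = 0 := by linarith
      have h2 : t' = 0 := by linarith
      exact ⟨0, le_rfl, x, hx, x, hx, by simp [h1, h2]⟩
    · have hs : t / (t + t') + t' / (t + t') = 1 := by field_simp
      refine ⟨t + t', hpos.le, _, hC hc hc' (div_nonneg ht hpos.le) (div_nonneg ht' hpos.le) hs,
        _, hC hd hd' (div_nonneg ht hpos.le) (div_nonneg ht' hpos.le) hs, ?_⟩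
      have e1 : (t + t') * (t / (t + t')) = t := mul_div_cancel₀ _ hpos.ne'
      have e2 : (t + t') * (t' / (t + t')) = t' := mul_div_cancel₀ _ hpos.ne'
      simp only [smul_sub, smul_add, smul_smul, e1, e2]
      abel
  | smul a v _ hv =>
    obtain ⟨t, ht, c, hc, d, hd, rfl⟩ := hv
    rcases le_total 0 a with ha | ha
    · exact ⟨a * t, mul_nonneg ha ht, c, hc, d, hd, by rw [mul_smul]⟩
    · exact ⟨-a * t, mul_nonneg (neg_nonneg.2 ha) ht, d, hd, c, hc, by module⟩

/-- An affine map that is injective on a convex set has an affine left inverse there. -/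
lemma exists_affine_leftInverse {C : Set E} (hC : Convex ℝ C) (A : E →ᵃ[ℝ] F) (hA : InjOn A C) :
    ∃ B : F →ᵃ[ℝ] E, ∀ x ∈ C, B (A x) = x := by
  rcases C.eq_empty_or_nonempty with rfl | ⟨x, hx⟩
  · exact ⟨AffineMap.const ℝ F 0, by simp⟩
  -- Every direction of a convex set is a multiple of a difference of two of its points, so
  -- injectivity on `C` passes to the linear part.
  have hker : (A.linear.domRestrict (vectorSpan ℝ C)).ker = ⊥ := by
    rw [LinearMap.ker_eq_bot']
    rintro ⟨v, hv⟩ h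
    obtain ⟨t, ht, c, hc, d, hd, rfl⟩ := exists_smul_sub_of_mem_vectorSpan hC ⟨x, hx⟩ hv
    rw [LinearMap.domRestrict_apply, map_smul, ← vsub_eq_sub c d, A.linearMap_vsub,
      smul_eq_zero] at h
    rcases h with h | h
    · simp [h]
    · have : c = d := hA hc hd (vsub_eq_zero_iff_eq.1 h)
      simp [this]
  obtain ⟨g, hg⟩ := LinearMap.exists_leftInverse_of_injective _ hker
  refine ⟨AffineMap.mk' (fun y => x + (vectorSpan ℝ C).subtype (g (y - A x)))
    ((vectorSpan ℝ C).subtype ∘ₗ g) (A x) (fun y => by simp [add_comm]), fun z hz => ?_⟩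
  have hz' : z - x ∈ vectorSpan ℝ C := vsub_mem_vectorSpan ℝ hz hx
  have h1 := LinearMap.congr_fun hg ⟨z - x, hz'⟩
  have h2 : A.linear.domRestrict (vectorSpan ℝ C) ⟨z - x, hz'⟩ = A z - A x := by
    rw [LinearMap.domRestrict_apply]
    exact A.linearMap_vsub z x
  rw [LinearMap.comp_apply, h2] at h1
  change x + ((g (A z - A x) : vectorSpan ℝ C) : E) = z
  rw [h1]
  simp

/-- Each affine piece is injective, hence has an affine left inverse on its image, again a polytope.
As `g` is an arbitrary function, later charts need formulas for piecewise linearity in one direction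
only. -/
lemma IsPLOn.leftInverse {f : E → F} {g : F → E} {P : Set E} (hf : IsPLOn f P)
    (hg : ∀ x ∈ P, g (f x) = x) : IsPLOn g (f '' P) := by
  obtain ⟨𝒞, h1, rfl, h3⟩ := hf
  rw [sUnion_eq_biUnion, image_iUnion₂]
  refine IsPLOn.biUnion h1 fun C hC => ?_
  obtain ⟨hp, A, hA⟩ := h3 C hC
  have hinj : InjOn A C := fun x hx y hy hxy => by
    rw [← hA hx, ← hA hy] at hxy
    rw [← hg x ⟨C, hC, hx⟩, ← hg y ⟨C, hC, hy⟩, hxy]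
  obtain ⟨B, hB⟩ := exists_affine_leftInverse hp.convex A hinj
  rw [hA.image_eq]
  refine (hp.image A).isPLOn B ?_
  rintro _ ⟨x, hx, rfl⟩
  rw [hB x hx, ← hA hx, hg x ⟨C, hC, hx⟩]

/-- The inverse of a piecewise linear bijection is piecewise linear. -/
lemma IsPLOn.exists_inverse [Nonempty E] {f : E → F} {P : Set E} {Q : Set F} (hf : IsPLOn f P)
    (hb : BijOn f P Q) : ∃ g : F → E, IsPLOn g Q ∧ BijOn g Q P ∧ (∀ x ∈ P, g (f x) = x) ∧
      ∀ y ∈ Q, f (g y) = y := by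
  have hinv := hb.invOn_invFunOn
  refine ⟨Function.invFunOn f P, ?_, hinv.symm.bijOn (hb.surjOn.mapsTo_invFunOn) hb.mapsTo,
    fun x hx => hinv.1 hx, fun y hy => hinv.2 hy⟩
  rw [← hb.image_eq]
  exact hf.leftInverse fun x hx => hinv.1 hx

/-- On a segment, a piecewise linear map is affine near the starting point. -/
lemma IsPLOn.exists_affine_germ {f : E → F} {P : Set E} (hf : IsPLOn f P) {x u : E}
    (hseg : ∀ t ∈ Icc (0 : ℝ) 1, x + t • u ∈ P) :
    ∃ ε, 0 < ε ∧ ε ≤ 1 ∧ ∃ w : F, ∀ t ∈ Icc (0 : ℝ) ε, f (x + t • u) = f x + t • w := by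
  obtain ⟨𝒞, h1, rfl, h3⟩ := hf
  -- Finitely many pieces cover the segment, so one of them meets it arbitrarily close to `x`. Being
  -- closed and convex, that piece contains `x` and a whole initial segment.
  obtain ⟨C, hC, hfreq⟩ : ∃ C ∈ 𝒞, ∃ᶠ t in 𝓝[>] (0 : ℝ), x + t • u ∈ C := by
    by_contra! hcon
    have h := (Filter.eventually_all_finite h1).2 hcon
    have h' : ∀ᶠ t in 𝓝[>] (0 : ℝ), t ∈ Ioc (0 : ℝ) 1 := Ioc_mem_nhdsGT one_pos
    obtain ⟨t, ht, ht'⟩ := (h.and h').exists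
    obtain ⟨C, hC, hmem⟩ := hseg t ⟨ht'.1.le, ht'.2⟩
    exact ht C hC hmem
  have hcont : Continuous fun t : ℝ => x + t • u := by fun_prop
  obtain ⟨hp, A, hA⟩ := h3 C hC
  have h0 : x ∈ C := by
    have hcl : IsClosed ((fun t : ℝ => x + t • u) ⁻¹' C) := hp.isCompact.isClosed.preimage hcont
    have := hcl.closure_eq ▸ (mem_closure_iff_frequently.2
      (hfreq.filter_mono nhdsWithin_le_nhds : ∃ᶠ t in 𝓝 (0:ℝ), t ∈ (fun t : ℝ => x + t • u) ⁻¹' C))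
    simpa using this
  obtain ⟨ε, hε, hε'⟩ := (hfreq.and_eventually (Ioc_mem_nhdsGT one_pos :
    ∀ᶠ t in 𝓝[>] (0 : ℝ), t ∈ Ioc (0 : ℝ) 1)).exists
  refine ⟨ε, hε'.1, hε'.2, A.linear u, fun t ht => ?_⟩
  have hmem : x + t • u ∈ C := by
    have := hp.convex.add_smul_mem h0 hε (t := t / ε)
      ⟨div_nonneg ht.1 hε'.1.le, (div_le_one hε'.1).2 ht.2⟩
    rwa [smul_smul, div_mul_cancel₀ _ hε'.1.ne'] at this
  rw [hA hmem, hA h0, add_comm x, ← vadd_eq_add, A.map_vadd, map_smul, vadd_eq_add, add_comm]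

/-! ### Maps that are piecewise linear on every polytope -/

/-- A map that is piecewise linear on every polytope. -/
def IsPL (f : E → F) : Prop := ∀ C : Set E, IsPolytope C → IsPLOn f C

lemma IsPL.isPLOn {f : E → F} (hf : IsPL f) {P : Set E} (hP : IsPolytopal P) : IsPLOn f P := by
  obtain ⟨𝒞, h1, rfl, h3⟩ := hP
  exact IsPLOn.sUnion h1 fun C hC => hf C (h3 C hC)

lemma IsPL.of_affine (A : E →ᵃ[ℝ] F) : IsPL A := fun _ hC => hC.isPLOn A fun _ _ => rfl

lemma IsPL.of_linear (A : E →ₗ[ℝ] F) : IsPL A := IsPL.of_affine A.toAffineMap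

lemma IsPL.const (c : F) : IsPL (fun _ : E => c) := IsPL.of_affine (AffineMap.const ℝ E c)

lemma IsPL.comp [FiniteDimensional ℝ E] {g : F → H} {f : E → F} (hg : IsPL g) (hf : IsPL f) :
    IsPL (fun x => g (f x)) := fun C hC =>
  (hg.isPLOn (hf C hC).image_isPolytopal).comp (hf C hC) (mapsTo_image f C)

lemma IsPL.prodMk [FiniteDimensional ℝ E] {f : E → F} {g : E → H} (hf : IsPL f) (hg : IsPL g) :
    IsPL (fun x => (f x, g x)) := fun C hC => (hf C hC).prodMk (hg C hC)

lemma IsPL.fst : IsPL (fun x : E × F => x.1) := IsPL.of_linear (LinearMap.fst ℝ E F)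

lemma IsPL.snd : IsPL (fun x : E × F => x.2) := IsPL.of_linear (LinearMap.snd ℝ E F)

lemma IsPL.apply {ι : Type*} [Fintype ι] (i : ι) : IsPL (fun x : ι → ℝ => x i) :=
  IsPL.of_linear (LinearMap.proj (φ := fun _ : ι => ℝ) i)

lemma IsPL.add [FiniteDimensional ℝ E] {f g : E → F} (hf : IsPL f) (hg : IsPL g) :
    IsPL (fun x => f x + g x) := by
  have : IsPL (fun p : F × F => p.1 + p.2) :=
    IsPL.of_linear (LinearMap.fst ℝ F F + LinearMap.snd ℝ F F)
  intro C hC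
  exact (this.isPLOn ((hf C hC).prodMk (hg C hC)).image_isPolytopal).comp
    ((hf C hC).prodMk (hg C hC)) (mapsTo_image _ C)

lemma IsPL.const_smul [FiniteDimensional ℝ E] {f : E → F} (hf : IsPL f) (c : ℝ) :
    IsPL (fun x => c • f x) := fun C hC => by
  have : IsPL (fun y : F => c • y) := IsPL.of_linear (c • LinearMap.id : F →ₗ[ℝ] F)
  exact (this.isPLOn (hf C hC).image_isPolytopal).comp (hf C hC) (mapsTo_image f C)

lemma IsPL.const_mul [FiniteDimensional ℝ E] {f : E → ℝ} (hf : IsPL f) (c : ℝ) :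
    IsPL (fun x => c * f x) := hf.const_smul c

lemma IsPL.div_const [FiniteDimensional ℝ E] {f : E → ℝ} (hf : IsPL f) (c : ℝ) :
    IsPL (fun x => f x / c) := by
  simpa only [div_eq_inv_mul] using hf.const_mul c⁻¹

lemma IsPL.smul_const [FiniteDimensional ℝ E] {f : E → ℝ} (hf : IsPL f) (v : F) :
    IsPL (fun x => f x • v) := (IsPL.of_linear (LinearMap.toSpanSingleton ℝ F v)).comp hf

lemma IsPL.neg [FiniteDimensional ℝ E] {f : E → F} (hf : IsPL f) : IsPL (fun x => -f x) := by
  simpa using hf.const_smul (-1)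

lemma IsPL.sub [FiniteDimensional ℝ E] {f g : E → F} (hf : IsPL f) (hg : IsPL g) :
    IsPL (fun x => f x - g x) := by
  simpa only [sub_eq_add_neg] using hf.add hg.neg

/-- The one nonlinear building block, from which `max`, `min` and the absolute value are derived.
Boundedness of `C` allows the two half-lines to be replaced by polytopes. -/
lemma isPL_posPart : IsPL (fun x : ℝ => max x 0) := by
  intro C hC
  obtain ⟨M, hM⟩ := hC.isCompact.isBounded.subset_closedBall 0
  rw [Real.closedBall_eq_Icc, zero_sub, zero_add] at hM
  have hCeq : C = (C ∩ Icc 0 M) ∪ (C ∩ Icc (-M) 0) := by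
    ext x
    constructor
    · intro hx
      have := hM hx
      rcases le_total 0 x with h | h
      · exact Or.inl ⟨hx, h, this.2⟩
      · exact Or.inr ⟨hx, this.1, h⟩
    · rintro (h | h) <;> exact h.1
  rw [hCeq]
  refine ((hC.inter (isPolytope_Icc 0 M)).isPLOn (AffineMap.id ℝ ℝ) ?_).union
    ((hC.inter (isPolytope_Icc (-M) 0)).isPLOn (AffineMap.const ℝ ℝ 0) ?_)
  · intro x hx
    simp [hx.2.1]
  · intro x hx
    simp [hx.2.2]

lemma IsPL.max [FiniteDimensional ℝ E] {f g : E → ℝ} (hf : IsPL f) (hg : IsPL g) :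
    IsPL (fun x => max (f x) (g x)) := by
  have h := (isPL_posPart.comp (hf.sub hg)).add hg
  have : (fun x => Max.max (f x) (g x)) = fun x => Max.max (f x - g x) 0 + g x := by
    ext x
    rw [← max_add_add_right]
    simp
  rwa [this]

lemma IsPL.min [FiniteDimensional ℝ E] {f g : E → ℝ} (hf : IsPL f) (hg : IsPL g) :
    IsPL (fun x => min (f x) (g x)) := by
  have h := (hf.neg.max hg.neg).neg
  simpa only [max_neg_neg, neg_neg] using h

lemma IsPL.abs [FiniteDimensional ℝ E] {f : E → ℝ} (hf : IsPL f) : IsPL (fun x => |f x|) :=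
  hf.max hf.neg

lemma IsPL.sum [FiniteDimensional ℝ E] {ι : Type*} (s : Finset ι) {f : ι → E → F}
    (hf : ∀ i ∈ s, IsPL (f i)) : IsPL (fun x => ∑ i ∈ s, f i x) := by
  classical
  induction s using Finset.induction_on with
  | empty => simpa using IsPL.const 0
  | insert a s ha ih =>
    simp only [Finset.sum_insert ha]
    exact (hf a (by simp)).add (ih fun i hi => hf i (by simp [hi]))

lemma IsPL.pi [FiniteDimensional ℝ E] {ι : Type*} [Fintype ι] {f : ι → E → ℝ}
    (hf : ∀ i, IsPL (f i)) : IsPL (fun x i => f i x) := by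
  classical
  have h := IsPL.sum Finset.univ (f := fun i x => f i x • (Pi.single i (1 : ℝ) : ι → ℝ))
    fun i _ => (hf i).smul_const _
  convert h using 2 with x
  ext j
  simp [Finset.sum_apply, Pi.single_apply]

end PLCalculus

end PLTop

namespace PLTop

/-! ### Conical neighbourhoods in finite unions of polytopes. -/

section Polyhedra

variable {E : Type*} [NormedAddCommGroup E] [NormedSpace ℝ E]

/-! ### Finite unions of polytopes are polyhedra -/

/-- A simplex is conical near each of its points. -/
lemma exists_conical_radius_of_affineIndependent [FiniteDimensional ℝ E] {s : Finset E}
    (hs : AffineIndependent ℝ ((↑) : s → E)) {x : E} (hx : x ∈ convexHull ℝ (s : Set E)) :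
    ∃ ε : ℝ, 0 < ε ∧ ∀ y ∈ convexHull ℝ (s : Set E), ∀ τ : ℝ, 0 ≤ τ → τ * ‖y - x‖ ≤ ε →
      x + τ • (y - x) ∈ convexHull ℝ (s : Set E) := by
  set A : (s → ℝ) →ₗ[ℝ] E := Fintype.linearCombination ℝ ((↑) : s → E) with hA
  have hAapp : ∀ w, A w = ∑ p, w p • (p : E) := fun w => Fintype.linearCombination_apply ..
  have hmem : ∀ y, y ∈ convexHull ℝ (s : Set E) ↔ ∃ w ∈ stdSimplex ℝ s, A w = y := by
    intro y
    constructor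
    · intro hy
      obtain ⟨w, hw0, hw1, rfl⟩ := Finset.mem_convexHull'.1 hy
      refine ⟨fun p => w p, ⟨fun p => hw0 p p.2, ?_⟩, ?_⟩
      · rw [← hw1, Finset.sum_coe_sort s w]
      · rw [hAapp, Finset.sum_coe_sort s fun p => w p • p]
    · rintro ⟨w, hw, rfl⟩
      rw [hAapp]
      exact (convex_convexHull ℝ _).sum_mem (fun p _ => hw.1 p) hw.2
        fun p _ => subset_convexHull ℝ _ p.2
  have hinj : InjOn A.toAffineMap (stdSimplex ℝ s) := by
    intro v hv w hw hvw
    have h1 : ∑ p, (v p - w p) = 0 := by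
      rw [Finset.sum_sub_distrib, hv.2, hw.2, sub_self]
    have h2 : ∑ p, (v p - w p) • (p : E) = 0 := by
      have : A v = A w := hvw
      rw [hAapp, hAapp] at this
      simp only [sub_smul, Finset.sum_sub_distrib, this, sub_self]
    have h3 := affineIndependent_iff.1 hs Finset.univ (fun p => v p - w p) h1 h2
    ext p
    exact sub_eq_zero.1 (h3 p (Finset.mem_univ p))
  -- Barycentric coordinates are restrictions of the affine map `B`, hence Lipschitz. A displacement
  -- of length at most `δ / (‖L‖ + 1)` changes each of them by at most `δ`, the least positive
  -- coordinate of `x`; coordinates that vanish at `x` can only grow.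
  obtain ⟨B, hB⟩ := exists_affine_leftInverse (convex_stdSimplex ℝ s) A.toAffineMap hinj
  obtain ⟨w, hw, rfl⟩ := (hmem x).1 hx
  set L := LinearMap.toContinuousLinearMap B.linear with hL
  obtain ⟨δ, hδ, hδw⟩ : ∃ δ : ℝ, 0 < δ ∧ ∀ p, 0 < w p → δ ≤ w p := by
    have hne : (Finset.univ.filter (fun p => 0 < w p)).Nonempty := by
      by_contra hcon
      rw [Finset.not_nonempty_iff_eq_empty, Finset.filter_eq_empty_iff] at hcon
      have : ∑ p, w p ≤ 0 := Finset.sum_nonpos fun p hp => not_lt.1 (hcon hp)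
      linarith [hw.2]
    obtain ⟨q, hq, hmin⟩ := Finset.exists_min_image _ w hne
    exact ⟨w q, (Finset.mem_filter.1 hq).2, fun p hpw => hmin p (by simp [hpw])⟩
  refine ⟨δ / (‖L‖ + 1), by positivity, fun y hy τ hτ hle => ?_⟩
  obtain ⟨v, hv, rfl⟩ := (hmem y).1 hy
  have hvw : v - w = L (A v - A w) := by
    have h1 := hB v hv
    have h2 := hB w hw
    have h3 : L (A v - A w) = B (A v) - B (A w) := B.linearMap_vsub (A v) (A w)
    rw [h3]
    simp only [LinearMap.coe_toAffineMap] at h1 h2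
    rw [h1, h2]
  have hbound : ∀ p, |τ * (v p - w p)| ≤ δ := by
    intro p
    have h1 : |v p - w p| ≤ ‖L‖ * ‖A v - A w‖ := by
      calc |v p - w p| = ‖(v - w) p‖ := rfl
        _ ≤ ‖v - w‖ := norm_le_pi_norm (v - w) p
        _ ≤ _ := by rw [hvw]; exact L.le_opNorm _
    rw [abs_mul, abs_of_nonneg hτ]
    calc τ * |v p - w p| ≤ τ * ((‖L‖ + 1) * ‖A v - A w‖) := by
          gcongr
          exact h1.trans (by gcongr; linarith)
      _ = (‖L‖ + 1) * (τ * ‖A v - A w‖) := by ring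
      _ ≤ (‖L‖ + 1) * (δ / (‖L‖ + 1)) := by gcongr
      _ = δ := by field_simp
  refine (hmem _).2 ⟨w + τ • (v - w), ⟨fun p => ?_, ?_⟩, by simp⟩
  · have h1 := abs_le.1 (hbound p)
    simp only [Pi.add_apply, Pi.smul_apply, Pi.sub_apply, smul_eq_mul]
    rcases (hw.1 p).eq_or_lt with h0 | hpos
    · rw [← h0]
      have := mul_nonneg hτ (hv.1 p)
      simpa using this
    · have := hδw p hpos
      linarith
  · have h1 := hw.2
    have h2 := hv.2
    simp only [Pi.add_apply, Pi.smul_apply, Pi.sub_apply, smul_eq_mul, Finset.sum_add_distrib,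
      ← Finset.mul_sum, Finset.sum_sub_distrib, h1, h2]
    simp

/-- A polytope is conical near each of its points. -/
lemma IsPolytope.exists_conical_radius [FiniteDimensional ℝ E] {C : Set E} (hC : IsPolytope C)
    {x : E} (hx : x ∈ C) :
    ∃ ε : ℝ, 0 < ε ∧ ∀ y ∈ C, ∀ τ : ℝ, 0 ≤ τ → τ * ‖y - x‖ ≤ ε → x + τ • (y - x) ∈ C := by
  obtain ⟨s, rfl⟩ := hC
  -- By Carathéodory the polytope is a union of simplices on its vertices. A simplex through `x` is
  -- covered by the preceding lemma. One that misses `x` stays at distance at least some `ε`, which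
  -- forces `τ ≤ 1`, and convexity of the whole polytope suffices.
  have key : ∀ t ∈ s.powerset, AffineIndependent ℝ ((↑) : t → E) → ∃ ε : ℝ, 0 < ε ∧
      ∀ y ∈ convexHull ℝ (t : Set E), ∀ τ : ℝ, 0 ≤ τ → τ * ‖y - x‖ ≤ ε →
        x + τ • (y - x) ∈ convexHull ℝ (s : Set E) := by
    intro t ht hind
    have hts : convexHull ℝ (t : Set E) ⊆ convexHull ℝ (s : Set E) :=
      convexHull_mono (by exact_mod_cast Finset.mem_powerset.1 ht)
    by_cases hxt : x ∈ convexHull ℝ (t : Set E)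
    · obtain ⟨ε, hε, h⟩ := exists_conical_radius_of_affineIndependent hind hxt
      exact ⟨ε, hε, fun y hy τ hτ hle => hts (h y hy τ hτ hle)⟩
    · have hcl : IsClosed (convexHull ℝ (t : Set E)) :=
        (t.finite_toSet.isCompact_convexHull ℝ).isClosed
      obtain ⟨ε, hε, hball⟩ := Metric.isOpen_iff.1 hcl.isOpen_compl x hxt
      refine ⟨ε, hε, fun y hy τ hτ hle => ?_⟩
      have hd : ε ≤ ‖y - x‖ := by
        by_contra hcon
        exact hball (by rw [Metric.mem_ball, dist_eq_norm]; exact not_le.1 hcon) hy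
      have hτ1 : τ ≤ 1 := by
        by_contra hcon
        nlinarith
      exact (convex_convexHull ℝ _).add_smul_sub_mem hx (hts hy) ⟨hτ, hτ1⟩
  choose! ε hε h using key
  obtain ⟨δ, hδ, hδε⟩ : ∃ δ : ℝ, 0 < δ ∧ ∀ t ∈ s.powerset,
      AffineIndependent ℝ ((↑) : t → E) → δ ≤ ε t := by
    classical
    obtain ⟨q, hq, hmin⟩ := Finset.exists_min_image
      (insert ∅ (s.powerset.filter fun t : Finset E => AffineIndependent ℝ ((↑) : t → E)))
      (fun t => if t = ∅ then 1 else ε t) ⟨_, Finset.mem_insert_self _ _⟩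
    have h0 : ∅ ∈ s.powerset := Finset.empty_mem_powerset s
    have h0' : AffineIndependent ℝ ((↑) : (∅ : Finset E) → E) :=
      affineIndependent_of_subsingleton ℝ _
    refine ⟨min (if q = ∅ then 1 else ε q) (ε ∅), lt_min ?_ (hε _ h0 h0'), fun t ht hind => ?_⟩
    · split_ifs with hq0
      · exact one_pos
      · rcases Finset.mem_insert.1 hq with hq | hq
        · exact absurd hq hq0
        · exact hε q (Finset.mem_filter.1 hq).1 (Finset.mem_filter.1 hq).2
    · by_cases ht0 : t = ∅
      · subst ht0
        exact min_le_right _ _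
      · have := hmin t (Finset.mem_insert_of_mem (Finset.mem_filter.2 ⟨ht, hind⟩))
        rw [if_neg ht0] at this
        exact (min_le_left _ _).trans this
  refine ⟨δ, hδ, fun y hy τ hτ hle => ?_⟩
  have hy' := hy
  rw [convexHull_eq_union] at hy'
  simp only [mem_iUnion] at hy'
  obtain ⟨t, ht, hind, hyt⟩ := hy'
  have htm : t ∈ s.powerset := Finset.mem_powerset.2 (by exact_mod_cast ht)
  exact h t htm hind y hyt τ hτ (hle.trans (hδε t htm hind))

lemma IsPolytopal.isPolyhedron [FiniteDimensional ℝ E] {P : Set E} (hP : IsPolytopal P) :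
    IsPolyhedron P := by
  have hcpt := hP.isCompact
  obtain ⟨𝒞, hfin, rfl, hpoly⟩ := hP
  intro x hx
  have key : ∀ C ∈ 𝒞, ∃ ε : ℝ, 0 < ε ∧ (∀ y ∈ C, ‖y - x‖ ≤ ε → x ∈ C) ∧
      ∀ y ∈ C, x ∈ C → ∀ τ : ℝ, 0 ≤ τ → τ * ‖y - x‖ ≤ ε → x + τ • (y - x) ∈ C := by
    intro C hC
    by_cases hxC : x ∈ C
    · obtain ⟨ε, hε, h⟩ := (hpoly C hC).exists_conical_radius hxC
      exact ⟨ε, hε, fun _ _ _ => hxC, fun y hy _ => h y hy⟩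
    · obtain ⟨ε, hε, hball⟩ :=
        Metric.isOpen_iff.1 (hpoly C hC).isCompact.isClosed.isOpen_compl x hxC
      refine ⟨ε / 2, by positivity, fun y hy hyx => ?_, fun _ _ h => absurd h hxC⟩
      exact absurd hy (hball (by rw [Metric.mem_ball, dist_eq_norm]; linarith))
  choose! ε hε h1 h2 using key
  obtain ⟨δ, hδ, hδε⟩ : ∃ δ : ℝ, 0 < δ ∧ ∀ C ∈ 𝒞, δ ≤ ε C := by
    obtain ⟨C₀, hC₀, -⟩ := hx
    obtain ⟨q, hq, hmin⟩ := hfin.toFinset.exists_min_image ε ⟨C₀, by simpa⟩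
    exact ⟨ε q, hε q (by simpa using hq), fun C hC => hmin C (by simpa using hC)⟩
  -- The base of the cone is the section by a sphere so small that every piece meeting the closed
  -- ball contains `x` and is conical there.
  refine ⟨⋃₀ 𝒞 ∩ Metric.sphere x δ, hcpt.inter_right Metric.isClosed_sphere, ⟨?_, ?_⟩, ?_, ?_⟩
  · rintro ⟨-, h⟩
    simp only [mem_sphere_iff_norm, sub_self, norm_zero] at h
    exact hδ.ne h
  · rintro y ⟨-, hy⟩ y' ⟨-, hy'⟩ z hz hzy hzy'
    rw [segment_eq_image'] at hzy hzy'
    obtain ⟨a, ha, rfl⟩ := hzy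
    obtain ⟨b, hb, hab⟩ := hzy'
    rw [mem_sphere_iff_norm] at hy hy'
    have h3 : b • (y' - x) = a • (y - x) := by simpa using hab
    have h4 := congrArg norm h3
    rw [norm_smul, norm_smul, hy, hy', Real.norm_of_nonneg ha.1, Real.norm_of_nonneg hb.1] at h4
    have h5 : b = a := mul_right_cancel₀ hδ.ne' h4
    subst h5
    have hb0 : b ≠ 0 := fun h => hz (by simp [h])
    have := smul_right_injective E hb0 h3
    simpa using this.symm
  · rintro z (rfl | ⟨y, ⟨⟨C, hC, hyC⟩, hy⟩, hz⟩)
    · exact hx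
    · have hxC := h1 C hC y hyC ((mem_sphere_iff_norm.1 hy).le.trans (hδε C hC))
      exact ⟨C, hC, (hpoly C hC).convex.segment_subset hxC hyC hz⟩
  · refine mem_nhdsWithin.2 ⟨Metric.ball x δ, Metric.isOpen_ball, Metric.mem_ball_self hδ, ?_⟩
    rintro z ⟨hz, C, hC, hzC⟩
    rw [Metric.mem_ball, dist_eq_norm] at hz
    by_cases hzx : z = x
    · exact Or.inl hzx
    · have hn : 0 < ‖z - x‖ := norm_pos_iff.2 (sub_ne_zero.2 hzx)
      have hxC := h1 C hC z hzC (hz.le.trans (hδε C hC))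
      have he : δ / ‖z - x‖ * ‖z - x‖ = δ := div_mul_cancel₀ _ hn.ne'
      refine Or.inr ⟨x + (δ / ‖z - x‖) • (z - x),
        ⟨⟨C, hC, h2 C hC z hzC hxC _ (by positivity) (by rw [he]; exact hδε C hC)⟩, ?_⟩, ?_⟩
      · rw [mem_sphere_iff_norm, add_sub_cancel_left, norm_smul, Real.norm_of_nonneg
          (by positivity), he]
      · rw [segment_eq_image']
        refine ⟨‖z - x‖ / δ, ⟨by positivity, (div_le_one hδ).2 hz.le⟩, ?_⟩
        simp only [add_sub_cancel_left, smul_smul]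
        rw [show ‖z - x‖ / δ * (δ / ‖z - x‖) = 1 by field_simp, one_smul]
        abel

end Polyhedra

end PLTop

namespace PLTop

/-! ### Leg coordinates and recognition of the local models. -/

section Models

variable {E F : Type*} [NormedAddCommGroup E] [NormedSpace ℝ E]
  [NormedAddCommGroup F] [NormedSpace ℝ F]

/-! ### Leg coordinates on the local models -/

/-- Nonnegative coordinates, at most `k` of which are nonzero. -/
def IsLeg (k : ℕ) {ι : Type*} (y : ι → ℝ) : Prop := (∀ i, 0 ≤ y i) ∧ {i | y i ≠ 0}.ncard ≤ k

/-- The point with barycentric coordinates `y`, the remaining weight being put on the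
barycentre. -/
noncomputable def conePt (k : ℕ) (y : Fin (k + 2) → ℝ) : Fin (k + 2) → ℝ :=
  fun i => 1 / ((k : ℝ) + 2) + y i - (∑ j, y j) / ((k : ℝ) + 2)

/-- The difference of the coordinates of a point and its smallest coordinate. -/
noncomputable def legCoord (k : ℕ) (x : Fin (k + 2) → ℝ) : Fin (k + 2) → ℝ :=
  fun i => x i - Finset.univ.inf' Finset.univ_nonempty x

/-- The model cone. -/
def modelCone (k : ℕ) : Set (Fin (k + 2) → ℝ) := coneSet (barycentre k) (codimTwoSkeleton k)

@[simp] lemma conePt_zero (k : ℕ) : conePt k 0 = barycentre k := by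
  ext i
  simp [conePt, barycentre]

lemma conePt_add_smul (k : ℕ) (y y' : Fin (k + 2) → ℝ) (t : ℝ) :
    conePt k (y + t • (y' - y)) = conePt k y + t • (conePt k y' - conePt k y) := by
  ext i
  simp only [conePt, Pi.add_apply, Pi.smul_apply, Pi.sub_apply, smul_eq_mul,
    Finset.sum_add_distrib, ← Finset.mul_sum, Finset.sum_sub_distrib]
  ring

lemma conePt_smul (k : ℕ) (y : Fin (k + 2) → ℝ) (t : ℝ) :
    conePt k (t • y) = barycentre k + t • (conePt k y - barycentre k) := by
  simpa using conePt_add_smul k 0 y t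

lemma isPL_conePt (k : ℕ) : IsPL (conePt k) :=
  IsPL.pi fun i => ((IsPL.const _).add (IsPL.apply i)).sub
    ((IsPL.sum _ fun j _ => IsPL.apply j).div_const _)

lemma continuous_conePt (k : ℕ) : Continuous (conePt k) := by
  unfold conePt
  fun_prop

lemma ncard_ne_zero_smul {ι : Type*} (y : ι → ℝ) {t : ℝ} (ht : t ≠ 0) :
    {i | (t • y) i ≠ 0} = {i | y i ≠ 0} := by
  ext i
  simp [ht]

lemma IsLeg.smul {k : ℕ} {ι : Type*} {y : ι → ℝ} (hy : IsLeg k y) {t : ℝ} (ht : 0 ≤ t) :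
    IsLeg k (t • y) := by
  rcases ht.eq_or_lt with rfl | ht
  · simp [IsLeg]
  · refine ⟨fun i => mul_nonneg ht.le (hy.1 i), ?_⟩
    rw [ncard_ne_zero_smul y ht.ne']
    exact hy.2

/-- On the skeleton the coordinates sum to one and `conePt` is the identity; scaling a leg towards
zero moves its point along the segment to the barycentre. -/
lemma mem_modelCone {k : ℕ} {x : Fin (k + 2) → ℝ} :
    x ∈ modelCone k ↔ ∃ y, IsLeg k y ∧ ∑ i, y i ≤ 1 ∧ x = conePt k y := by
  constructor
  · rintro (rfl | ⟨w, ⟨hw, hcard⟩, hx⟩)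
    · exact ⟨0, by simp [IsLeg], by simp, by simp⟩
    · rw [segment_eq_image'] at hx
      obtain ⟨t, ht, rfl⟩ := hx
      have hleg : IsLeg k w := ⟨hw.1, hcard⟩
      refine ⟨t • w, hleg.smul ht.1, ?_, ?_⟩
      · simp [← Finset.mul_sum, hw.2, ht.2]
      · rw [conePt_smul]
        have : conePt k w = w := by
          ext i
          simp [conePt, hw.2]
        rw [this]
  · rintro ⟨y, hy, hsum, rfl⟩
    rcases (Finset.sum_nonneg fun i _ => hy.1 i : 0 ≤ ∑ i, y i).eq_or_lt with h0 | hpos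
    · have hy0 : y = 0 := by
        ext i
        exact (Finset.sum_eq_zero_iff_of_nonneg fun i _ => hy.1 i).1 h0.symm i (Finset.mem_univ i)
      rw [hy0, conePt_zero]
      exact Or.inl rfl
    · set S := ∑ i, y i with hS
      have hleg := hy.smul (inv_nonneg.2 hpos.le)
      have hw1 : ∑ i, (S⁻¹ • y) i = 1 := by
        simp only [Pi.smul_apply, smul_eq_mul, ← Finset.mul_sum, ← hS]
        exact inv_mul_cancel₀ hpos.ne'
      refine Or.inr ⟨S⁻¹ • y, ⟨⟨hleg.1, hw1⟩, hleg.2⟩, ?_⟩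
      rw [segment_eq_image']
      refine ⟨S, ⟨hpos.le, hsum⟩, ?_⟩
      have h1 : conePt k (S⁻¹ • y) = S⁻¹ • y := by
        ext i
        simp only [conePt, hw1]
        ring
      dsimp only
      rw [← h1, ← conePt_smul, smul_smul, mul_inv_cancel₀ hpos.ne', one_smul]

lemma IsLeg.exists_eq_zero {k : ℕ} {y : Fin (k + 2) → ℝ} (hy : IsLeg k y) : ∃ i, y i = 0 := by
  by_contra! hcon
  have h1 := hy.2
  have : {i | y i ≠ 0} = univ := by
    ext i
    simp [hcon i]
  rw [this, ncard_univ, Nat.card_eq_fintype_card, Fintype.card_fin] at h1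
  omega

/-- `conePt` adds one constant to all coordinates of `y`. At most `k` of the `k + 2` coordinates of
a leg are nonzero, so some coordinate vanishes and the constant is the smallest coordinate of the
image. -/
lemma legCoord_conePt {k : ℕ} {y : Fin (k + 2) → ℝ} (hy : IsLeg k y) :
    legCoord k (conePt k y) = y := by
  obtain ⟨j, hj⟩ := hy.exists_eq_zero
  have : Finset.univ.inf' Finset.univ_nonempty (conePt k y)
      = 1 / ((k : ℝ) + 2) - (∑ j, y j) / ((k : ℝ) + 2) := by
    apply le_antisymm
    · have := Finset.inf'_le (conePt k y) (Finset.mem_univ j)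
      rw [show conePt k y j = 1 / ((k : ℝ) + 2) - (∑ j, y j) / ((k : ℝ) + 2) by
        simp [conePt, hj]] at this
      exact this
    · refine Finset.le_inf' _ _ fun i _ => ?_
      have := hy.1 i
      simp only [conePt]
      linarith
  ext i
  simp only [legCoord, this]
  simp only [conePt]
  ring

lemma isPL_legCoord (k : ℕ) : IsPL (legCoord k) := by
  refine IsPL.pi fun i => (IsPL.apply i).sub ?_
  have : IsPL (Finset.univ.inf' Finset.univ_nonempty
      fun (j : Fin (k + 2)) (x : Fin (k + 2) → ℝ) => x j) := by
    refine Finset.inf'_induction _ _ (p := fun f : (Fin (k + 2) → ℝ) → ℝ => IsPL f)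
      (fun a ha b hb => ?_) fun j _ => IsPL.apply j
    exact ha.min hb
  have he : (fun x : Fin (k + 2) → ℝ => Finset.univ.inf' Finset.univ_nonempty x)
      = Finset.univ.inf' Finset.univ_nonempty
      fun (j : Fin (k + 2)) (x : Fin (k + 2) → ℝ) => x j := by
    ext x
    rw [Finset.inf'_apply]
  change IsPL (fun x : Fin (k + 2) → ℝ => Finset.univ.inf' Finset.univ_nonempty x)
  rw [he]
  exact this

/-- There is one piece for each set of at most `k` indices, namely the image of the weights
supported there with sum at most one. -/
lemma isPolytopal_modelCone (k : ℕ) : IsPolytopal (modelCone k) := by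
  classical
  have h : modelCone k = ⋃ s ∈ {s : Finset (Fin (k + 2)) | s.card ≤ k},
      conePt k '' (Icc 0 (fun i => if i ∈ s then 1 else 0) ∩
        (fun y => ∑ i, y i) ⁻¹' Icc (0 : ℝ) 1) := by
    ext x
    simp only [mem_iUnion, mem_modelCone, exists_prop]
    constructor
    · rintro ⟨y, hy, hsum, rfl⟩
      refine ⟨Finset.univ.filter fun i => y i ≠ 0, ?_, y, ⟨⟨hy.1, fun i => ?_⟩, ?_, hsum⟩, rfl⟩
      · have := hy.2
        rw [mem_ofPred_eq, ← Set.ncard_coe_finset]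
        simpa using this
      · have h1 : y i ≤ 1 := (Finset.single_le_sum (fun i _ => hy.1 i) (Finset.mem_univ i)).trans hsum
        by_cases h0 : y i = 0
        · simp [h0]
        · simpa [h0] using h1
      · exact Finset.sum_nonneg fun i _ => hy.1 i
    · rintro ⟨s, hs, y, ⟨⟨h0, h1⟩, h2⟩, rfl⟩
      refine ⟨y, ⟨h0, ?_⟩, h2.2, rfl⟩
      refine le_trans ?_ hs
      rw [← Set.ncard_coe_finset]
      refine Set.ncard_le_ncard (fun i hi => ?_) s.finite_toSet
      by_contra hcon
      have h3 := h1 i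
      simp only [Finset.mem_coe] at hcon
      simp only [if_neg hcon] at h3
      exact hi (le_antisymm h3 (h0 i))
  rw [h]
  refine IsPolytopal.biUnion (Set.toFinite _) fun s _ => ?_
  refine IsPLOn.image_isPolytopal ((isPL_conePt k) _ ?_)
  set A : (Fin (k + 2) → ℝ) →ₗ[ℝ] ℝ := ∑ i, LinearMap.proj i with hA
  have hAe : ((fun y : Fin (k + 2) → ℝ => ∑ i, y i)) = A.toAffineMap := by
    ext y
    simp [hA]
  rw [hAe]
  refine (isPolytope_Icc_pi _ _ fun i => ?_).inter_preimage (isPolytope_Icc 0 1) A.toAffineMap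
  dsimp only [Pi.zero_apply]
  split_ifs <;> norm_num

lemma model_eq (n k : ℕ) :
    model n k = modelCone k ×ˢ Icc (fun _ => -1) (fun _ => 1) := rfl

lemma isPolytopal_model (n k : ℕ) : IsPolytopal (model n k) :=
  (isPolytopal_modelCone k).prod (isPolytope_Icc_pi _ _ fun _ => by norm_num).isPolytopal

lemma barycentre_mem_modelCone (k : ℕ) : barycentre k ∈ modelCone k := Or.inl rfl

lemma modelCentre_mem (n k : ℕ) : modelCentre n k ∈ model n k :=
  ⟨barycentre_mem_modelCone k, fun _ => by simp [modelCentre], fun _ => by simp [modelCentre]⟩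

lemma starConvex_modelCone {k : ℕ} {x : Fin (k + 2) → ℝ} (hx : x ∈ modelCone k) {t : ℝ}
    (ht : 0 ≤ t) (ht1 : t ≤ 1) : barycentre k + t • (x - barycentre k) ∈ modelCone k := by
  obtain ⟨y, hy, hsum, rfl⟩ := mem_modelCone.1 hx
  refine mem_modelCone.2 ⟨t • y, hy.smul ht, ?_, (conePt_smul k y t).symm⟩
  simp only [Pi.smul_apply, smul_eq_mul, ← Finset.mul_sum]
  have : 0 ≤ ∑ i, y i := Finset.sum_nonneg fun i _ => hy.1 i
  nlinarith

lemma starConvex_model {n k : ℕ} {q : (Fin (k + 2) → ℝ) × (Fin (n - k) → ℝ)}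
    (hq : q ∈ model n k) {t : ℝ} (ht : 0 ≤ t) (ht1 : t ≤ 1) :
    modelCentre n k + t • (q - modelCentre n k) ∈ model n k := by
  refine ⟨starConvex_modelCone hq.1 ht ht1, fun i => ?_, fun i => ?_⟩
  · have := hq.2.1 i
    simp only [modelCentre, Prod.snd_add, Prod.smul_snd, Prod.snd_sub, Pi.add_apply,
      Pi.smul_apply, Pi.sub_apply, Pi.zero_apply, smul_eq_mul] at *
    nlinarith
  · have := hq.2.2 i
    simp only [modelCentre, Prod.snd_add, Prod.smul_snd, Prod.snd_sub, Pi.add_apply,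
      Pi.smul_apply, Pi.sub_apply, Pi.zero_apply, smul_eq_mul] at *
    nlinarith

/-! ### Recognizing model neighbourhoods -/

/-- A piecewise linear parametrization `τ` suffices: the inverse `ρ` needs no regularity, by
`IsPLOn.leftInverse`. -/
lemma hasModelNhd_of_chart {P : Set E} {x : E} {Q : Set F} {y : F} (τ : F → E) (ρ : E → F)
    (hτ : IsPLOn τ Q) (hy : y ∈ Q) (hx : τ y = x) (hP : MapsTo τ Q P)
    (hρ : ∀ q ∈ Q, ρ (τ q) = q) (hnhd : ∀ᶠ p in 𝓝[P] x, ρ p ∈ Q ∧ τ (ρ p) = p) :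
    HasModelNhd P x Q y := by
  refine ⟨τ '' Q, hP.image_subset, ?_, ρ, hτ.leftInverse hρ, ⟨?_, ?_, ?_⟩, ?_⟩
  · filter_upwards [hnhd] with p hp
    exact ⟨_, hp.1, hp.2⟩
  · rintro _ ⟨q, hq, rfl⟩
    rwa [hρ q hq]
  · rintro _ ⟨q, hq, rfl⟩ _ ⟨q', hq', rfl⟩ h
    rw [hρ q hq, hρ q' hq'] at h
    rw [h]
  · intro q hq
    exact ⟨τ q, mem_image_of_mem _ hq, hρ q hq⟩
  · rw [← hx, hρ y hy]

/-- A point is of type `k` if it has a chart in terms of leg coordinates. -/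
lemma isPointOfType_of_legChart {n k : ℕ} {P : Set E}
    (σ : (Fin (k + 2) → ℝ) × (Fin (n - k) → ℝ) → E)
    (l : E → (Fin (k + 2) → ℝ) × (Fin (n - k) → ℝ)) (hσ : IsPL σ) {ε : ℝ} (hε : 0 < ε)
    (h1 : ∀ y t, IsLeg k y → (∀ i, y i ≤ ε) → (∀ j, |t j| ≤ ε) →
      σ (y, t) ∈ P ∧ l (σ (y, t)) = (y, t))
    (hc : ContinuousAt l (σ 0))
    (h2 : ∀ᶠ p in 𝓝[P] (σ 0), IsLeg k (l p).1 ∧ σ (l p) = p) :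
    IsPointOfType n k P (σ 0) := by
  have hl0 : l (σ 0) = 0 := (h1 0 0 (by simp [IsLeg]) (fun _ => hε.le) (by simp [hε.le])).2
  have hlegle : ∀ y : Fin (k + 2) → ℝ, IsLeg k y → ∑ i, y i ≤ 1 → ∀ i, (ε • y) i ≤ ε := by
    intro y hy hsum i
    have h3 : y i ≤ 1 := (Finset.single_le_sum (fun i _ => hy.1 i) (Finset.mem_univ i)).trans hsum
    simp only [Pi.smul_apply, smul_eq_mul]
    nlinarith
  have hkey : ∀ q ∈ model n k, ∃ y, IsLeg k y ∧ ∑ i, y i ≤ 1 ∧ q.1 = conePt k y ∧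
      legCoord k q.1 = y ∧ σ (ε • legCoord k q.1, ε • q.2) ∈ P ∧
      l (σ (ε • legCoord k q.1, ε • q.2)) = (ε • y, ε • q.2) := by
    intro q hq
    obtain ⟨y, hy, hsum, hqy⟩ := mem_modelCone.1 hq.1
    have hleg : legCoord k q.1 = y := by rw [hqy, legCoord_conePt hy]
    have h4 : ∀ j, |(ε • q.2) j| ≤ ε := by
      intro j
      have h5 : |q.2 j| ≤ 1 := abs_le.2 ⟨hq.2.1 j, hq.2.2 j⟩
      simp only [Pi.smul_apply, smul_eq_mul, abs_mul, abs_of_pos hε]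
      nlinarith
    have h6 := h1 (ε • y) (ε • q.2) (hy.smul hε.le) (hlegle y hy hsum) h4
    exact ⟨y, hy, hsum, hqy, hleg, hleg ▸ h6.1, by rw [hleg]; exact h6.2⟩
  -- The model has size one and the given chart has size `ε`, whence the rescaling.
  refine hasModelNhd_of_chart (fun q => σ (ε • legCoord k q.1, ε • q.2))
    (fun p => (conePt k (ε⁻¹ • (l p).1), ε⁻¹ • (l p).2)) ?_ (modelCentre_mem n k) ?_ ?_ ?_ ?_
  · refine IsPL.isPLOn (hσ.comp ?_) (isPolytopal_model n k)
    exact (((isPL_legCoord k).comp IsPL.fst).const_smul ε).prodMk (IsPL.snd.const_smul ε)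
  · have : legCoord k (barycentre k) = 0 := by
      rw [← conePt_zero, legCoord_conePt (by simp [IsLeg])]
    simp only [modelCentre, this, smul_zero]
    rfl
  · intro q hq
    obtain ⟨y, -, -, -, -, h, -⟩ := hkey q hq
    exact h
  · intro q hq
    obtain ⟨y, hy, -, hqy, hleg, -, h⟩ := hkey q hq
    have he : ε⁻¹ * ε = 1 := inv_mul_cancel₀ hε.ne'
    ext1
    · simp only [h, smul_smul, he, one_smul]
      exact hqy.symm
    · simp only [h, smul_smul, he, one_smul]
  -- With this bound on each of the `k + 2` leg coordinates, their sum is at most `ε`.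
  · have hsmall : ∀ᶠ p in 𝓝[P] (σ 0), ‖l p‖ < ε / (k + 2) := by
      have h3 : ContinuousAt (fun p => ‖l p‖) (σ 0) := hc.norm
      have h4 : ‖l (σ 0)‖ < ε / (k + 2) := by
        rw [hl0, norm_zero]
        positivity
      exact (h3.eventually_lt continuousAt_const h4).filter_mono nhdsWithin_le_nhds
    filter_upwards [h2, hsmall] with p hp hsm
    have hk : (1 : ℝ) ≤ k + 2 := by
      have : (0 : ℝ) ≤ k := Nat.cast_nonneg k
      linarith
    have hle : ε / (k + 2) ≤ ε := div_le_self hε.le hk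
    have hleg : IsLeg k (ε⁻¹ • (l p).1) := hp.1.smul (inv_nonneg.2 hε.le)
    have hbd : ∀ j, |(l p).2 j| ≤ ε := fun j => by
      calc |(l p).2 j| = ‖(l p).2 j‖ := rfl
        _ ≤ ‖(l p).2‖ := norm_le_pi_norm _ j
        _ ≤ ‖l p‖ := norm_snd_le _
        _ ≤ ε := hsm.le.trans hle
    refine ⟨⟨mem_modelCone.2 ⟨_, hleg, ?_, rfl⟩, fun j => ?_, fun j => ?_⟩, ?_⟩
    · have h3 : ∀ i, (l p).1 i ≤ ε / (k + 2) := fun i => by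
        calc (l p).1 i ≤ ‖(l p).1 i‖ := le_abs_self _
          _ ≤ ‖(l p).1‖ := norm_le_pi_norm _ i
          _ ≤ ‖l p‖ := norm_fst_le _
          _ ≤ _ := hsm.le
      have h4 : ∑ i, (l p).1 i ≤ ∑ _i : Fin (k + 2), ε / (k + 2) :=
        Finset.sum_le_sum fun i _ => h3 i
      simp only [Finset.sum_const, Finset.card_univ, Fintype.card_fin, nsmul_eq_mul] at h4
      push_cast at h4
      rw [mul_div_cancel₀ _ (by positivity)] at h4
      simp only [Pi.smul_apply, smul_eq_mul, ← Finset.mul_sum]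
      rw [inv_mul_le_one₀ hε]
      exact h4
    · have h5 := (abs_le.1 (hbd j)).1
      simp only [Pi.smul_apply, smul_eq_mul]
      rw [← sub_nonneg, sub_neg_eq_add, inv_mul_eq_div]
      have : 0 ≤ ((l p).2 j + ε) / ε := div_nonneg (by linarith) hε.le
      rwa [add_div, div_self hε.ne'] at this
    · have h5 := (abs_le.1 (hbd j)).2
      simp only [Pi.smul_apply, smul_eq_mul]
      rw [inv_mul_le_one₀ hε]
      exact h5
    · have he : ε * ε⁻¹ = 1 := mul_inv_cancel₀ hε.ne'
      simp only [legCoord_conePt hleg, smul_smul, he, one_smul]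
      exact hp.2

end Models

end PLTop

namespace PLTop

/-! ### Rays from the centre do not separate two-dimensional models. -/

section Connectedness

variable {E F : Type*} [NormedAddCommGroup E] [NormedSpace ℝ E]
  [NormedAddCommGroup F] [NormedSpace ℝ F]

/-! ### The models of dimension `n + 1` as products with an interval -/

/-- The last coordinate of the cube is singled out. -/
def cubeEquiv (n k : ℕ) (h : k ≤ n) : Option (Fin (n - k)) ≃ Fin (n + 1 - k) :=
  (finSuccEquiv (n - k)).symm.trans (finCongr (by omega))

/-- Append a coordinate to the cube factor. -/
noncomputable def appendCoord (n k : ℕ) (h : k ≤ n) :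
    (((Fin (k + 2) → ℝ) × (Fin (n - k) → ℝ)) × ℝ) →ₗ[ℝ]
      (Fin (k + 2) → ℝ) × (Fin (n + 1 - k) → ℝ) where
  toFun p := (p.1.1, fun j => ((cubeEquiv n k h).symm j).elim p.2 p.1.2)
  map_add' _ _ := by
    ext j
    · rfl
    · dsimp
      cases (cubeEquiv n k h).symm j <;> rfl
  map_smul' _ _ := by
    ext j
    · rfl
    · dsimp
      cases (cubeEquiv n k h).symm j <;> rfl

/-- Split off a coordinate of the cube factor. -/
noncomputable def splitCoord (n k : ℕ) (h : k ≤ n) :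
    ((Fin (k + 2) → ℝ) × (Fin (n + 1 - k) → ℝ)) →ₗ[ℝ]
      ((Fin (k + 2) → ℝ) × (Fin (n - k) → ℝ)) × ℝ where
  toFun q := ((q.1, fun i => q.2 (cubeEquiv n k h (some i))), q.2 (cubeEquiv n k h none))
  map_add' _ _ := rfl
  map_smul' _ _ := rfl

@[simp] lemma splitCoord_appendCoord {n k : ℕ} (h : k ≤ n) (p) :
    splitCoord n k h (appendCoord n k h p) = p := by
  simp [splitCoord, appendCoord]

@[simp] lemma appendCoord_splitCoord {n k : ℕ} (h : k ≤ n) (q) :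
    appendCoord n k h (splitCoord n k h q) = q := by
  ext j
  · rfl
  · obtain ⟨o, rfl⟩ := (cubeEquiv n k h).surjective j
    cases o <;> simp [splitCoord, appendCoord]

lemma splitCoord_centre {n k : ℕ} (h : k ≤ n) :
    splitCoord n k h (modelCentre (n + 1) k) = (modelCentre n k, 0) := rfl

lemma splitCoord_mem {n k : ℕ} (h : k ≤ n) (q) :
    splitCoord n k h q ∈ model n k ×ˢ Icc (-1) 1 ↔ q ∈ model (n + 1) k := by
  simp only [model_eq, mem_prod, mem_Icc, Pi.le_def, splitCoord, LinearMap.coe_mk, AddHom.coe_mk,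
    ← (cubeEquiv n k h).forall_congr_right (q := fun j => -1 ≤ q.2 j),
    ← (cubeEquiv n k h).forall_congr_right (q := fun j => q.2 j ≤ 1), Option.forall]
  tauto

/-! ### Complements of rays -/

/-- The ray from `c` in the direction `u`. -/
def ray (c u : E) : Set E := {p | ∃ t : ℝ, 0 ≤ t ∧ p = c + t • u}

lemma isPreconnected_of_joinedIn {S : Set E} (h : ∀ x ∈ S, ∀ y ∈ S, JoinedIn S x y) :
    IsPreconnected S := by
  rcases S.eq_empty_or_nonempty with rfl | ⟨x, hx⟩
  · exact isPreconnected_empty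
  · exact (show IsPathConnected S from ⟨x, hx, fun {y} hy => h x hx y hy⟩).isConnected.isPreconnected

/-- In the product of a star convex set with an interval, no ray from the centre separates. -/
lemma isPreconnected_prod_diff_ray_of_nonneg {M : Set E} {c : E} (hM : StarConvex ℝ c M)
    (h : ∀ u : E, ∃ m ∈ M, m ∉ ray c u) (u : E × ℝ) (hu : u ≠ 0) (hu2 : 0 ≤ u.2) :
    IsPreconnected ((M ×ˢ Icc (-1 : ℝ) 1) \ ray (c, 0) u) := by
  obtain ⟨v, τ⟩ := u
  dsimp only at hu2
  set S := (M ×ˢ Icc (-1 : ℝ) 1) \ ray (c, 0) (v, τ) with hS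
  have hray : ∀ (m : E) (t : ℝ), (m, t) ∈ ray (c, (0 : ℝ)) (v, τ) ↔
      ∃ s : ℝ, 0 ≤ s ∧ m = c + s • v ∧ t = s * τ := by
    intro m t
    simp [ray]
  -- The ray stays at nonnegative heights, so the whole floor at height `-1` is available, and it is
  -- star-shaped about `c`.
  have hbase : ∀ m ∈ M, JoinedIn S (m, -1) (c, -1) := by
    intro m hm
    refine JoinedIn.of_segment_subset ?_
    rw [segment_symm, segment_eq_image']
    rintro _ ⟨s, hs, rfl⟩
    have he : ((c, (-1 : ℝ)) + s • ((m, (-1 : ℝ)) - (c, -1))) = (c + s • (m - c), -1) := by simp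
    dsimp only
    rw [he]
    refine ⟨⟨hM.add_smul_sub_mem hm hs.1 hs.2, by norm_num⟩, fun hcon => ?_⟩
    obtain ⟨a, ha, -, h2⟩ := (hray _ _).1 hcon
    nlinarith [mul_nonneg ha hu2]
  -- If every point of the ray over `m` lies strictly above `t`, a vertical descent to the floor
  -- avoids the ray.
  have hdown : ∀ m ∈ M, ∀ t ∈ Icc (-1 : ℝ) 1,
      (∀ s : ℝ, 0 ≤ s → m = c + s • v → t < s * τ) → JoinedIn S (m, t) (c, -1) := by
    intro m hm t ht hcond
    refine JoinedIn.trans (JoinedIn.of_segment_subset ?_) (hbase m hm)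
    rw [segment_symm, segment_eq_image']
    rintro _ ⟨a, ha, rfl⟩
    have he : ((m, (-1 : ℝ)) + a • ((m, t) - (m, (-1 : ℝ)))) = (m, -1 + a * (t + 1)) := by simp
    dsimp only
    rw [he]
    have hle : -1 + a * (t + 1) ≤ t := by nlinarith [ht.1, ha.2]
    refine ⟨⟨hm, by nlinarith [ht.1, ha.1], hle.trans ht.2⟩, fun hcon => ?_⟩
    obtain ⟨s, hs, h1, h2⟩ := (hray _ _).1 hcon
    linarith [hcond s hs h1]
  have hall : ∀ p ∈ S, JoinedIn S p (c, -1) := by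
    rintro ⟨m, t⟩ ⟨⟨hm, ht⟩, hp⟩
    by_cases hcond : ∀ s : ℝ, 0 ≤ s → m = c + s • v → t < s * τ
    · exact hdown m hm t ht hcond
    push Not at hcond
    obtain ⟨s, hs, hms, hle⟩ := hcond
    have hlt : s * τ < t := lt_of_le_of_ne hle fun he => hp ((hray _ _).2 ⟨s, hs, hms, he.symm⟩)
    have ht0 : 0 < t := lt_of_le_of_lt (mul_nonneg hs hu2) hlt
    have hv : v ≠ 0 := by
      rintro rfl
      have hτ : 0 < τ := lt_of_le_of_ne hu2 fun he => hu (by simp [← he])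
      exact hp ((hray _ _).2 ⟨t / τ, by positivity, by simpa using hms, by field_simp⟩)
    -- A point above the ray is moved at constant height `t` to the axis over `c`, from there to the
    -- vertical line over `m₂`, which misses the ray altogether, and then down.
    obtain ⟨m₂, hm₂, hm₂r⟩ := h v
    have hm₂' : ∀ s : ℝ, 0 ≤ s → m₂ ≠ c + s • v := fun s hs he => hm₂r ⟨s, hs, he⟩
    have step1 : JoinedIn S (m, t) (c, t) := by
      refine JoinedIn.of_segment_subset ?_
      rw [segment_symm, segment_eq_image']
      rintro _ ⟨a, ha, rfl⟩
      have he : ((c, t) + a • ((m, t) - (c, t))) = (c + a • (m - c), t) := by simp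
      dsimp only
      rw [he]
      refine ⟨⟨hM.add_smul_sub_mem hm ha.1 ha.2, ht⟩, fun hcon => ?_⟩
      obtain ⟨b, hb, h1, h2⟩ := (hray _ _).1 hcon
      have h3 : (a * s) • v = b • v := by
        rw [hms] at h1
        simpa [smul_smul] using h1
      have h4 : a * s = b := smul_left_injective ℝ hv h3
      have h5 : b ≤ s := by nlinarith [ha.2]
      nlinarith
    have step2 : JoinedIn S (c, t) (m₂, t) := by
      refine JoinedIn.of_segment_subset ?_
      rw [segment_eq_image']
      rintro _ ⟨a, ha, rfl⟩
      have he : ((c, t) + a • ((m₂, t) - (c, t))) = (c + a • (m₂ - c), t) := by simp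
      dsimp only
      rw [he]
      refine ⟨⟨hM.add_smul_sub_mem hm₂ ha.1 ha.2, ht⟩, fun hcon => ?_⟩
      obtain ⟨b, hb, h1, h2⟩ := (hray _ _).1 hcon
      have h3 : a • (m₂ - c) = b • v := by simpa using h1
      rcases ha.1.eq_or_lt with h0 | hpos
      · rw [← h0, zero_smul] at h3
        rcases smul_eq_zero.1 h3.symm with hb0 | hv0
        · rw [hb0, zero_mul] at h2
          exact ht0.ne' h2
        · exact hv hv0
      · refine hm₂' (b / a) (by positivity) ?_
        rw [div_eq_inv_mul, mul_smul, ← h3, smul_smul, inv_mul_cancel₀ hpos.ne', one_smul]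
        abel
    exact (step1.trans step2).trans (hdown m₂ hm₂ t ht fun s hs he => absurd he (hm₂' s hs))
  exact isPreconnected_of_joinedIn fun x hx y hy => (hall x hx).trans (hall y hy).symm

lemma isPreconnected_prod_diff_ray {M : Set E} {c : E} (hM : StarConvex ℝ c M)
    (h : ∀ u : E, ∃ m ∈ M, m ∉ ray c u) (u : E × ℝ) (hu : u ≠ 0) :
    IsPreconnected ((M ×ˢ Icc (-1 : ℝ) 1) \ ray (c, 0) u) := by
  rcases le_total 0 u.2 with h2 | h2
  · exact isPreconnected_prod_diff_ray_of_nonneg hM h u hu h2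
  · have hne : (u.1, -u.2) ≠ 0 := by
      intro h0
      simp only [Prod.mk_eq_zero, neg_eq_zero] at h0
      exact hu (Prod.ext h0.1 h0.2)
    have key := isPreconnected_prod_diff_ray_of_nonneg hM h (u.1, -u.2) hne (by simpa using h2)
    have := key.image (fun p : E × ℝ => (p.1, -p.2)) (by fun_prop)
    convert this using 1
    ext ⟨m, t⟩
    simp only [ray, mem_sdiff, mem_prod, mem_Icc, mem_ofPred_eq, mem_image, Prod.exists,
      Prod.ext_iff, Prod.fst_add, Prod.snd_add, Prod.smul_fst, Prod.smul_snd,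
      zero_add, smul_eq_mul]
    constructor
    · rintro ⟨⟨hm, h1, h2⟩, h3⟩
      refine ⟨m, -t, ⟨⟨hm, by linarith, by linarith⟩, ?_⟩, rfl, by simp⟩
      rintro ⟨s, hs, he, he'⟩
      exact h3 ⟨s, hs, he, by linarith⟩
    · rintro ⟨m', t', ⟨⟨hm, h1, h2⟩, h3⟩, rfl, rfl⟩
      refine ⟨⟨hm, by linarith, by linarith⟩, ?_⟩
      rintro ⟨s, hs, he, he'⟩
      exact h3 ⟨s, hs, he, by linarith⟩

/-- A linear functional that takes both signs on the one-dimensional model and vanishes only at its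
centre. -/
lemma exists_separating_functional {k : ℕ} (hk : k < 2) :
    ∃ φ : ((Fin (k + 2) → ℝ) × (Fin (1 - k) → ℝ)) →ₗ[ℝ] ℝ,
      (∃ m ∈ model 1 k, 0 < φ (m - modelCentre 1 k)) ∧
      (∃ m ∈ model 1 k, φ (m - modelCentre 1 k) < 0) ∧
      ∀ m ∈ model 1 k, φ (m - modelCentre 1 k) = 0 → m = modelCentre 1 k := by
  interval_cases k
  · refine ⟨(LinearMap.proj (φ := fun _ : Fin 1 => ℝ) 0).comp (LinearMap.snd ℝ _ _), ?_, ?_, ?_⟩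
    · refine ⟨(barycentre 0, fun _ => 1), ⟨barycentre_mem_modelCone 0, ?_, ?_⟩, ?_⟩
      · intro i; norm_num
      · intro i; norm_num
      · simp [modelCentre]
    · refine ⟨(barycentre 0, fun _ => -1), ⟨barycentre_mem_modelCone 0, ?_, ?_⟩, ?_⟩
      · intro i; norm_num
      · intro i; norm_num
      · simp [modelCentre]
    · rintro ⟨x, t⟩ ⟨hx, -⟩ h
      obtain ⟨y, hy, -, hxy⟩ := mem_modelCone.1 hx
      have hy0 : y = 0 := by
        have h1 := hy.2
        rw [Nat.le_zero, Set.ncard_eq_zero] at h1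
        ext i
        by_contra hne
        have : i ∈ {i | y i ≠ 0} := hne
        rw [h1] at this
        exact this
      rw [hy0, conePt_zero] at hxy
      ext i
      · exact congrFun hxy i
      · have h2 : i = (0 : Fin 1) := Subsingleton.elim (α := Fin 1) _ _
        subst h2
        simpa [modelCentre] using h
  · have hleg : ∀ j : Fin 3, IsLeg 1 (Pi.single j (1 : ℝ) : Fin 3 → ℝ) := by
      intro j
      refine ⟨fun i => ?_, ?_⟩
      · by_cases hij : i = j
        · subst hij; simp
        · simp [hij]
      · refine (Set.ncard_le_ncard (t := {j}) (fun i hi => ?_)).trans (by simp)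
        by_contra hij
        exact hi (by simp only [mem_singleton_iff] at hij; simp [hij])
    have hmem : ∀ j : Fin 3, ((conePt 1 (Pi.single j 1), 0) :
        (Fin 3 → ℝ) × (Fin 0 → ℝ)) ∈ model 1 1 := fun j =>
      ⟨mem_modelCone.2 ⟨_, hleg j, by simp, rfl⟩, fun i => i.elim0, fun i => i.elim0⟩
    -- Relative to the barycentre, coordinate `0` grows with slope `2/3` on leg `0` and decreases
    -- with slope `1/3` on the other two legs.
    refine ⟨(LinearMap.proj (φ := fun _ : Fin 3 => ℝ) 0).comp (LinearMap.fst ℝ _ _),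
      ⟨_, hmem 0, ?_⟩, ⟨_, hmem 1, ?_⟩, ?_⟩
    · simp [modelCentre, conePt, barycentre]
      norm_num
    · simp [modelCentre, conePt, barycentre]
      norm_num
    · rintro ⟨x, t⟩ ⟨hx, -⟩ h
      obtain ⟨y, hy, -, hxy⟩ := mem_modelCone.1 hx
      dsimp only at hxy
      subst hxy
      have h1 : y 0 = (∑ j, y j) / 3 := by
        simp only [LinearMap.comp_apply, LinearMap.fst_apply, LinearMap.proj_apply, modelCentre,
          Prod.fst_sub, Pi.sub_apply, conePt, barycentre] at h
        norm_num at h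
        linarith
      rw [Fin.sum_univ_three] at h1
      have h2 := hy.1 0
      have h3 := hy.1 1
      have h4 := hy.1 2
      have hsub : ∀ i j, y i ≠ 0 → y j ≠ 0 → i = j := fun i j hi hj =>
        (Set.ncard_le_one (Set.toFinite _)).1 hy.2 i hi j hj
      have hy0 : y = 0 := by
        have h5 : y 0 = 0 := by
          by_contra h0
          have h6 : y 1 = 0 := by
            by_contra hcon
            exact absurd (hsub 0 1 h0 hcon) (by decide)
          have h7 : y 2 = 0 := by
            by_contra hcon
            exact absurd (hsub 0 2 h0 hcon) (by decide)
          rw [h6, h7] at h1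
          exact h0 (by linarith)
        have h6 : y 1 = 0 := by linarith
        have h7 : y 2 = 0 := by linarith
        ext i
        fin_cases i
        · exact h5
        · exact h6
        · exact h7
      rw [hy0, conePt_zero]
      exact Prod.ext rfl (Subsingleton.elim (α := Fin 0 → ℝ) _ _)

/-- Vectors with nonnegative coordinates of sum at most one, at most two of which are nonzero. -/
def legSpace : Set (Fin 4 → ℝ) := {y | IsLeg 2 y ∧ ∑ i, y i ≤ 1}

lemma mem_legSpace_of_pair {i j : Fin 4} {y : Fin 4 → ℝ} (h0 : ∀ l, 0 ≤ y l)
    (hij : ∀ l, l ≠ i → l ≠ j → y l = 0) (hsum : ∑ l, y l ≤ 1) : y ∈ legSpace := by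
  refine ⟨⟨h0, ?_⟩, hsum⟩
  refine (Set.ncard_le_ncard (t := {i, j}) (fun l hl => ?_)).trans ?_
  swap
  · by_cases h : i = j
    · simp [h]
    · rw [Set.ncard_pair h]
  by_contra hcon
  simp only [mem_insert_iff, mem_singleton_iff, not_or] at hcon
  exact hl (hij l hcon.1 hcon.2)

lemma exists_pair_of_ncard_le_two {y : Fin 4 → ℝ} (h : {i | y i ≠ 0}.ncard ≤ 2) :
    ∃ i j : Fin 4, i ≠ j ∧ ∀ l, l ≠ i → l ≠ j → y l = 0 := by
  classical
  have hcard : (Finset.univ.filter fun i => y i ≠ 0).card ≤ 2 := by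
    rw [← Set.ncard_coe_finset]
    simpa using h
  obtain ⟨t, ht, htc⟩ := Finset.exists_superset_card_eq hcard (by simp)
  obtain ⟨i, j, hij, rfl⟩ := Finset.card_eq_two.1 htc
  refine ⟨i, j, hij, fun l hi hj => ?_⟩
  by_contra hl
  have := ht (by simp [hl] : l ∈ Finset.univ.filter fun i => y i ≠ 0)
  simp [hi, hj] at this

/-- No ray separates the cone on the complete graph with four vertices. -/
lemma isPreconnected_legSpace_diff_ray (ω : Fin 4 → ℝ) :
    IsPreconnected (legSpace \ ray 0 ω) := by
  classical
  set S := legSpace \ ray 0 ω with hS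
  have hray : ∀ y : Fin 4 → ℝ, y ∈ ray 0 ω ↔ ∃ s : ℝ, 0 ≤ s ∧ ∀ i, y i = s * ω i := by
    intro y
    simp [ray, funext_iff]
  have hvert : ∀ i : Fin 4, (Pi.single i (1 : ℝ) : Fin 4 → ℝ) ∈ legSpace := by
    intro i
    refine mem_legSpace_of_pair (i := i) (j := i) (fun l => ?_) (fun l hl _ => ?_) (by simp)
    · by_cases hl : l = i
      · subst hl; simp
      · simp [hl]
    · simp [hl]
  have hconv : ∀ (i j : Fin 4) (y : Fin 4 → ℝ), y ∈ legSpace →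
      (∀ l, l ≠ i → l ≠ j → y l = 0) → ∀ a ∈ Icc (0 : ℝ) 1,
      y + a • (Pi.single i 1 - y) ∈ legSpace := by
    intro i j y hy hij a ha
    refine mem_legSpace_of_pair (i := i) (j := j) (fun l => ?_) (fun l hi hj => ?_) ?_
    · have h1 := hy.1.1 l
      have h2 := (hvert i).1.1 l
      simp only [Pi.add_apply, Pi.smul_apply, Pi.sub_apply, smul_eq_mul]
      nlinarith [ha.1, ha.2, mul_nonneg ha.1 h2, mul_nonneg (sub_nonneg.2 ha.2) h1]
    · simp [hij l hi hj, hi]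
    · simp only [Pi.add_apply, Pi.smul_apply, Pi.sub_apply, smul_eq_mul, Finset.sum_add_distrib,
        ← Finset.mul_sum, Finset.sum_sub_distrib, Finset.sum_pi_single', Finset.mem_univ, if_true]
      nlinarith [hy.2, ha.1, ha.2]
  -- every point is joined to a vertex
  have hto : ∀ y ∈ S, ∃ i : Fin 4, JoinedIn S y (Pi.single i 1) := by
    rintro y ⟨hy, hyr⟩
    obtain ⟨i, j, hij, hsupp⟩ := exists_pair_of_ncard_le_two hy.1.2
    -- The ray cannot meet both the segment to vertex `i` and the one to vertex `j`. Otherwise `α *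
    -- ω j - β * ω i` would be both nonpositive and nonnegative, hence zero, and the ray would pass
    -- through `y`.
    by_cases hcase : ∃ a ∈ Icc (0 : ℝ) 1, y + a • (Pi.single i 1 - y) ∈ ray 0 ω
    · refine ⟨j, JoinedIn.of_segment_subset ?_⟩
      rw [segment_eq_image']
      rintro _ ⟨b, hb, rfl⟩
      refine ⟨hconv j i y hy (fun l h1 h2 => hsupp l h2 h1) b hb, fun hcon => ?_⟩
      obtain ⟨a, ha, har⟩ := hcase
      obtain ⟨s, hs, hsω⟩ := (hray _).1 har
      obtain ⟨s', hs', hsω'⟩ := (hray _).1 hcon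
      have e1 := hsω i
      have e2 := hsω j
      have e3 := hsω' i
      have e4 := hsω' j
      have hji := hij.symm
      simp only [Pi.add_apply, Pi.smul_apply, Pi.sub_apply, smul_eq_mul, Pi.single_eq_same,
        Pi.single_eq_of_ne hij, Pi.single_eq_of_ne hji] at e1 e2 e3 e4
      have hα := hy.1.1 i
      have hβ := hy.1.1 j
      set α := y i
      set β := y j
      have f1 : s * (α * ω j - β * ω i) = -(a * β) := by linear_combination β * e1 - α * e2
      have f2 : s' * (α * ω j - β * ω i) = b * α := by linear_combination β * e3 - α * e4
      have hαβ : 0 < α + β := by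
        refine lt_of_le_of_ne (by positivity) fun h0 => hyr ((hray _).2 ⟨0, le_rfl, fun l => ?_⟩)
        rw [zero_mul]
        by_cases hli : l = i
        · subst hli
          linarith
        by_cases hlj : l = j
        · subst hlj
          linarith
        exact hsupp l hli hlj
      have hprod : s' * (a * β) + s * (b * α) = 0 := by linear_combination s' * f1 - s * f2
      have hn1 : 0 ≤ s' * (a * β) := mul_nonneg hs' (mul_nonneg ha.1 hβ)
      have hn2 : 0 ≤ s * (b * α) := mul_nonneg hs (mul_nonneg hb.1 hα)
      have hspos : s ≠ 0 := by
        rintro rfl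
        have h1 : (1 - a) * (α + β) + a = 0 := by linear_combination e1 + e2
        have h2 := mul_nonneg (sub_nonneg.2 ha.2) hαβ.le
        have h3 : a = 0 := by linarith [ha.1]
        rw [h3] at h1
        linarith
      have hspos' : s' ≠ 0 := by
        rintro rfl
        have h1 : (1 - b) * (α + β) + b = 0 := by linear_combination e3 + e4
        have h2 := mul_nonneg (sub_nonneg.2 hb.2) hαβ.le
        have h3 : b = 0 := by linarith [hb.1]
        rw [h3] at h1
        linarith
      have g1 : a * β = 0 := by
        have : s' * (a * β) = 0 := by linarith
        exact (mul_eq_zero.1 this).resolve_left hspos'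
      have g2 : b * α = 0 := by
        have : s * (b * α) = 0 := by linarith
        exact (mul_eq_zero.1 this).resolve_left hspos
      rcases mul_eq_zero.1 g1 with ha0 | hβ0
      · subst ha0
        exact hyr ((hray _).2 ⟨s, hs, by simpa using hsω⟩)
      · have hb0 : b = 0 := (mul_eq_zero.1 g2).resolve_right (by linarith)
        subst hb0
        exact hyr ((hray _).2 ⟨s', hs', by simpa using hsω'⟩)
    · refine ⟨i, JoinedIn.of_segment_subset ?_⟩
      rw [segment_eq_image']
      rintro _ ⟨a, ha, rfl⟩
      exact ⟨hconv i j y hy hsupp a ha, fun hr => hcase ⟨a, ha, hr⟩⟩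
  have hpath : ∀ k l : Fin 4, k ≠ l → (Pi.single k (1 : ℝ) : Fin 4 → ℝ) ∈ S →
      (Pi.single l (1 : ℝ) : Fin 4 → ℝ) ∈ S → (∀ a ∈ Icc (0 : ℝ) 1,
        (Pi.single k 1 + a • (Pi.single l 1 - Pi.single k 1) : Fin 4 → ℝ) ∉ ray 0 ω) →
      JoinedIn S (Pi.single k 1) (Pi.single l 1) := by
    intro k l hkl hk hl h
    refine JoinedIn.of_segment_subset ?_
    rw [segment_eq_image']
    rintro _ ⟨a, ha, rfl⟩
    exact ⟨hconv l k _ hk.1 (fun m _ h2 => by simp [h2]) a ha, h a ha⟩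
  have hvv : ∀ k l : Fin 4, (Pi.single k (1 : ℝ) : Fin 4 → ℝ) ∈ S →
      (Pi.single l (1 : ℝ) : Fin 4 → ℝ) ∈ S → JoinedIn S (Pi.single k 1) (Pi.single l 1) := by
    intro k l hk hl
    by_cases hkl : k = l
    · subst hkl
      exact JoinedIn.refl hk
    by_cases hcase : ∃ a ∈ Icc (0 : ℝ) 1,
        (Pi.single k 1 + a • (Pi.single l 1 - Pi.single k 1) : Fin 4 → ℝ) ∈ ray 0 ω
    · obtain ⟨a, ha, har⟩ := hcase
      obtain ⟨s, hs, hsω⟩ := (hray _).1 har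
      have hlk : l ≠ k := Ne.symm hkl
      have e1 := hsω k
      have e2 := hsω l
      simp only [Pi.add_apply, Pi.smul_apply, Pi.sub_apply, smul_eq_mul, Pi.single_eq_same,
        Pi.single_eq_of_ne hkl, Pi.single_eq_of_ne hlk] at e1 e2
      have ha0 : a ≠ 0 := by
        rintro rfl
        exact hk.2 (by simpa using har)
      have ha1 : a ≠ 1 := by
        rintro rfl
        exact hl.2 (by simpa using har)
      have hωk : ω k ≠ 0 := by
        intro h0
        rw [h0] at e1
        exact ha1 (by linarith)
      have hωl : ω l ≠ 0 := by
        intro h0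
        rw [h0] at e2
        exact ha0 (by linarith)
      -- The ray crosses the edge from `k` to `l`, so `ω k` and `ω l` are nonzero. An edge on which
      -- coordinate `r` vanishes can meet a ray with `ω r ≠ 0` only at the cone point, which is on
      -- no edge; so the detour through a third vertex `m` is free.
      obtain ⟨m, hmk, hml⟩ : ∃ m : Fin 4, m ≠ k ∧ m ≠ l :=
        (by decide : ∀ k l : Fin 4, ∃ m, m ≠ k ∧ m ≠ l) k l
      have havoid : ∀ p q r : Fin 4, r ≠ p → r ≠ q → p ≠ q → ω r ≠ 0 → ∀ a ∈ Icc (0 : ℝ) 1,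
          (Pi.single p 1 + a • (Pi.single q 1 - Pi.single p 1) : Fin 4 → ℝ) ∉ ray 0 ω := by
        intro p q r hrp hrq hpq hr a ha har
        obtain ⟨s, hs, hsω⟩ := (hray _).1 har
        have e1 := hsω r
        have e2 := hsω p
        have e3 := hsω q
        simp only [Pi.add_apply, Pi.smul_apply, Pi.sub_apply, smul_eq_mul, Pi.single_eq_same,
          Pi.single_eq_of_ne hrp, Pi.single_eq_of_ne hrq, Pi.single_eq_of_ne hpq,
          Pi.single_eq_of_ne hpq.symm] at e1 e2 e3
        have hs0 : s = 0 := by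
          have : s * ω r = 0 := by linarith
          exact (mul_eq_zero.1 this).resolve_right hr
        rw [hs0] at e2 e3
        linarith
      have hm : (Pi.single m (1 : ℝ) : Fin 4 → ℝ) ∈ S := by
        refine ⟨hvert m, fun hcon => ?_⟩
        exact havoid k m l hlk hml.symm hmk.symm hωl 1 (by simp) (by simpa using hcon)
      exact (hpath k m hmk.symm hk hm (havoid k m l hlk hml.symm hmk.symm hωl)).trans
        (hpath m l hml hm hl (havoid m l k hmk.symm hkl hml hωk))
    · exact hpath k l hkl hk hl fun a ha hr => hcase ⟨a, ha, hr⟩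
  refine isPreconnected_of_joinedIn fun x hx y hy => ?_
  obtain ⟨i, hi⟩ := hto x hx
  obtain ⟨j, hj⟩ := hto y hy
  exact (hi.trans (hvv i j hi.target_mem hj.target_mem)).trans hj.symm

/-- No ray from the centre separates a two-dimensional model. -/
lemma isPreconnected_model_diff_ray {k : ℕ} (hk : k ≤ 2)
    (u : (Fin (k + 2) → ℝ) × (Fin (2 - k) → ℝ)) (hu : u ≠ 0) :
    IsPreconnected (model 2 k \ ray (modelCentre 2 k) u) := by
  rcases hk.lt_or_eq with hk | rfl
  · have hk1 : k ≤ 1 := by omega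
    have hu' : splitCoord 1 k hk1 u ≠ 0 := fun h0 => hu (by
      rw [← appendCoord_splitCoord hk1 u, h0, map_zero])
    -- A functional taking both signs shows that no single ray covers the one-dimensional model.
    obtain ⟨φ, ⟨m₁, hm₁, hφ₁⟩, ⟨m₂, hm₂, hφ₂⟩, -⟩ := exists_separating_functional hk
    have key := isPreconnected_prod_diff_ray (M := model 1 k) (c := modelCentre 1 k) ?_ ?_
      (splitCoord 1 k hk1 u) hu'
    · have h2 := key.image (appendCoord 1 k hk1)
        (appendCoord 1 k hk1).continuous_of_finiteDimensional.continuousOn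
      convert h2 using 1
      ext q
      have hq : q ∈ ray (modelCentre 2 k) u ↔
          splitCoord 1 k hk1 q ∈ ray (modelCentre 1 k, (0 : ℝ)) (splitCoord 1 k hk1 u) := by
        constructor
        · rintro ⟨t, ht, rfl⟩
          exact ⟨t, ht, by rw [map_add, map_smul, splitCoord_centre]⟩
        · rintro ⟨t, ht, h⟩
          refine ⟨t, ht, ?_⟩
          rw [← splitCoord_centre hk1, ← map_smul, ← map_add] at h
          simpa only [appendCoord_splitCoord] using congrArg (appendCoord 1 k hk1) h
      constructor
      · rintro ⟨h3, h4⟩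
        exact ⟨splitCoord 1 k hk1 q, ⟨(splitCoord_mem hk1 q).2 h3, fun h => h4 (hq.2 h)⟩,
          appendCoord_splitCoord hk1 q⟩
      · rintro ⟨p, ⟨h3, h4⟩, rfl⟩
        refine ⟨(splitCoord_mem hk1 _).1 (by rwa [splitCoord_appendCoord]), fun h => h4 ?_⟩
        have := hq.1 h
        rwa [splitCoord_appendCoord] at this
    · intro q hq a b ha hb hab
      have := starConvex_model hq hb (by linarith)
      convert this using 1
      rw [show a = 1 - b by linarith]
      module
    · intro v
      by_contra! hcon
      obtain ⟨s, hs, hs'⟩ := hcon m₁ hm₁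
      obtain ⟨t, ht, ht'⟩ := hcon m₂ hm₂
      rw [hs', add_sub_cancel_left, map_smul, smul_eq_mul] at hφ₁
      rw [ht', add_sub_cancel_left, map_smul, smul_eq_mul] at hφ₂
      rcases le_total 0 (φ v) with h0 | h0
      · exact absurd (mul_nonneg ht h0) (not_le.2 hφ₂)
      · exact absurd (mul_nonpos_of_nonneg_of_nonpos hs h0) (not_le.2 hφ₁)
  -- In leg coordinates the trace of the ray on the cone is again that of a ray, with `ω = 0` when
  -- the ray meets the cone only in its apex.
  · obtain ⟨ω, hω⟩ : ∃ ω : Fin 4 → ℝ, ∀ y ∈ legSpace,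
        ((conePt 2 y, 0) ∈ ray (modelCentre 2 2) u ↔ y ∈ ray 0 ω) := by
      have hmem : ∀ y, (conePt 2 y, 0) ∈ ray (modelCentre 2 2) u ↔
          ∃ t : ℝ, 0 ≤ t ∧ conePt 2 y = barycentre 2 + t • u.1 := by
        intro y
        refine exists_congr fun t => and_congr_right fun _ => ?_
        rw [Prod.ext_iff]
        exact and_iff_left (Subsingleton.elim (α := Fin 0 → ℝ) _ _)
      have hu1 : u.1 ≠ 0 := fun h => hu (Prod.ext h (Subsingleton.elim (α := Fin 0 → ℝ) _ _))
      by_cases hex : ∃ y ∈ legSpace, ∃ t : ℝ, 0 < t ∧ conePt 2 y = barycentre 2 + t • u.1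
      · obtain ⟨y₀, hy₀, t₀, ht₀, h₀⟩ := hex
        have hω : conePt 2 (t₀⁻¹ • y₀) = barycentre 2 + u.1 := by
          rw [conePt_smul, h₀, add_sub_cancel_left, smul_smul, inv_mul_cancel₀ ht₀.ne', one_smul]
        refine ⟨t₀⁻¹ • y₀, fun y hy => ?_⟩
        rw [hmem]
        refine exists_congr fun t => and_congr_right fun ht => ?_
        have hleg : IsLeg 2 (t • t₀⁻¹ • y₀) := (hy₀.1.smul (inv_nonneg.2 ht₀.le)).smul ht
        have he : conePt 2 (t • t₀⁻¹ • y₀) = barycentre 2 + t • u.1 := by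
          rw [conePt_smul, hω, add_sub_cancel_left]
        rw [← he, zero_add]
        constructor
        · intro h
          rw [← legCoord_conePt hy.1, h, legCoord_conePt hleg]
        · intro h
          rw [h]
      · refine ⟨0, fun y hy => ?_⟩
        rw [hmem]
        constructor
        · rintro ⟨t, ht, h⟩
          rcases ht.eq_or_lt with rfl | hpos
          · refine ⟨0, le_rfl, ?_⟩
            rw [zero_smul, add_zero, ← conePt_zero] at h
            rw [← legCoord_conePt hy.1, h, legCoord_conePt (by simp [IsLeg])]
            simp
          · exact absurd ⟨y, hy, t, hpos, h⟩ hex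
        · rintro ⟨t, ht, h⟩
          refine ⟨0, le_rfl, ?_⟩
          rw [h]
          simp
    have h2 := (isPreconnected_legSpace_diff_ray ω).image
      (fun y => ((conePt 2 y, 0) : (Fin 4 → ℝ) × (Fin 0 → ℝ)))
      ((continuous_conePt 2).prodMk continuous_const).continuousOn
    convert h2 using 1
    ext ⟨x, t⟩
    have ht : t = 0 := Subsingleton.elim (α := Fin 0 → ℝ) _ _
    subst ht
    constructor
    · rintro ⟨⟨hx, -⟩, hr⟩
      obtain ⟨y, hy, hsum, hxy⟩ := mem_modelCone.1 hx
      dsimp only at hxy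
      subst hxy
      exact ⟨y, ⟨⟨hy, hsum⟩, fun h => hr ((hω y ⟨hy, hsum⟩).2 h)⟩, rfl⟩
    · rintro ⟨y, ⟨hy, hyr⟩, he⟩
      rw [← he]
      exact ⟨⟨mem_modelCone.2 ⟨y, hy.1, hy.2, rfl⟩, fun i => i.elim0, fun i => i.elim0⟩,
        fun h => hyr ((hω y hy).1 h)⟩

end Connectedness

end PLTop

namespace PLTop

/-! ### Interior points against boundary points, and surfaces filling a given boundary. -/

section Exclusivity

variable {E F : Type*} [NormedAddCommGroup E] [NormedSpace ℝ E]
  [NormedAddCommGroup F] [NormedSpace ℝ F]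

/-! ### Interior points are not boundary points -/

/-- Near its centre a model is invariant under expansion from the centre. -/
lemma eventually_expand_mem_model (n k : ℕ) {η : ℝ} (hη : 0 < η) :
    ∀ᶠ q in 𝓝[model n k] (modelCentre n k),
      modelCentre n k + η⁻¹ • (q - modelCentre n k) ∈ model n k := by
  have hc0 : legCoord k (barycentre k) = 0 := by
    rw [← conePt_zero, legCoord_conePt (by simp [IsLeg])]
  have hpl : IsPLOn (fun q : (Fin (k + 2) → ℝ) × (Fin (n - k) → ℝ) => ∑ i, legCoord k q.1 i)
      (model n k) :=
    (IsPL.sum _ fun i _ => (IsPL.apply i).comp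
      ((isPL_legCoord k).comp IsPL.fst)).isPLOn (isPolytopal_model n k)
  have h1 : ∀ᶠ q in 𝓝[model n k] (modelCentre n k), ∑ i, legCoord k q.1 i < η := by
    refine (hpl.continuousOn _ (modelCentre_mem n k)).eventually_lt continuousWithinAt_const ?_
    simpa [modelCentre, hc0] using hη
  have h2 : ∀ᶠ q in 𝓝[model n k] (modelCentre n k), ‖q.2‖ < η := by
    have : ContinuousAt (fun q : (Fin (k + 2) → ℝ) × (Fin (n - k) → ℝ) => ‖q.2‖)
      (modelCentre n k) := by fun_prop
    refine (this.eventually_lt continuousAt_const ?_).filter_mono nhdsWithin_le_nhds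
    simpa [modelCentre] using hη
  filter_upwards [h1, h2, self_mem_nhdsWithin] with q hq1 hq2 hq
  obtain ⟨y, hy, -, hqy⟩ := mem_modelCone.1 hq.1
  rw [hqy, legCoord_conePt hy] at hq1
  have hb : ∀ j, |q.2 j| ≤ η := fun j => (norm_le_pi_norm q.2 j).trans hq2.le
  have he : modelCentre n k + η⁻¹ • (q - modelCentre n k) = (conePt k (η⁻¹ • y), η⁻¹ • q.2) := by
    rw [conePt_smul, ← hqy]
    ext i <;> simp [modelCentre]
  rw [he]
  refine ⟨mem_modelCone.2 ⟨_, hy.smul (inv_nonneg.2 hη.le), ?_, rfl⟩, fun j => ?_, fun j => ?_⟩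
  · simp only [Pi.smul_apply, smul_eq_mul, ← Finset.mul_sum]
    rw [inv_mul_le_one₀ hη]
    exact hq1.le
  · have h5 := (abs_le.1 (hb j)).1
    simp only [Pi.smul_apply, smul_eq_mul]
    rw [← sub_nonneg, sub_neg_eq_add, inv_mul_eq_div]
    have : 0 ≤ (q.2 j + η) / η := div_nonneg (by linarith) hη.le
    rwa [add_div, div_self hη.ne'] at this
  · have h5 := (abs_le.1 (hb j)).2
    simp only [Pi.smul_apply, smul_eq_mul]
    rw [inv_mul_le_one₀ hη]
    exact h5

/-- In the boundary model the functional `φ` of `exists_separating_functional` vanishes exactly on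
the transverse segment over the centre and takes both signs arbitrarily near its foot. Seen in the
interior model, the germ of that segment is a straight ray, whose complement is connected. The
intermediate value theorem yields a contradiction. -/
theorem not_isBoundaryPointOfType_of_isPointOfType [FiniteDimensional ℝ E] {P : Set E} {x : E}
    (hx : x ∈ P) {k k' : ℕ} (hk : k ≤ 2) (hk' : k' < 2) (h1 : IsPointOfType 2 k P x) :
    ¬ IsBoundaryPointOfType 2 k' P x := by
  rintro ⟨N₂, hN₂P, hN₂, f₂, hf₂, hb₂, hx₂⟩
  obtain ⟨N₁, hN₁P, hN₁, f₁, hf₁, hb₁, hx₁⟩ := h1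
  obtain ⟨g₁, hg₁, hgb₁, hgf₁, hfg₁⟩ := hf₁.exists_inverse hb₁
  obtain ⟨g₂, hg₂, hgb₂, hgf₂, hfg₂⟩ := hf₂.exists_inverse hb₂
  change IsPLOn g₂ (model 1 k' ×ˢ Icc (0 : ℝ) 1) at hg₂
  change BijOn g₂ (model 1 k' ×ˢ Icc (0 : ℝ) 1) N₂ at hgb₂
  change BijOn f₂ N₂ (model 1 k' ×ˢ Icc (0 : ℝ) 1) at hb₂
  change f₂ x = (modelCentre 1 k', 0) at hx₂
  change ∀ y ∈ model 1 k' ×ˢ Icc (0 : ℝ) 1, f₂ (g₂ y) = y at hfg₂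
  set c := modelCentre 1 k' with hc
  set c₁ := modelCentre 2 k with hc₁
  set Q₁ := model 2 k with hQ₁
  set Q₂ := model 1 k' ×ˢ Icc (0 : ℝ) 1 with hQ₂
  have hxN₁ : x ∈ N₁ := mem_of_mem_nhdsWithin hx hN₁
  have hxN₂ : x ∈ N₂ := mem_of_mem_nhdsWithin hx hN₂
  have hcQ₁ : c₁ ∈ Q₁ := modelCentre_mem 2 k
  have hgc₁ : g₁ c₁ = x := by rw [← hx₁, hgf₁ x hxN₁]
  have hgc₂ : g₂ (c, 0) = x := by rw [← hx₂, hgf₂ x hxN₂]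
  obtain ⟨φ, ⟨m₁, hm₁, hφ₁⟩, ⟨m₂, hm₂, hφ₂⟩, hφ⟩ := exists_separating_functional hk'
  have hdQ₂ : ∀ t ∈ Icc (0 : ℝ) 1, (c, t) ∈ Q₂ := fun t ht => ⟨modelCentre_mem 1 k', ht⟩
  -- the image in `P` of the segment transverse to the boundary is a segment near `x`
  obtain ⟨ε₁, hε₁, hε₁1, u, hu⟩ : ∃ ε, 0 < ε ∧ ε ≤ 1 ∧ ∃ w : E, ∀ t ∈ Icc (0 : ℝ) ε,
      g₂ (c, t) = x + t • w := by
    obtain ⟨ε, hε, hε1, w, hw⟩ := hg₂.exists_affine_germ (x := (c, (0 : ℝ))) (u := (0, (1 : ℝ)))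
      (fun t ht => by simpa using hdQ₂ t ht)
    exact ⟨ε, hε, hε1, w, fun t ht => by simpa [hgc₂] using hw t ht⟩
  -- A second germ, taken along the segment just found and shortened to stay in `N₁`, gives the
  -- direction `u₁` of the ray in the interior model.
  obtain ⟨δ, hδ, hδε, u₁, hseg, hu₁⟩ : ∃ δ, 0 < δ ∧ δ ≤ ε₁ ∧ ∃ u₁,
      (∀ t ∈ Icc (0 : ℝ) δ, x + t • u ∈ N₁) ∧
      ∀ t ∈ Icc (0 : ℝ) δ, f₁ (x + t • u) = c₁ + t • u₁ := by
    obtain ⟨r, hr, hball⟩ := Metric.mem_nhdsWithin_iff.1 hN₁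
    set ε₂ := min ε₁ (r / (2 * (‖u‖ + 1))) with hε₂
    have hε₂0 : 0 < ε₂ := lt_min hε₁ (by positivity)
    have hmem : ∀ t ∈ Icc (0 : ℝ) ε₂, x + t • u ∈ N₁ := by
      intro t ht
      have ht1 : t ∈ Icc (0 : ℝ) ε₁ := ⟨ht.1, ht.2.trans (min_le_left _ _)⟩
      refine hball ⟨?_, ?_⟩
      · rw [Metric.mem_ball, dist_eq_norm, add_sub_cancel_left, norm_smul,
          Real.norm_of_nonneg ht.1]
        have h3 : t ≤ r / (2 * (‖u‖ + 1)) := ht.2.trans (min_le_right _ _)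
        calc t * ‖u‖ ≤ r / (2 * (‖u‖ + 1)) * (‖u‖ + 1) := by
              gcongr
              linarith
          _ = r / 2 := by field_simp
          _ < r := by linarith
      · rw [← hu t ht1]
        exact hN₂P (hgb₂.mapsTo (hdQ₂ t ⟨ht.1, ht1.2.trans hε₁1⟩))
    obtain ⟨ε₃, hε₃, hε₃1, w, hw⟩ := hf₁.exists_affine_germ (x := x) (u := ε₂ • u) (by
      intro t ht
      rw [smul_smul]
      exact hmem _ ⟨mul_nonneg ht.1 hε₂0.le, mul_le_of_le_one_left hε₂0.le ht.2⟩)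
    have hle : ε₃ * ε₂ ≤ ε₂ := mul_le_of_le_one_left hε₂0.le hε₃1
    refine ⟨ε₃ * ε₂, by positivity, hle.trans (min_le_left _ _), ε₂⁻¹ • w,
      fun t ht => hmem t ⟨ht.1, ht.2.trans hle⟩, fun t ht => ?_⟩
    have := hw (t / ε₂) ⟨div_nonneg ht.1 hε₂0.le, (div_le_iff₀ hε₂0).2 ht.2⟩
    rw [smul_smul, div_mul_cancel₀ _ hε₂0.ne', hx₁] at this
    rw [this, smul_smul, div_eq_mul_inv]
  have hδ1 : δ ≤ 1 := hδε.trans hε₁1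
  have hgδ : ∀ t ∈ Icc (0 : ℝ) δ, g₂ (c, t) = x + t • u := fun t ht =>
    hu t ⟨ht.1, ht.2.trans hδε⟩
  have hu₁0 : u₁ ≠ 0 := by
    rintro rfl
    have h3 := hu₁ δ ⟨hδ.le, le_rfl⟩
    rw [smul_zero, add_zero, ← hx₁] at h3
    have h4 := hb₁.injOn (hseg δ ⟨hδ.le, le_rfl⟩) hxN₁ h3
    rw [← hgδ δ ⟨hδ.le, le_rfl⟩, ← hgc₂] at h4
    have h5 := hgb₂.injOn (hdQ₂ δ ⟨hδ.le, hδ1⟩) (hdQ₂ 0 (by simp)) h4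
    exact hδ.ne' (Prod.ext_iff.1 h5).2
  -- a small copy of the interior model
  have hg₁P : MapsTo g₁ Q₁ P := fun q hq => hN₁P (hgb₁.mapsTo hq)
  have hg₁t : Filter.Tendsto g₁ (𝓝[Q₁] c₁) (𝓝[P] x) := by
    have := (hg₁.continuousOn c₁ hcQ₁).tendsto_nhdsWithin hg₁P
    rwa [hgc₁] at this
  have hf₂t : Filter.Tendsto f₂ (𝓝[P] x) (𝓝 (c, 0)) := by
    have := hf₂.continuousOn x hxN₂
    rw [ContinuousWithinAt, hx₂] at this
    exact this.mono_left (by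
      rw [← nhdsWithin_inter_of_mem' (t := N₂) hN₂]
      exact nhdsWithin_mono _ inter_subset_right)
  have hgood : ∀ᶠ q in 𝓝[Q₁] c₁, g₁ q ∈ N₂ ∧ (f₂ (g₁ q)).2 < δ ∧ ‖q - c₁‖ < δ * ‖u₁‖ := by
    have e1 : ∀ᶠ q in 𝓝[Q₁] c₁, g₁ q ∈ N₂ := hg₁t hN₂
    have e2 : ∀ᶠ q in 𝓝[Q₁] c₁, (f₂ (g₁ q)).2 < δ := by
      have := (continuous_snd.tendsto _).comp (hf₂t.comp hg₁t)
      exact this.eventually (gt_mem_nhds hδ)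
    have e3 : ∀ᶠ q in 𝓝[Q₁] c₁, ‖q - c₁‖ < δ * ‖u₁‖ := by
      have : ContinuousAt (fun q => ‖q - c₁‖) c₁ := by fun_prop
      refine (this.eventually_lt continuousAt_const ?_).filter_mono nhdsWithin_le_nhds
      have : 0 < ‖u₁‖ := norm_pos_iff.2 hu₁0
      simpa using by positivity
    exact e1.and (e2.and e3)
  obtain ⟨r, hr, hball⟩ := Metric.mem_nhdsWithin_iff.1 hgood
  obtain ⟨η, hη, hη1, hηr⟩ : ∃ η : ℝ, 0 < η ∧ η ≤ 1 ∧
      ∀ q ∈ Q₁, c₁ + η • (q - c₁) ∈ Metric.ball c₁ r := by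
    obtain ⟨B, hB⟩ := (isPolytopal_model 2 k).isCompact.isBounded.exists_norm_le
    set B' := |B| + ‖c₁‖ + 1 with hB'
    have hB'0 : 0 < B' := by positivity
    refine ⟨min 1 (r / (2 * B')), lt_min one_pos (by positivity), min_le_left _ _, fun q hq => ?_⟩
    rw [Metric.mem_ball, dist_eq_norm, add_sub_cancel_left, norm_smul,
      Real.norm_of_nonneg (le_min zero_le_one (by positivity))]
    have h3 : ‖q - c₁‖ ≤ B' := by
      have := norm_sub_le q c₁
      have := hB q hq
      have := le_abs_self B
      linarith
    calc min 1 (r / (2 * B')) * ‖q - c₁‖ ≤ r / (2 * B') * B' := by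
          gcongr
          exact min_le_right _ _
      _ = r / 2 := by field_simp
      _ < r := by linarith
  -- Contraction to the centre preserves the ray, so `K` is connected and still misses it, while
  -- lying where both charts are defined.
  set K := (fun q => c₁ + η • (q - c₁)) '' (Q₁ \ ray c₁ u₁) with hK
  have hKpre : IsPreconnected K :=
    (isPreconnected_model_diff_ray hk u₁ hu₁0).image _ (by fun_prop)
  have hKQ : K ⊆ Q₁ := by
    rintro _ ⟨q, ⟨hq, -⟩, rfl⟩
    exact starConvex_model hq hη.le hη1
  have hKgood : ∀ q ∈ K, g₁ q ∈ N₂ ∧ (f₂ (g₁ q)).2 < δ ∧ ‖q - c₁‖ < δ * ‖u₁‖ := by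
    intro q hq
    refine hball ⟨?_, hKQ hq⟩
    obtain ⟨q₀, ⟨hq₀, -⟩, rfl⟩ := hq
    exact hηr q₀ hq₀
  have hcont : ContinuousOn (fun q => φ ((f₂ (g₁ q)).1 - c)) K := by
    have h3 : ContinuousOn (f₂ ∘ g₁) K :=
      hf₂.continuousOn.comp (hg₁.continuousOn.mono hKQ) fun q hq => (hKgood q hq).1
    exact φ.continuous_of_finiteDimensional.comp_continuousOn
      ((continuous_fst.comp_continuousOn h3).sub continuousOn_const)
  -- A zero would lie on the transverse segment, hence on the ray.
  have hne : ∀ q ∈ K, φ ((f₂ (g₁ q)).1 - c) ≠ 0 := by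
    intro q hq h0
    obtain ⟨hqN, hqδ, -⟩ := hKgood q hq
    have hfQ := hb₂.mapsTo hqN
    have h3 := hφ _ hfQ.1 h0
    set s := (f₂ (g₁ q)).2 with hs
    have hs' : s ∈ Icc (0 : ℝ) δ := ⟨hfQ.2.1, hqδ.le⟩
    have h4 : f₂ (g₁ q) = (c, s) := Prod.ext h3 rfl
    have h5 : g₁ q = x + s • u := by rw [← hgδ s hs', ← h4, hgf₂ _ hqN]
    have h6 : q = c₁ + s • u₁ := by rw [← hu₁ s hs', ← h5, hfg₁ _ (hKQ hq)]
    obtain ⟨q₀, ⟨hq₀, hq₀r⟩, rfl⟩ := hq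
    refine hq₀r ⟨s / η, div_nonneg hs'.1 hη.le, ?_⟩
    have h7 : η • (q₀ - c₁) = s • u₁ := by simpa using h6
    rw [div_eq_inv_mul, mul_smul, ← h7, smul_smul, inv_mul_cancel₀ hη.ne', one_smul]
    abel
  -- Points of the boundary face near the centre in the direction of `m` carry the sign of `φ (m -
  -- c)`. They lie in `K`: expansion by `η⁻¹` keeps them in the model, and a point on the ray would
  -- come from the transverse segment, where `φ` vanishes.
  have hsign : ∀ m ∈ model 1 k', φ (m - c) ≠ 0 →
      ∃ q ∈ K, ∃ s : ℝ, 0 < s ∧ φ ((f₂ (g₁ q)).1 - c) = s * φ (m - c) := by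
    intro m hm hφm
    have hpQ : ∀ s ∈ Icc (0 : ℝ) 1, (c + s • (m - c), (0 : ℝ)) ∈ Q₂ := fun s hs =>
      ⟨starConvex_model hm hs.1 hs.2, by simp⟩
    have hIoc : ∀ᶠ s in 𝓝[>] (0 : ℝ), s ∈ Ioc (0 : ℝ) 1 := Ioc_mem_nhdsGT one_pos
    have t1 : Filter.Tendsto (fun s : ℝ => (c + s • (m - c), (0 : ℝ))) (𝓝[>] 0)
        (𝓝[Q₂] (c, 0)) := by
      refine tendsto_nhdsWithin_iff.2 ⟨?_, ?_⟩
      · have : Continuous fun s : ℝ => (c + s • (m - c), (0 : ℝ)) := by fun_prop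
        have h3 := this.tendsto 0
        simp only [zero_smul, add_zero] at h3
        exact h3.mono_left nhdsWithin_le_nhds
      · filter_upwards [hIoc] with s hs
        exact hpQ s ⟨hs.1.le, hs.2⟩
    have t2 : Filter.Tendsto g₂ (𝓝[Q₂] (c, 0)) (𝓝[P] x) := by
      have := (hg₂.continuousOn (c, 0) (hdQ₂ 0 (by simp))).tendsto_nhdsWithin
        (fun q hq => hN₂P (hgb₂.mapsTo hq) : MapsTo g₂ Q₂ P)
      rwa [hgc₂] at this
    have t3 : Filter.Tendsto f₁ (𝓝[P] x) (𝓝[Q₁] c₁) := by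
      refine tendsto_nhdsWithin_iff.2 ⟨?_, ?_⟩
      · have := hf₁.continuousOn x hxN₁
        rw [ContinuousWithinAt, hx₁] at this
        exact this.mono_left (by
          rw [← nhdsWithin_inter_of_mem' (t := N₁) hN₁]
          exact nhdsWithin_mono _ inter_subset_right)
      · filter_upwards [hN₁] with y hy
        exact hb₁.mapsTo hy
    have t4 := t3.comp (t2.comp t1)
    have e1 := (t2.comp t1).eventually hN₁
    have e2 := t4.eventually (eventually_expand_mem_model 2 k hη)
    obtain ⟨s, ⟨hs, hsN⟩, hsq⟩ := ((hIoc.and e1).and e2).exists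
    simp only [Function.comp_apply] at hsN hsq
    set p := (c + s • (m - c), (0 : ℝ)) with hp
    have hpQ₂ : p ∈ Q₂ := hpQ s ⟨hs.1.le, hs.2⟩
    set q := f₁ (g₂ p) with hq
    have hqQ : q ∈ Q₁ := hb₁.mapsTo hsN
    have hgq : g₁ q = g₂ p := hgf₁ _ hsN
    have hqη : c₁ + η • ((c₁ + η⁻¹ • (q - c₁)) - c₁) = q := by
      rw [add_sub_cancel_left, smul_smul, mul_inv_cancel₀ hη.ne', one_smul]
      abel
    have hqball : ‖q - c₁‖ < δ * ‖u₁‖ := by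
      refine (hball ⟨?_, hqQ⟩).2.2
      rw [← hqη]
      exact hηr _ hsq
    have hfgq : (f₂ (g₁ q)).1 - c = s • (m - c) := by
      rw [hgq, hfg₂ p hpQ₂, hp, add_sub_cancel_left]
    refine ⟨q, ⟨_, ⟨hsq, ?_⟩, hqη⟩, s, hs.1, by rw [hfgq, map_smul, smul_eq_mul]⟩
    rintro ⟨t, ht, he⟩
    have h3 : q = c₁ + (η * t) • u₁ := by
      rw [← hqη, he, add_sub_cancel_left, smul_smul]
    have h4 : η * t ∈ Icc (0 : ℝ) δ := by
      refine ⟨by positivity, ?_⟩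
      rw [h3, add_sub_cancel_left, norm_smul, Real.norm_of_nonneg (by positivity)] at hqball
      exact (lt_of_mul_lt_mul_right hqball (norm_nonneg _)).le
    have h5 : g₁ q = g₂ (c, η * t) := by
      rw [hgδ _ h4, h3, ← hu₁ _ h4, hgf₁ _ (hseg _ h4)]
    rw [hgq] at h5
    have h6 := hgb₂.injOn hpQ₂ (hdQ₂ _ ⟨h4.1, h4.2.trans hδ1⟩) h5
    have h7 : c + s • (m - c) = c := (Prod.ext_iff.1 h6).1
    have h8 : s • (m - c) = 0 := by simpa using h7
    have h9 : m - c = 0 := (smul_eq_zero.1 h8).resolve_left hs.1.ne'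
    exact hφm (by rw [h9, map_zero])
  obtain ⟨q₁, hq₁, s₁, hs₁, he₁⟩ := hsign m₁ hm₁ hφ₁.ne'
  obtain ⟨q₂, hq₂, s₂, hs₂, he₂⟩ := hsign m₂ hm₂ hφ₂.ne
  have hivt := hKpre.intermediate_value hq₂ hq₁ hcont
  obtain ⟨q, hq, hq0⟩ := hivt (show (0 : ℝ) ∈ Icc _ _ from
    ⟨by rw [he₂]; exact (mul_neg_of_pos_of_neg hs₂ hφ₂).le, by
      rw [he₁]; exact (mul_pos hs₁ hφ₁).le⟩)
  exact hne q hq hq0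

/-! ### Surfaces with prescribed boundary -/

/-- `S` is a finite union of polytopes all of whose points are regular points of a fake surface,
the boundary points being those of `B`. -/
structure Fills (S B : Set E) : Prop where
  isPolytopal : IsPolytopal S
  subset : B ⊆ S
  isBoundaryPoint : ∀ x ∈ B, ∃ k < 2, IsBoundaryPointOfType 2 k S x
  isInteriorPoint : ∀ x ∈ S, x ∉ B → ∃ k ≤ 2, IsPointOfType 2 k S x

lemma Fills.isSingularManifoldWithBoundary [FiniteDimensional ℝ E] {S B : Set E}
    (h : Fills S B) : IsSingularManifoldWithBoundary 2 S := by
  refine ⟨h.isPolytopal.isPolyhedron, fun x hx => ?_⟩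
  by_cases hxB : x ∈ B
  · exact Or.inr (h.isBoundaryPoint x hxB)
  · exact Or.inl (h.isInteriorPoint x hx hxB)

/-- `Fills` prescribes a type at every point; exclusivity of interior and boundary types excludes
boundary points outside `B`. -/
lemma Fills.singularBoundary_eq [FiniteDimensional ℝ E] {S B : Set E} (h : Fills S B) :
    singularBoundary 2 S = B := by
  ext x
  constructor
  · rintro ⟨hx, k, hk, hbd⟩
    by_contra hxB
    obtain ⟨k', hk', hint⟩ := h.isInteriorPoint x hx hxB
    exact not_isBoundaryPointOfType_of_isPointOfType hx hk' hk hint hbd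
  · exact fun hx => ⟨h.subset hx, h.isBoundaryPoint x hx⟩

/-- Model neighbourhoods are preserved by affine embeddings onto a neighbourhood. -/
lemma HasModelNhd.image {H : Type*} [NormedAddCommGroup H] [NormedSpace ℝ H]
    [FiniteDimensional ℝ E] [FiniteDimensional ℝ F] {P : Set E} {x : E} {Q : Set H} {y : H}
    (h : HasModelNhd P x Q y) (j : E →ᵃ[ℝ] F) (l : F →ᵃ[ℝ] E)
    (hl : ∀ p, l (j p) = p) {P' : Set F} (hP' : j '' P ∈ 𝓝[P'] (j x)) (hsub : j '' P ⊆ P') :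
    HasModelNhd P' (j x) Q y := by
  obtain ⟨N, hNP, hN, f, hf, hb, hfx⟩ := h
  have hlcont : Continuous l := l.continuous_of_finiteDimensional
  refine ⟨j '' N, (image_mono hNP).trans hsub, ?_, f ∘ l, ?_, ?_, ?_⟩
  · have ht : Filter.Tendsto l (𝓝[P'] (j x)) (𝓝[P] x) := by
      refine tendsto_nhdsWithin_iff.2 ⟨?_, ?_⟩
      · have := hlcont.tendsto (j x)
        rw [hl] at this
        exact this.mono_left nhdsWithin_le_nhds
      · filter_upwards [hP'] with q hq
        obtain ⟨p, hp, rfl⟩ := hq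
        rwa [hl]
    filter_upwards [hP', ht hN] with q hq hqN
    obtain ⟨p, hp, rfl⟩ := hq
    rw [mem_preimage, hl] at hqN
    exact mem_image_of_mem _ hqN
  · refine hf.comp ((IsPL.of_affine l).isPLOn (hf.isPolytopal.image j)) ?_
    rintro _ ⟨p, hp, rfl⟩
    rwa [hl]
  · refine ⟨?_, ?_, ?_⟩
    · rintro _ ⟨p, hp, rfl⟩
      rw [Function.comp_apply, hl]
      exact hb.mapsTo hp
    · rintro _ ⟨p, hp, rfl⟩ _ ⟨p', hp', rfl⟩ he
      rw [Function.comp_apply, Function.comp_apply, hl, hl] at he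
      rw [hb.injOn hp hp' he]
    · intro z hz
      obtain ⟨p, hp, rfl⟩ := hb.surjOn hz
      exact ⟨j p, mem_image_of_mem _ hp, by rw [Function.comp_apply, hl]⟩
  · rw [Function.comp_apply, hl, hfx]

lemma Fills.image [FiniteDimensional ℝ E] [FiniteDimensional ℝ F] {S B : Set E} (h : Fills S B)
    (j : E →ᵃ[ℝ] F) (l : F →ᵃ[ℝ] E) (hl : ∀ p, l (j p) = p) : Fills (j '' S) (j '' B) := by
  have hinj : Function.Injective j := Function.LeftInverse.injective hl
  refine ⟨h.isPolytopal.image j, image_mono h.subset, ?_, ?_⟩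
  · rintro _ ⟨x, hx, rfl⟩
    obtain ⟨k, hk, hbd⟩ := h.isBoundaryPoint x hx
    exact ⟨k, hk, HasModelNhd.image hbd j l hl self_mem_nhdsWithin subset_rfl⟩
  · rintro _ ⟨x, hx, rfl⟩ hxB
    obtain ⟨k, hk, hint⟩ := h.isInteriorPoint x hx fun hb => hxB (mem_image_of_mem _ hb)
    exact ⟨k, hk, HasModelNhd.image hint j l hl self_mem_nhdsWithin subset_rfl⟩

lemma Fills.union [FiniteDimensional ℝ E] {S B S' B' : Set E} (h : Fills S B) (h' : Fills S' B')
    (hd : Disjoint S S') : Fills (S ∪ S') (B ∪ B') := by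
  have key : ∀ {S S' : Set E}, IsPolytopal S' → Disjoint S S' → ∀ x ∈ S, ∀ {H : Type}
      [NormedAddCommGroup H] [NormedSpace ℝ H] {Q : Set H} {y : H}, HasModelNhd S x Q y →
      HasModelNhd (S ∪ S') x Q y := by
    intro S S' hS' hd x hx H _ _ Q y hm
    have hnhd : S ∈ 𝓝[S ∪ S'] x := by
      have : S'ᶜ ∈ 𝓝 x :=
        hS'.isCompact.isClosed.isOpen_compl.mem_nhds (disjoint_left.1 hd hx)
      filter_upwards [self_mem_nhdsWithin, nhdsWithin_le_nhds this] with p hp hp'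
      exact hp.resolve_right hp'
    exact HasModelNhd.image hm (AffineMap.id ℝ E) (AffineMap.id ℝ E) (fun _ => rfl)
      (by simpa using hnhd) (by simp)
  refine ⟨h.isPolytopal.union h'.isPolytopal, union_subset_union h.subset h'.subset, ?_, ?_⟩
  · rintro x (hx | hx)
    · obtain ⟨k, hk, hbd⟩ := h.isBoundaryPoint x hx
      exact ⟨k, hk, key h'.isPolytopal hd x (h.subset hx) hbd⟩
    · obtain ⟨k, hk, hbd⟩ := h'.isBoundaryPoint x hx
      rw [union_comm]
      exact ⟨k, hk, key h.isPolytopal hd.symm x (h'.subset hx) hbd⟩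
  · rintro x (hx | hx) hxB
    · obtain ⟨k, hk, hint⟩ := h.isInteriorPoint x hx fun hb => hxB (Or.inl hb)
      exact ⟨k, hk, key h'.isPolytopal hd x hx hint⟩
    · obtain ⟨k, hk, hint⟩ := h'.isInteriorPoint x hx fun hb => hxB (Or.inr hb)
      rw [union_comm]
      exact ⟨k, hk, key h.isPolytopal hd.symm x hx hint⟩

end Exclusivity

end PLTop

namespace PLTop

/-! ### Trivalent graphs as finite simple graphs with straight edges. -/

section GraphStructure

variable {E : Type*} [NormedAddCommGroup E] [NormedSpace ℝ E]

/-! ### Trivalent graphs are unions of straight edges -/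

lemma isLeg_one_single (j : Fin 3) : IsLeg 1 (Pi.single j (1 : ℝ) : Fin 3 → ℝ) := by
  refine ⟨fun i => ?_, ?_⟩
  · by_cases hij : i = j
    · subst hij; simp
    · simp [hij]
  · refine (Set.ncard_le_ncard (t := {j}) (fun i hi => ?_)).trans (by simp)
    by_contra hij
    exact hi (by simp only [mem_singleton_iff] at hij; simp [hij])

lemma IsLeg.eq_smul_single {y : Fin 3 → ℝ} (hy : IsLeg 1 y) :
    ∃ i, y = y i • (Pi.single i (1 : ℝ) : Fin 3 → ℝ) := by
  by_cases h : ∃ i, y i ≠ 0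
  · obtain ⟨i, hi⟩ := h
    refine ⟨i, ?_⟩
    ext j
    by_cases hij : j = i
    · subst hij; simp
    · have : y j = 0 := by
        by_contra hj
        exact hij ((Set.ncard_le_one (Set.toFinite _)).1 hy.2 j hj i hi)
      simp [hij, this]
  · push Not at h
    exact ⟨0, by ext j; simp [h]⟩

/-- The one-dimensional models consist of two or three legs. -/
lemma exists_legs {k : ℕ} (hk : k ≤ 1) : ∃ d : ℕ, (d = 2 ∨ d = 3) ∧
    ∃ w : Fin d → (Fin (k + 2) → ℝ) × (Fin (1 - k) → ℝ), (∀ i, w i ≠ 0) ∧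
      (∀ i, ∀ t ∈ Icc (0 : ℝ) 1, modelCentre 1 k + t • w i ∈ model 1 k) ∧
      (∀ q ∈ model 1 k, ∃ i, ∃ t ∈ Icc (0 : ℝ) 1, q = modelCentre 1 k + t • w i) ∧
      ∀ i j, ∀ s t : ℝ, 0 < s → 0 < t → s • w i = t • w j → i = j := by
  have hk : k = 0 ∨ k = 1 := by omega
  rcases hk with rfl | rfl
  · refine ⟨2, Or.inl rfl, ![(0, fun _ => 1), (0, fun _ => -1)], ?_, ?_, ?_, ?_⟩
    · intro i h
      fin_cases i
      · have := congrFun (Prod.ext_iff.1 h).2 (0 : Fin 1)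
        simp at this
      · have := congrFun (Prod.ext_iff.1 h).2 (0 : Fin 1)
        simp at this
    · intro i t ht
      fin_cases i
      · refine ⟨?_, fun j => ?_, fun j => ?_⟩
        · change barycentre 0 + t • (0 : Fin 2 → ℝ) ∈ modelCone 0
          rw [smul_zero, add_zero]
          exact barycentre_mem_modelCone 0
        · simp [modelCentre]; linarith [ht.1]
        · simpa [modelCentre] using ht.2
      · refine ⟨?_, fun j => ?_, fun j => ?_⟩
        · change barycentre 0 + t • (0 : Fin 2 → ℝ) ∈ modelCone 0
          rw [smul_zero, add_zero]
          exact barycentre_mem_modelCone 0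
        · simpa [modelCentre] using ht.2
        · simp [modelCentre]; linarith [ht.1]
    · rintro ⟨x, t⟩ ⟨hx, ht⟩
      obtain ⟨y, hy, -, hxy⟩ := mem_modelCone.1 hx
      have hy0 : y = 0 := by
        have h1 := hy.2
        rw [Nat.le_zero, Set.ncard_eq_zero] at h1
        ext i
        by_contra hne
        have : i ∈ {i | y i ≠ 0} := hne
        rw [h1] at this
        exact this
      rw [hy0, conePt_zero] at hxy
      dsimp only at hxy
      subst hxy
      have h1 := ht.1 (0 : Fin 1)
      have h2 := ht.2 (0 : Fin 1)
      dsimp only at h1 h2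
      rcases le_total 0 (t (0 : Fin 1)) with h0 | h0
      · refine ⟨0, t (0 : Fin 1), ⟨h0, h2⟩, Prod.ext (by simp [modelCentre]) ?_⟩
        ext j
        have hj : j = (0 : Fin 1) := Subsingleton.elim (α := Fin 1) _ _
        subst hj
        simp [modelCentre]
      · refine ⟨1, -t (0 : Fin 1), ⟨by linarith, by linarith⟩,
          Prod.ext (by simp [modelCentre]) ?_⟩
        ext j
        have hj : j = (0 : Fin 1) := Subsingleton.elim (α := Fin 1) _ _
        subst hj
        simp [modelCentre]
    · intro i j s t hs ht h
      have h1 := congrFun (Prod.ext_iff.1 h).2 (0 : Fin 1)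
      fin_cases i <;> fin_cases j <;> simp at h1 ⊢ <;> linarith
  · have hw : ∀ (i : Fin 3) (t : ℝ), modelCentre 1 1 +
        t • ((conePt 1 (Pi.single i 1) - barycentre 1, 0) : (Fin 3 → ℝ) × (Fin 0 → ℝ)) =
        (conePt 1 (t • Pi.single i 1), 0) := by
      intro i t
      rw [conePt_smul]
      exact Prod.ext rfl (Subsingleton.elim (α := Fin 0 → ℝ) _ _)
    refine ⟨3, Or.inr rfl, fun i => (conePt 1 (Pi.single i 1) - barycentre 1, 0), ?_, ?_, ?_, ?_⟩
    · intro i h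
      have h1 : conePt 1 (Pi.single i 1) = conePt 1 0 := by
        rw [conePt_zero]
        exact sub_eq_zero.1 (Prod.ext_iff.1 h).1
      have h2 := congrArg (legCoord 1) h1
      rw [legCoord_conePt (isLeg_one_single i), legCoord_conePt (by simp [IsLeg])] at h2
      simpa using congrFun h2 i
    · intro i t ht
      rw [hw]
      refine ⟨mem_modelCone.2 ⟨_, (isLeg_one_single i).smul ht.1, ?_, rfl⟩,
        fun j => j.elim0, fun j => j.elim0⟩
      simp [← Finset.mul_sum, ht.2]
    · rintro ⟨x, t⟩ ⟨hx, -⟩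
      obtain ⟨y, hy, hsum, hxy⟩ := mem_modelCone.1 hx
      obtain ⟨i, hi⟩ := hy.eq_smul_single
      refine ⟨i, y i, ⟨hy.1 i, (Finset.single_le_sum (fun i _ => hy.1 i)
        (Finset.mem_univ i)).trans hsum⟩, ?_⟩
      rw [hw, ← hi]
      exact Prod.ext hxy (Subsingleton.elim (α := Fin 0 → ℝ) _ _)
    · intro i j s t hs ht h
      have h1 : conePt 1 (s • Pi.single i 1) = conePt 1 (t • Pi.single j 1) := by
        have h2 := congrArg (fun z => modelCentre 1 1 + z) h
        dsimp only at h2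
        rw [hw, hw] at h2
        exact (Prod.ext_iff.1 h2).1
      have h2 := congrArg (legCoord 1) h1
      rw [legCoord_conePt ((isLeg_one_single i).smul hs.le),
        legCoord_conePt ((isLeg_one_single j).smul ht.le)] at h2
      by_contra hij
      have h3 := congrFun h2 i
      simp [hij] at h3
      exact hs.ne' h3

/-- Near each of its points a trivalent graph consists of two or three straight segments. -/
lemma exists_rays [FiniteDimensional ℝ E] {T : Set E} (hT : IsSingularManifold 1 T) {z : E}
    (hz : z ∈ T) : ∃ d : ℕ, (d = 2 ∨ d = 3) ∧ ∃ u : Fin d → E, (∀ i, u i ≠ 0) ∧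
      (∀ i, ∀ t ∈ Icc (0 : ℝ) 1, z + t • u i ∈ T) ∧
      (∀ᶠ y in 𝓝[T] z, ∃ i, ∃ t ∈ Icc (0 : ℝ) 1, y = z + t • u i) ∧
      ∀ i j, ∀ s t : ℝ, 0 < s → 0 < t → s • u i = t • u j → i = j := by
  obtain ⟨k, hk, N, hNT, hN, f, hf, hb, hfz⟩ := hT.2 z hz
  obtain ⟨g, hg, hgb, hgf, hfg⟩ := hf.exists_inverse hb
  obtain ⟨d, hd, w, hw0, hwmem, hwall, hwinj⟩ := exists_legs hk
  have hzN : z ∈ N := mem_of_mem_nhdsWithin hz hN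
  set c := modelCentre 1 k with hc
  have hgc : g c = z := by rw [← hfz, hgf z hzN]
  -- The inverse chart carries each leg of the model to an arc with a straight germ at `z`.
  have hgerm : ∀ i, ∃ ε : ℝ, 0 < ε ∧ ε ≤ 1 ∧ ∃ v : E, ∀ t ∈ Icc (0 : ℝ) ε,
      g (c + t • w i) = z + t • v := by
    intro i
    obtain ⟨ε, h1, h2, v, hv⟩ := hg.exists_affine_germ (x := c) (u := w i) (hwmem i)
    exact ⟨ε, h1, h2, v, fun t ht => by rw [hv t ht, hgc]⟩
  choose ε hε hε1 v hv using hgerm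
  have hdpos : Nonempty (Fin d) := ⟨⟨0, by omega⟩⟩
  obtain ⟨δ, hδ, hδε⟩ : ∃ δ : ℝ, 0 < δ ∧ ∀ i, δ ≤ ε i := by
    obtain ⟨i, -, hi⟩ := Finset.exists_min_image Finset.univ ε Finset.univ_nonempty
    exact ⟨ε i, hε i, fun j => hi j (Finset.mem_univ j)⟩
  have hδ1 : δ ≤ 1 := (hδε (Classical.arbitrary _)).trans (hε1 _)
  have hgδ : ∀ i, ∀ t ∈ Icc (0 : ℝ) δ, g (c + t • w i) = z + t • v i := fun i t ht =>
    hv i t ⟨ht.1, ht.2.trans (hδε i)⟩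
  have hmemδ : ∀ i, ∀ t ∈ Icc (0 : ℝ) δ, c + t • w i ∈ model 1 k := fun i t ht =>
    hwmem i t ⟨ht.1, ht.2.trans hδ1⟩
  have hv0 : ∀ i, v i ≠ 0 := by
    intro i h0
    have h1 := hgδ i δ ⟨hδ.le, le_rfl⟩
    rw [h0, smul_zero, add_zero, ← hgc] at h1
    have h2 := hgb.injOn (hmemδ i δ ⟨hδ.le, le_rfl⟩) (modelCentre_mem 1 k) h1
    have h3 : δ • w i = 0 := add_eq_left.1 h2
    exact (smul_ne_zero hδ.ne' (hw0 i)) h3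
  refine ⟨d, hd, fun i => δ • v i, fun i => smul_ne_zero hδ.ne' (hv0 i), ?_, ?_, ?_⟩
  · intro i t ht
    have h1 : t * δ ∈ Icc (0 : ℝ) δ := ⟨by have := ht.1; positivity, by nlinarith [ht.2]⟩
    rw [smul_smul, ← hgδ i _ h1]
    exact hNT (hgb.mapsTo (hmemδ i _ h1))
  · have ht : Filter.Tendsto f (𝓝[T] z) (𝓝 c) := by
      have := hf.continuousOn z hzN
      rw [ContinuousWithinAt, hfz] at this
      exact this.mono_left (by
        rw [← nhdsWithin_inter_of_mem' (t := N) hN]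
        exact nhdsWithin_mono _ inter_subset_right)
    have hsmall : ∀ᶠ q in 𝓝 c, ∀ i, ‖q - c‖ < δ * ‖w i‖ := by
      refine Filter.eventually_all.2 fun i => ?_
      have h1 : ContinuousAt (fun q => ‖q - c‖) c := by fun_prop
      refine h1.eventually_lt continuousAt_const ?_
      have : 0 < ‖w i‖ := norm_pos_iff.2 (hw0 i)
      simpa using by positivity
    filter_upwards [hN, ht.eventually hsmall] with y hyN hy
    obtain ⟨i, t, ht, he⟩ := hwall (f y) (hb.mapsTo hyN)
    have h1 := hy i
    rw [he, add_sub_cancel_left, norm_smul, Real.norm_of_nonneg ht.1] at h1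
    have h2 : t < δ := lt_of_mul_lt_mul_right h1 (norm_nonneg _)
    refine ⟨i, t / δ, ⟨by have := ht.1; positivity, (div_le_one hδ).2 h2.le⟩, ?_⟩
    rw [smul_smul, div_mul_cancel₀ _ hδ.ne', ← hgδ i t ⟨ht.1, h2.le⟩, ← he, hgf y hyN]
  · intro i j s t hs ht h
    dsimp only at h
    rw [smul_smul, smul_smul] at h
    -- The parameters may be large; dividing by their sum brings both into the range where the
    -- inverse chart is injective.
    set m := s + t with hm
    have hm0 : 0 < m := by positivity
    have h1 : s / m * δ ∈ Icc (0 : ℝ) δ := ⟨by positivity,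
      mul_le_of_le_one_left hδ.le ((div_le_one hm0).2 (by linarith))⟩
    have h2 : t / m * δ ∈ Icc (0 : ℝ) δ := ⟨by positivity,
      mul_le_of_le_one_left hδ.le ((div_le_one hm0).2 (by linarith))⟩
    have h3 : g (c + (s / m * δ) • w i) = g (c + (t / m * δ) • w j) := by
      rw [hgδ i _ h1, hgδ j _ h2]
      have : (s / m * δ) • v i = m⁻¹ • ((s * δ) • v i) := by
        rw [smul_smul]; congr 1; ring
      rw [this, h, smul_smul]
      congr 2
      ring
    have h4 := hgb.injOn (hmemδ i _ h1) (hmemδ j _ h2) h3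
    exact hwinj i j _ _ (by positivity) (by positivity) (add_left_cancel h4)

/-- Near `z` the set `T` is an open straight segment. -/
def IsStraight (T : Set E) (z : E) : Prop :=
  ∃ u : E, u ≠ 0 ∧ (∀ t ∈ Icc (-1 : ℝ) 1, z + t • u ∈ T) ∧
    ∀ᶠ y in 𝓝[T] z, ∃ t ∈ Icc (-1 : ℝ) 1, y = z + t • u

/-- The points near which `T` is not a straight segment. -/
def corners (T : Set E) : Set E := {z | z ∈ T ∧ ¬ IsStraight T z}

/-- Near `z` the graph consists of legs. Inside one leg it is straight, since the other legs are
compact and miss the point. -/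
lemma eventually_isStraight [FiniteDimensional ℝ E] {T : Set E} (hT : IsSingularManifold 1 T)
    {z : E} (hz : z ∈ T) : ∀ᶠ y in 𝓝[T] z, y ≠ z → IsStraight T y := by
  obtain ⟨d, -, u, hu0, humem, hunhd, huinj⟩ := exists_rays hT hz
  obtain ⟨U, hU, hzU, hUT⟩ := mem_nhdsWithin.1 hunhd
  have hsmall : ∀ᶠ y in 𝓝[T] z, ∀ i, ‖y - z‖ < ‖u i‖ := by
    refine Filter.eventually_all.2 fun i => ?_
    have h1 : ContinuousAt (fun q => ‖q - z‖) z := by fun_prop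
    refine (h1.eventually_lt continuousAt_const ?_).filter_mono nhdsWithin_le_nhds
    simpa using hu0 i
  filter_upwards [mem_nhdsWithin_of_mem_nhds (hU.mem_nhds hzU), hsmall, self_mem_nhdsWithin]
    with y hyU hy hyT hyz
  obtain ⟨i, t, ht, rfl⟩ := hUT ⟨hyU, hyT⟩
  have hui : 0 < ‖u i‖ := norm_pos_iff.2 (hu0 i)
  have ht0 : 0 < t := lt_of_le_of_ne ht.1 fun h => hyz (by simp [← h])
  have ht1 : t < 1 := by
    have h1 := hy i
    rw [add_sub_cancel_left, norm_smul, Real.norm_of_nonneg ht.1] at h1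
    nlinarith
  set δ := min t (1 - t) with hδ
  have hδ0 : 0 < δ := lt_min ht0 (by linarith)
  have hδt : δ ≤ t := min_le_left _ _
  have hδt' : δ ≤ 1 - t := min_le_right _ _
  refine ⟨δ • u i, smul_ne_zero hδ0.ne' (hu0 i), fun s hs => ?_, ?_⟩
  · have : z + t • u i + s • δ • u i = z + (t + s * δ) • u i := by
      rw [add_smul, smul_smul, add_assoc]
    rw [this]
    exact humem i _ ⟨by nlinarith [hs.1], by nlinarith [hs.2]⟩
  · have hoff : ∀ᶠ p in 𝓝[T] (z + t • u i), ∀ j, j ≠ i → ∀ s ∈ Icc (0 : ℝ) 1,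
        p ≠ z + s • u j := by
      refine Filter.eventually_all.2 fun j => ?_
      by_cases hji : j = i
      · simp [hji]
      have hcl : IsClosed ((fun s : ℝ => z + s • u j) '' Icc 0 1) :=
        (isCompact_Icc.image (by fun_prop)).isClosed
      have hnot : z + t • u i ∉ (fun s : ℝ => z + s • u j) '' Icc 0 1 := by
        rintro ⟨s, hs, he⟩
        have h1 : s • u j = t • u i := add_left_cancel he
        rcases hs.1.eq_or_lt with h0 | h0
        · rw [← h0, zero_smul] at h1
          exact smul_ne_zero ht0.ne' (hu0 i) h1.symm
        · exact hji (huinj j i s t h0 ht0 h1)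
      refine Filter.Eventually.filter_mono nhdsWithin_le_nhds ?_
      filter_upwards [hcl.isOpen_compl.mem_nhds hnot] with p hp _ s hs he
      exact hp ⟨s, hs, he.symm⟩
    have hnear : ∀ᶠ p in 𝓝[T] (z + t • u i), ‖p - (z + t • u i)‖ < δ * ‖u i‖ := by
      have h1 : ContinuousAt (fun q => ‖q - (z + t • u i)‖) (z + t • u i) := by fun_prop
      refine (h1.eventually_lt continuousAt_const ?_).filter_mono nhdsWithin_le_nhds
      simpa using by positivity
    filter_upwards [hoff, hnear, self_mem_nhdsWithin,
      mem_nhdsWithin_of_mem_nhds (hU.mem_nhds hyU)] with p hp1 hp2 hpT hpU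
    obtain ⟨j, s, hs, rfl⟩ := hUT ⟨hpU, hpT⟩
    have hji : j = i := by
      by_contra hji
      exact hp1 j hji s hs rfl
    subst hji
    have h1 : z + s • u j - (z + t • u j) = (s - t) • u j := by
      rw [sub_smul]; abel
    rw [h1, norm_smul, Real.norm_eq_abs] at hp2
    have h2 : |s - t| < δ := lt_of_mul_lt_mul_right hp2 (norm_nonneg _)
    have h3 : |(s - t) / δ| ≤ 1 := by
      rw [abs_div, abs_of_pos hδ0]
      exact (div_le_one hδ0).2 h2.le
    refine ⟨(s - t) / δ, abs_le.1 h3, ?_⟩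
    rw [smul_smul, div_mul_cancel₀ _ hδ0.ne', sub_smul]
    abel

/-- Each point of `T` has a neighbourhood with no corner except possibly itself, and `T` is compact.
Corners include bends as well as branch points. -/
lemma finite_corners [FiniteDimensional ℝ E] {T : Set E} (hT : IsFiniteTrivalentGraph T) :
    (corners T).Finite := by
  have key : (corners T ∩ T).Finite := by
    refine hT.1.induction_on (p := fun s => (corners T ∩ s).Finite) (by simp)
      (fun s t hst ht => ht.subset (inter_subset_inter_right _ hst))
      (fun s t hs ht => by rw [inter_union_distrib_left]; exact hs.union ht) fun z hz => ?_
    refine ⟨_, eventually_isStraight hT.2 hz, (finite_singleton z).subset ?_⟩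
    rintro y ⟨hy, hyz⟩
    by_contra hne
    exact hy.2 (hyz hne)
  rwa [inter_eq_left.2 fun z hz => hz.1] at key

/-- Segments in `T` issuing from a straight point have the direction of `T` there. -/
lemma eq_smul_of_straight {T : Set E} {z u w : E}
    (hu : ∀ᶠ y in 𝓝[T] z, ∃ t ∈ Icc (-1 : ℝ) 1, y = z + t • u)
    (hw : ∀ t ∈ Icc (0 : ℝ) 1, z + t • w ∈ T) : ∃ b : ℝ, w = b • u := by
  have ht : Filter.Tendsto (fun t : ℝ => z + t • w) (𝓝[>] 0) (𝓝[T] z) := by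
    refine tendsto_nhdsWithin_iff.2 ⟨?_, ?_⟩
    · have : Continuous fun t : ℝ => z + t • w := by fun_prop
      have h3 := this.tendsto 0
      simp only [zero_smul, add_zero] at h3
      exact h3.mono_left nhdsWithin_le_nhds
    · filter_upwards [(Ioc_mem_nhdsGT one_pos : Ioc (0 : ℝ) 1 ∈ 𝓝[>] 0)] with t ht
      exact hw t ⟨ht.1.le, ht.2⟩
  obtain ⟨t, ⟨s, -, hs⟩, ht0⟩ := ((ht.eventually hu).and
    (self_mem_nhdsWithin : Ioi (0 : ℝ) ∈ 𝓝[>] 0)).exists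
  have h1 : t • w = s • u := add_left_cancel hs
  have ht0' : t ≠ 0 := (mem_Ioi.1 ht0).ne'
  exact ⟨t⁻¹ * s, by rw [mul_smul, ← h1, smul_smul, inv_mul_cancel₀ ht0', one_smul]⟩

/-- A segment of `T` extends until it reaches a corner. -/
lemma exists_first_corner [FiniteDimensional ℝ E] {T : Set E} (hT : IsFiniteTrivalentGraph T)
    {z u : E} (hu : u ≠ 0) {ε : ℝ} (hε : 0 < ε) (hseg : ∀ t ∈ Icc (0 : ℝ) ε, z + t • u ∈ T) :
    ∃ s : ℝ, 0 < s ∧ z + s • u ∈ corners T ∧ (∀ t ∈ Icc (0 : ℝ) s, z + t • u ∈ T) ∧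
      ∀ t ∈ Ioo (0 : ℝ) s, z + t • u ∉ corners T := by
  have hcl : IsClosed T := hT.1.isClosed
  have hcont : Continuous fun t : ℝ => z + t • u := by fun_prop
  -- The segment is prolonged as far as possible; boundedness of `T` stops it, which is why circle
  -- components also have corners.
  set A := {s : ℝ | 0 ≤ s ∧ ∀ t ∈ Icc (0 : ℝ) s, z + t • u ∈ T} with hA
  have hεA : ε ∈ A := ⟨hε.le, hseg⟩
  have hbdd : BddAbove A := by
    obtain ⟨B, hB⟩ := hT.1.isBounded.exists_norm_le
    refine ⟨(B + ‖z‖) / ‖u‖, fun s hs => ?_⟩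
    have h1 := hB _ (hs.2 s ⟨hs.1, le_rfl⟩)
    have h2 : ‖s • u‖ ≤ B + ‖z‖ := by
      have := norm_sub_le (z + s • u) z
      rw [add_sub_cancel_left] at this
      linarith
    rw [norm_smul, Real.norm_of_nonneg hs.1] at h2
    rwa [le_div_iff₀ (norm_pos_iff.2 hu)]
  set s₀ := sSup A with hs₀
  have hεs : ε ≤ s₀ := le_csSup hbdd hεA
  have hs₀0 : 0 < s₀ := hε.trans_le hεs
  have hlt : ∀ t ∈ Ico (0 : ℝ) s₀, z + t • u ∈ T := by
    intro t ht
    obtain ⟨s, hs, hts⟩ := exists_lt_of_lt_csSup ⟨ε, hεA⟩ ht.2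
    exact hs.2 t ⟨ht.1, hts.le⟩
  have hle : ∀ t ∈ Icc (0 : ℝ) s₀, z + t • u ∈ T := by
    have h1 : Icc (0 : ℝ) s₀ ⊆ (fun t : ℝ => z + t • u) ⁻¹' T := by
      rw [← closure_Ico hs₀0.ne]
      exact (hcl.preimage hcont).closure_subset_iff.2 hlt
    exact h1
  -- If `T` were straight at the furthest point, its direction would be that of the arriving
  -- segment, which could then be prolonged.
  have hcorner : z + s₀ • u ∈ corners T := by
    refine ⟨hle s₀ ⟨hs₀0.le, le_rfl⟩, ?_⟩
    rintro ⟨v, hv0, hvT, hv⟩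
    obtain ⟨b, hb⟩ := eq_smul_of_straight (w := -(s₀ • u)) hv (fun t ht => by
      have : z + s₀ • u + t • -(s₀ • u) = z + ((1 - t) * s₀) • u := by module
      rw [this]
      exact hle _ ⟨by nlinarith [ht.2], by nlinarith [ht.1]⟩)
    have hb0 : b ≠ 0 := by
      rintro rfl
      rw [zero_smul, neg_eq_zero] at hb
      exact smul_ne_zero hs₀0.ne' hu hb
    have hvu : u = (-(b / s₀)) • v := by
      have h1 : s₀ • u = -(b • v) := by rw [← hb, neg_neg]
      have h2 : u = s₀⁻¹ • (s₀ • u) := by rw [smul_smul, inv_mul_cancel₀ hs₀0.ne', one_smul]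
      rw [h2, h1]
      module
    set a := |b / s₀| with ha
    have ha0 : 0 < a := abs_pos.2 (div_ne_zero hb0 hs₀0.ne')
    have hmem : s₀ + a⁻¹ ∈ A := by
      refine ⟨by positivity, fun t ht => ?_⟩
      rcases le_total t s₀ with h | h
      · exact hle t ⟨ht.1, h⟩
      · have h1 : z + t • u = z + s₀ • u + ((t - s₀) * (-(b / s₀))) • v := by
          rw [mul_smul, ← hvu]
          module
        rw [h1]
        refine hvT _ (abs_le.1 ?_)
        rw [abs_mul, abs_neg, ← ha, abs_of_nonneg (by linarith)]
        have h2 : t - s₀ ≤ a⁻¹ := by linarith [ht.2]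
        calc (t - s₀) * a ≤ a⁻¹ * a := by gcongr
          _ = 1 := inv_mul_cancel₀ ha0.ne'
    have := le_csSup hbdd hmem
    have : 0 < a⁻¹ := by positivity
    linarith
  have hinj : Function.Injective fun t : ℝ => z + t • u := fun s t h =>
    smul_left_injective ℝ hu (add_left_cancel h)
  -- Other corners may lie on the way; finiteness provides a first one.
  have hfin : (Ioc (0 : ℝ) s₀ ∩ (fun t : ℝ => z + t • u) ⁻¹' corners T).Finite :=
    ((finite_corners hT).preimage hinj.injOn).inter_of_right _
  obtain ⟨s, ⟨hs, hsc⟩, hmin⟩ := hfin.exists_minimalFor id _ ⟨s₀, ⟨hs₀0, le_rfl⟩, hcorner⟩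
  refine ⟨s, hs.1, hsc, fun t ht => hle t ⟨ht.1, ht.2.trans hs.2⟩, fun t ht hcon => ?_⟩
  have := hmin ⟨⟨ht.1, ht.2.le.trans hs.2⟩, hcon⟩ ht.2.le
  exact absurd this (not_le.2 ht.2)

/-- The graph whose vertices are the corners and whose edges are the straight segments of `T`
between them. -/
def cornerGraph (T : Set E) : SimpleGraph (corners T) where
  Adj a b := a ≠ b ∧ segment ℝ (a : E) b ⊆ T ∧ ∀ y ∈ openSegment ℝ (a : E) b, y ∉ corners T
  symm := ⟨fun a b h => ⟨h.1.symm, by rw [segment_symm]; exact h.2.1,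
    by rw [openSegment_symm]; exact h.2.2⟩⟩
  loopless := ⟨fun a h => h.1 rfl⟩

/-- Two points of a line are adjacent if the line segment between them lies in `T` and has no
corner inside. -/
lemma cornerGraph_adj_of_line {T : Set E} {y v : E} (hv : v ≠ 0) {α β : ℝ} (hαβ : α < β)
    (ha : y + α • v ∈ corners T) (hb : y + β • v ∈ corners T)
    (hT : ∀ t ∈ Icc α β, y + t • v ∈ T) (hc : ∀ t ∈ Ioo α β, y + t • v ∉ corners T) :
    (cornerGraph T).Adj ⟨_, ha⟩ ⟨_, hb⟩ := by
  have hpt : ∀ θ : ℝ, y + α • v + θ • (y + β • v - (y + α • v)) = y + (α + θ * (β - α)) • v := by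
    intro θ
    module
  refine ⟨fun h => ?_, ?_, ?_⟩
  · have h1 := Subtype.ext_iff.1 h
    exact hαβ.ne (smul_left_injective ℝ hv (add_left_cancel h1))
  · rw [segment_eq_image']
    rintro _ ⟨θ, hθ, rfl⟩
    dsimp only
    rw [hpt]
    exact hT _ ⟨by nlinarith [hθ.1], by nlinarith [hθ.2]⟩
  · rw [openSegment_eq_image']
    rintro _ ⟨θ, hθ, rfl⟩
    dsimp only
    rw [hpt]
    exact hc _ ⟨by nlinarith [hθ.1], by nlinarith [hθ.2]⟩

/-- From a corner any leg leads to a next corner. From a straight point the first corners in the two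
directions are the ends of its edge. -/
lemma exists_edge_of_mem [FiniteDimensional ℝ E] {T : Set E} (hT : IsFiniteTrivalentGraph T)
    {y : E} (hy : y ∈ T) : ∃ a b, (cornerGraph T).Adj a b ∧ y ∈ segment ℝ (a : E) b := by
  by_cases hyc : y ∈ corners T
  · obtain ⟨d, hd, u, hu0, humem, -⟩ := exists_rays hT.2 hy
    have hdpos : Nonempty (Fin d) := ⟨⟨0, by omega⟩⟩
    obtain ⟨i⟩ := hdpos
    obtain ⟨s, hs, hsc, hsT, hso⟩ := exists_first_corner hT (hu0 i) one_pos (humem i)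
    have hyc' : y + (0 : ℝ) • u i ∈ corners T := by simpa using hyc
    refine ⟨_, _, cornerGraph_adj_of_line (hu0 i) hs hyc' hsc hsT hso, ?_⟩
    have := left_mem_segment ℝ (y + (0 : ℝ) • u i) (y + s • u i)
    simpa using this
  · have hst : IsStraight T y := by
      by_contra hcon
      exact hyc ⟨hy, hcon⟩
    obtain ⟨u, hu0, huT, -⟩ := hst
    obtain ⟨s, hs, hsc, hsT, hso⟩ := exists_first_corner hT hu0 one_pos
      fun t ht => huT t ⟨by linarith [ht.1], ht.2⟩
    obtain ⟨r, hr, hrc, hrT, hro⟩ := exists_first_corner hT (neg_ne_zero.2 hu0) one_pos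
      fun t ht => by
        rw [smul_neg, ← neg_smul]
        exact huT (-t) ⟨by linarith [ht.2], by linarith [ht.1]⟩
    simp only [smul_neg, ← neg_smul] at hrc hrT hro
    refine ⟨_, _, cornerGraph_adj_of_line hu0 (by linarith : -r < s) hrc hsc ?_ ?_, ?_⟩
    · intro t ht
      rcases le_total 0 t with h | h
      · exact hsT t ⟨h, ht.2⟩
      · simpa using hrT (-t) ⟨by linarith, by linarith [ht.1]⟩
    · intro t ht
      rcases lt_trichotomy 0 t with h | rfl | h
      · exact hso t ⟨h, ht.2⟩
      · simpa using hyc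
      · simpa using hro (-t) ⟨by linarith, by linarith [ht.1]⟩
    · dsimp only
      rw [segment_eq_image']
      refine ⟨r / (s + r), ⟨by positivity, (div_le_one (by positivity)).2 (by linarith)⟩, ?_⟩
      dsimp only
      have : y + (-r) • u + (r / (s + r)) • (y + s • u - (y + (-r) • u))
          = y + (-r + r / (s + r) * (s + r)) • u := by module
      rw [this, div_mul_cancel₀ _ (by positivity)]
      simp

/-- On one line, two intervals around the parameter zero with corner ends and no corner inside
coincide: an end of one cannot be interior to the other. -/
lemma cornerGraph_edge_unique_aux {T : Set E} {y v : E} {a b c d : corners T} {α β γ δ : ℝ}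
    (hab : (cornerGraph T).Adj a b) (hcd : (cornerGraph T).Adj c d)
    (ha : (a : E) = y + α • v) (hb : (b : E) = y + β • v) (hc : (c : E) = y + γ • v)
    (hd : (d : E) = y + δ • v) (hα : α < 0) (hβ : 0 < β) (hγ : γ < 0) (hδ : 0 < δ) :
    a = c ∧ b = d := by
  have key : ∀ {p q r : corners T} {x x' x'' : ℝ}, (cornerGraph T).Adj p q →
      (p : E) = y + x • v → (q : E) = y + x' • v → (r : E) = y + x'' • v →
      x < x'' → x'' < x' → False := by
    intro p q r x x' x'' hpq hp hq hr h1 h2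
    refine hpq.2.2 r ?_ r.2
    rw [openSegment_eq_image', hp, hq, hr]
    refine ⟨(x'' - x) / (x' - x), ⟨div_pos (by linarith) (by linarith),
      (div_lt_one (by linarith)).2 (by linarith)⟩, ?_⟩
    dsimp only
    have h3 : y + x • v + ((x'' - x) / (x' - x)) • (y + x' • v - (y + x • v))
          = y + (x + (x'' - x) / (x' - x) * (x' - x)) • v := by module
    rw [h3, div_mul_cancel₀ _ (by linarith)]
    congr 2
    ring
  constructor
  · refine Subtype.ext ?_
    rw [ha, hc]
    congr 2
    refine le_antisymm ?_ ?_
    · by_contra hcon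
      exact key hcd hc hd ha (not_le.1 hcon) (hα.trans hδ)
    · by_contra hcon
      exact key hab ha hb hc (not_le.1 hcon) (hγ.trans hβ)
  · refine Subtype.ext ?_
    rw [hb, hd]
    congr 2
    refine le_antisymm ?_ ?_
    · by_contra hcon
      exact key hab ha hb hd (hα.trans hδ) (not_le.1 hcon)
    · by_contra hcon
      exact key hcd hc hd hb (hγ.trans hβ) (not_le.1 hcon)

lemma cornerGraph_mem_corners {T : Set E} {c d : corners T} (hcd : (cornerGraph T).Adj c d) {y : E}
    (hy : y ∈ segment ℝ (c : E) d) (hyc : y ∈ corners T) : y = c ∨ y = d := by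
  rw [← insert_endpoints_openSegment] at hy
  rcases hy with h | h | h
  · exact Or.inl h
  · exact Or.inr h
  · exact absurd hyc (hcd.2.2 y h)

/-- `T` is straight at an interior point of an edge, so both edges lie on the line of `T` there and
can be compared as intervals; orientations account for the two alternatives. -/
lemma cornerGraph_edge_unique {T : Set E} {a b c d : corners T}
    (hab : (cornerGraph T).Adj a b) (hcd : (cornerGraph T).Adj c d) {y : E}
    (hy : y ∈ openSegment ℝ (a : E) b) (hy' : y ∈ segment ℝ (c : E) d) :
    (a = c ∧ b = d) ∨ (a = d ∧ b = c) := by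
  have hyc : y ∉ corners T := hab.2.2 y hy
  have hyT : y ∈ T := hab.2.1 (openSegment_subset_segment ℝ _ _ hy)
  have hy'' : y ∈ openSegment ℝ (c : E) d := by
    refine mem_openSegment_of_ne_left_right ?_ ?_ hy'
    · rintro rfl; exact hyc c.2
    · rintro rfl; exact hyc d.2
  have hst : IsStraight T y := by
    by_contra hcon
    exact hyc ⟨hyT, hcon⟩
  obtain ⟨v, hv0, -, hv⟩ := hst
  have key : ∀ {p q : corners T}, (cornerGraph T).Adj p q → y ∈ openSegment ℝ (p : E) q →
      ∃ x x' : ℝ, (p : E) = y + x • v ∧ (q : E) = y + x' • v ∧ (x < 0 ∧ 0 < x' ∨ x' < 0 ∧ 0 < x) := by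
    intro p q hpq hyo
    have hyo' := hyo
    rw [openSegment_eq_image'] at hyo'
    obtain ⟨θ, hθ, he⟩ := hyo'
    dsimp only at he
    have hmem : ∀ t ∈ Icc (0 : ℝ) 1, y + t • ((q : E) - y) ∈ T := fun t ht =>
      hpq.2.1 ((convex_segment _ _).add_smul_sub_mem (openSegment_subset_segment ℝ _ _ hyo)
        (right_mem_segment ℝ _ _) ht)
    obtain ⟨x', hx'⟩ := eq_smul_of_straight hv hmem
    have hq : (q : E) - y = (1 - θ) • ((q : E) - p) := by
      rw [← he]; module
    have hp : (p : E) - y = (-θ) • ((q : E) - p) := by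
      rw [← he]; module
    have hp' : (p : E) - y = (-(θ / (1 - θ)) * x') • v := by
      rw [mul_smul, ← hx', hq, smul_smul, hp]
      congr 1
      have : 1 - θ ≠ 0 := by linarith [hθ.2]
      field_simp
    have hx'0 : x' ≠ 0 := by
      rintro rfl
      rw [zero_smul] at hx'
      rw [hx'] at hq
      have h1 : (q : E) - p = 0 := by
        rcases smul_eq_zero.1 hq.symm with h | h
        · linarith [hθ.2]
        · exact h
      exact hpq.1 (Subtype.ext (sub_eq_zero.1 h1).symm)
    have hr : 0 < θ / (1 - θ) := div_pos hθ.1 (by linarith [hθ.2])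
    refine ⟨-(θ / (1 - θ)) * x', x', by rw [← hp']; abel, by rw [← hx']; abel, ?_⟩
    rcases lt_or_gt_of_ne hx'0 with h | h
    · right
      exact ⟨h, by nlinarith⟩
    · left
      exact ⟨by nlinarith, h⟩
  obtain ⟨α, β, ha, hb, hs⟩ := key hab hy
  obtain ⟨γ, δ, hc, hd, hs'⟩ := key hcd hy''
  rcases hs with ⟨h1, h2⟩ | ⟨h1, h2⟩ <;> rcases hs' with ⟨h3, h4⟩ | ⟨h3, h4⟩
  · exact Or.inl (cornerGraph_edge_unique_aux hab hcd ha hb hc hd h1 h2 h3 h4)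
  · exact Or.inr (cornerGraph_edge_unique_aux hab hcd.symm ha hb hd hc h1 h2 h3 h4)
  · exact Or.inr (cornerGraph_edge_unique_aux hab.symm hcd hb ha hc hd h1 h2 h3 h4).symm
  · exact Or.inl (cornerGraph_edge_unique_aux hab.symm hcd.symm hb ha hd hc h1 h2 h3 h4).symm

/-- The corner graph of a trivalent graph has degrees two and three. -/
lemma exists_neighbours [FiniteDimensional ℝ E] {T : Set E} (hT : IsFiniteTrivalentGraph T)
    (v : corners T) : ∃ d : ℕ, (d = 2 ∨ d = 3) ∧ ∃ nb : Fin d → corners T,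
      Function.Injective nb ∧ ∀ w, (cornerGraph T).Adj v w ↔ ∃ i, nb i = w := by
  obtain ⟨d, hd, u, hu0, humem, hunhd, huinj⟩ := exists_rays hT.2 v.2.1
  have h1 := fun i => exists_first_corner hT (hu0 i) one_pos (humem i)
  choose s hs hsc hsT hso using h1
  -- The neighbours are the first corners along the legs. Distinct legs have distinct directions, so
  -- straight edges cannot be multiple.
  refine ⟨d, hd, fun i => ⟨_, hsc i⟩, ?_, fun w => ⟨fun hw => ?_, ?_⟩⟩
  · intro i j hij
    exact huinj i j _ _ (hs i) (hs j) (add_left_cancel (Subtype.ext_iff.1 hij))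
  · have ht : Filter.Tendsto (fun t : ℝ => (v : E) + t • ((w : E) - v)) (𝓝[>] 0) (𝓝[T] v) := by
      refine tendsto_nhdsWithin_iff.2 ⟨?_, ?_⟩
      · have : Continuous fun t : ℝ => (v : E) + t • ((w : E) - v) := by fun_prop
        have h3 := this.tendsto 0
        simp only [zero_smul, add_zero] at h3
        exact h3.mono_left nhdsWithin_le_nhds
      · filter_upwards [(Ioc_mem_nhdsGT one_pos : Ioc (0 : ℝ) 1 ∈ 𝓝[>] 0)] with t ht
        exact hw.2.1 ((convex_segment _ _).add_smul_sub_mem (left_mem_segment ℝ _ _)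
          (right_mem_segment ℝ _ _) ⟨ht.1.le, ht.2⟩)
    obtain ⟨t, ⟨i, t', ht', he⟩, ht0⟩ := ((ht.eventually hunhd).and
      (self_mem_nhdsWithin : Ioi (0 : ℝ) ∈ 𝓝[>] 0)).exists
    have h2 : t • ((w : E) - v) = t' • u i := add_left_cancel he
    have h3 : (w : E) - v = (t' / t) • u i := by
      rw [div_eq_inv_mul, mul_smul, ← h2, smul_smul, inv_mul_cancel₀ ht0.ne', one_smul]
    have hr : 0 < t' / t := by
      refine lt_of_le_of_ne (div_nonneg ht'.1 ht0.le) fun h0 => ?_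
      rw [← h0, zero_smul] at h3
      exact hw.1 (Subtype.ext (sub_eq_zero.1 h3).symm)
    have hwe : (w : E) = v + (t' / t) • u i := by rw [← h3]; abel
    refine ⟨i, Subtype.ext ?_⟩
    rw [hwe]
    dsimp only
    congr 2
    -- An edge longer than `s i` would have a corner inside; a shorter one would end before the
    -- first corner.
    rcases lt_trichotomy (s i) (t' / t) with h | h | h
    · exfalso
      refine hw.2.2 _ ?_ (hsc i)
      rw [openSegment_eq_image']
      refine ⟨s i / (t' / t), ⟨div_pos (hs i) hr, (div_lt_one hr).2 h⟩, ?_⟩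
      dsimp only
      rw [h3, smul_smul, div_mul_cancel₀ _ hr.ne']
    · exact h
    · exact absurd (hwe ▸ w.2) (hso i _ ⟨hr, h⟩)
  · rintro ⟨i, rfl⟩
    have hv : (v : E) + (0 : ℝ) • u i ∈ corners T := by
      rw [zero_smul, add_zero]; exact v.2
    have := cornerGraph_adj_of_line (hu0 i) (hs i) hv (hsc i) (hsT i) (hso i)
    convert this using 1
    exact Subtype.ext (by simp)

end GraphStructure

end PLTop

namespace PLTop

/-! ### The collared double of a surface with a height function, and its charts. -/

section CollaredDouble

/-! ### Charts of surfaces -/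

/-- Among `k + 2` coordinates, at most `k` are nonzero exactly when at least two vanish; this form
is suited to case analysis on indices. -/
lemma isLeg_iff {k : ℕ} {y : Fin (k + 2) → ℝ} :
    IsLeg k y ↔ (∀ i, 0 ≤ y i) ∧ ∃ i j, i ≠ j ∧ y i = 0 ∧ y j = 0 := by
  have h1 := Set.ncard_add_ncard_compl {i | y i ≠ 0}
  have h2 : {i | y i ≠ 0}ᶜ = {i | y i = 0} := by ext; simp
  rw [h2, Nat.card_eq_fintype_card, Fintype.card_fin] at h1
  have h3 : 1 < {i | y i = 0}.ncard ↔ ∃ i j, i ≠ j ∧ y i = 0 ∧ y j = 0 := by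
    rw [Set.one_lt_ncard_iff]
    simp only [Set.mem_ofPred_eq]
    constructor
    · rintro ⟨a, b, h, h', h''⟩
      exact ⟨a, b, h'', h, h'⟩
    · rintro ⟨a, b, h, h', h''⟩
      exact ⟨a, b, h', h'', h⟩
  rw [IsLeg, ← h3]
  refine and_congr_right fun _ => ?_
  omega

variable {E : Type*} [NormedAddCommGroup E] [NormedSpace ℝ E]

lemma isPointOfType_zero_of_chart {P : Set E} (σ : ℝ × ℝ → E) (l : E → ℝ × ℝ) (hσ : IsPL σ)
    {ε : ℝ} (hε : 0 < ε)
    (h1 : ∀ s t, |s| ≤ ε → |t| ≤ ε → σ (s, t) ∈ P ∧ l (σ (s, t)) = (s, t))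
    (hc : ContinuousAt l (σ 0)) (h2 : ∀ᶠ p in 𝓝[P] (σ 0), σ (l p) = p) :
    IsPointOfType 2 0 P (σ 0) :=
  isPointOfType_of_legChart (n := 2) (k := 0) (E := E)
    (fun q : (Fin 2 → ℝ) × (Fin 2 → ℝ) => σ (q.2 0, q.2 1))
    (fun p => ((0 : Fin 2 → ℝ), ![(l p).1, (l p).2]))
    (hσ.comp (((IsPL.apply (0 : Fin 2)).comp IsPL.snd).prodMk
      ((IsPL.apply (1 : Fin 2)).comp IsPL.snd))) hε
    (fun y t hy _ ht => by
      have h := h1 (t 0) (t 1) (ht 0) (ht 1)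
      have hy0 : y = 0 := by
        obtain ⟨-, i, j, hij, hi, hj⟩ := isLeg_iff.1 hy
        ext m
        fin_cases i <;> fin_cases j <;> fin_cases m <;> simp_all
      refine ⟨h.1, ?_⟩
      simp only [h.2, hy0]
      ext m
      · rfl
      · fin_cases m <;> rfl)
    (by
      refine continuousAt_const.prodMk (continuousAt_pi.2 fun m => ?_)
      fin_cases m
      · exact hc.fst
      · exact hc.snd)
    (by
      filter_upwards [h2] with p hp
      exact ⟨by simp [IsLeg], hp⟩)

lemma isPointOfType_one_of_chart {P : Set E} (σ : (Fin 3 → ℝ) × ℝ → E) (l : E → (Fin 3 → ℝ) × ℝ)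
    (hσ : IsPL σ) {ε : ℝ} (hε : 0 < ε)
    (h1 : ∀ y t, IsLeg 1 y → (∀ i, y i ≤ ε) → |t| ≤ ε → σ (y, t) ∈ P ∧ l (σ (y, t)) = (y, t))
    (hc : ContinuousAt l (σ 0)) (h2 : ∀ᶠ p in 𝓝[P] (σ 0), IsLeg 1 (l p).1 ∧ σ (l p) = p) :
    IsPointOfType 2 1 P (σ 0) :=
  isPointOfType_of_legChart (n := 2) (k := 1) (E := E)
    (fun q : (Fin 3 → ℝ) × (Fin 1 → ℝ) => σ (q.1, q.2 0))
    (fun p => ((l p).1, fun _ : Fin 1 => (l p).2))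
    (hσ.comp (IsPL.fst.prodMk ((IsPL.apply (0 : Fin 1)).comp IsPL.snd))) hε
    (fun y t hy hyε ht => by
      have h := h1 y (t 0) hy hyε (ht 0)
      refine ⟨h.1, ?_⟩
      simp only [h.2]
      ext m
      · rfl
      · fin_cases m; rfl)
    (hc.fst.prodMk (continuousAt_pi.2 fun _ => hc.snd)) h2

lemma isPointOfType_two_of_chart {P : Set E} (σ : (Fin 4 → ℝ) → E) (l : E → (Fin 4 → ℝ))
    (hσ : IsPL σ) {ε : ℝ} (hε : 0 < ε)
    (h1 : ∀ y, IsLeg 2 y → (∀ i, y i ≤ ε) → σ y ∈ P ∧ l (σ y) = y)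
    (hc : ContinuousAt l (σ 0)) (h2 : ∀ᶠ p in 𝓝[P] (σ 0), IsLeg 2 (l p) ∧ σ (l p) = p) :
    IsPointOfType 2 2 P (σ 0) :=
  isPointOfType_of_legChart (n := 2) (k := 2) (E := E)
    (fun q : (Fin 4 → ℝ) × (Fin 0 → ℝ) => σ q.1)
    (fun p => (l p, (0 : Fin 0 → ℝ)))
    (hσ.comp IsPL.fst) hε
    (fun y t hy hyε _ => by
      have h := h1 y hy hyε
      refine ⟨h.1, ?_⟩
      simp only [h.2]
      ext m
      · rfl
      · exact Fin.elim0 m)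
    (hc.prodMk continuousAt_const) h2

/-! ### The collared double of a surface of heights -/

/-- A piecewise linear function which is positive exactly on `(-2, 0)`. -/
noncomputable def bump (z : ℝ) : ℝ := max 0 (min (-z) (z + 2)) / 2

/-- Two copies of `{p ∈ R | ht p ≤ 1 / 2}`, joined along `{p ∈ R | ht p = 1 / 2}`, with a collar
attached to one copy of `{p ∈ R | ht p = 0}`. -/
def collaredDouble (R : Set E) (ht : E → ℝ) : Set (E × ℝ) :=
  {p | p.1 ∈ R ∧ p.2 ∈ Icc (-2) 1 ∧ ht p.1 = bump p.2}

lemma bump_nonneg (z : ℝ) : 0 ≤ bump z := div_nonneg (le_max_left _ _) zero_le_two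

lemma bump_le {z : ℝ} : bump z ≤ 1 / 2 := by
  rw [bump]
  have : min (-z) (z + 2) ≤ 1 := by
    rcases le_total (-1) z with h | h
    · exact (min_le_left _ _).trans (by linarith)
    · exact (min_le_right _ _).trans (by linarith)
  linarith [max_le zero_le_one this]

lemma bump_of_nonneg {z : ℝ} (hz : 0 ≤ z) : bump z = 0 := by
  rw [bump, max_eq_left ((min_le_left _ _).trans (by linarith)), zero_div]

lemma bump_upper {z : ℝ} (hz : z ≤ 0) (hz' : -1 ≤ z) : bump z = -z / 2 := by
  rw [bump, min_eq_left (by linarith), max_eq_right (by linarith)]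

lemma bump_lower {z : ℝ} (hz : -2 ≤ z) (hz' : z ≤ -1) : bump z = (z + 2) / 2 := by
  rw [bump, min_eq_right (by linarith), max_eq_right (by linarith)]

lemma bump_pos {z : ℝ} (hz : -2 < z) (hz' : z < 0) : 0 < bump z := by
  have : 0 < min (-z) (z + 2) := lt_min (by linarith) (by linarith)
  rw [bump, max_eq_right this.le]
  exact half_pos this

lemma IsPL.bump [FiniteDimensional ℝ E] {f : E → ℝ} (hf : IsPL f) :
    IsPL (fun x => bump (f x)) :=
  ((IsPL.const 0).max (hf.neg.min (hf.add (IsPL.const 2)))).div_const 2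

variable {R : Set E} {ht : E → ℝ}

/-- The collared double is a disc where the surface of heights is a strip. -/
lemma isPointOfType_collaredDouble_of_strip {G : ℝ × ℝ → E} {l : E → ℝ}
    (hG : IsPL G) (hl : Continuous l) {ε s₀ z₀ : ℝ} (hε : 0 < ε) (hz : -2 < z₀) (hz' : z₀ < 0)
    (h1 : ∀ s h, |s - s₀| ≤ ε → h ∈ Icc (0 : ℝ) (1 / 2) →
      G (s, h) ∈ R ∧ ht (G (s, h)) = h ∧ l (G (s, h)) = s)
    (h2 : ∀ᶠ X in 𝓝 (G (s₀, bump z₀)), X ∈ R → G (l X, ht X) = X) :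
    IsPointOfType 2 0 (collaredDouble R ht) (G (s₀, bump z₀), z₀) := by
  -- Over a strip the height is forced to be `bump z`, so `(s, z)` are coordinates.
  have key := isPointOfType_zero_of_chart (P := collaredDouble R ht)
    (fun q => (G (s₀ + q.1, bump (z₀ + q.2)), z₀ + q.2)) (fun p => (l p.1 - s₀, p.2 - z₀))
    ((hG.comp (((IsPL.const s₀).add IsPL.fst).prodMk ((IsPL.const z₀).add IsPL.snd).bump)).prodMk
      ((IsPL.const z₀).add IsPL.snd))
    (ε := min ε (min (-z₀) (z₀ + 2))) (by simp only [lt_min_iff]; constructorm* _ ∧ _ <;> linarith)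
    (fun s t hs ht' => by
      simp only [le_min_iff] at hs ht'
      have ht1 := abs_le.1 ht'.2.1
      have ht2 := abs_le.1 ht'.2.2
      obtain ⟨h3, h4, h5⟩ := h1 (s₀ + s) (bump (z₀ + t)) (by simpa using hs.1)
        ⟨bump_nonneg _, bump_le⟩
      refine ⟨⟨h3, ⟨?_, ?_⟩, h4⟩, ?_⟩
      · dsimp only; linarith
      · dsimp only; linarith
      · simp [h5])
    (by fun_prop)
    (by
      simp only [Prod.fst_zero, Prod.snd_zero, add_zero]
      have h3 : ∀ᶠ p : E × ℝ in 𝓝 (G (s₀, bump z₀), z₀), p.1 ∈ R → G (l p.1, ht p.1) = p.1 :=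
        (continuousAt_fst : ContinuousAt Prod.fst (G (s₀, bump z₀), z₀)).eventually h2
      filter_upwards [nhdsWithin_le_nhds h3, self_mem_nhdsWithin] with p hp hpR
      have h4 := hp hpR.1
      rw [hpR.2.2] at h4
      ext1 <;> simp [h4])
  simpa using key

/-- The two points of the collared double over a point at which the surface of heights is a
two-sided neighbourhood of an arc of height zero. -/
lemma isPointOfType_collaredDouble_of_twoSided {κ : ℝ × ℝ → E}
    {l : E → ℝ × ℝ}
    (hκ : IsPL κ) (hl : Continuous l) {ε : ℝ} (hε : 0 < ε)
    (h1 : ∀ s r, |s| ≤ ε → |r| ≤ ε →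
      κ (s, r) ∈ R ∧ ht (κ (s, r)) = |r| ∧ l (κ (s, r)) = (s, r))
    (h2 : ∀ᶠ X in 𝓝 (κ 0), X ∈ R → κ (l X) = X) :
    IsPointOfType 2 1 (collaredDouble R ht) (κ 0, 0) ∧
      IsPointOfType 2 0 (collaredDouble R ht) (κ 0, -2) := by
  have hl0 : l (κ 0) = 0 := (h1 0 0 (by simpa using hε.le) (by simpa using hε.le)).2.2
  have h3 : ∀ᶠ X in 𝓝 (κ 0), X ∈ R → κ (l X) = X ∧ ht X = |(l X).2| := by
    have h4 : ∀ᶠ X in 𝓝 (κ 0), ‖l X‖ < ε := by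
      refine hl.norm.continuousAt.eventually_lt continuousAt_const ?_
      rw [hl0]
      simpa using hε
    filter_upwards [h2, h4] with X hX hX' hR
    have h5 := h1 (l X).1 (l X).2 ((norm_fst_le _).trans hX'.le) ((norm_snd_le _).trans hX'.le)
    rw [Prod.mk.eta, hX hR] at h5
    exact ⟨hX hR, h5.2.1⟩
  constructor
  -- Legs `0` and `1` are the two sides of the arc and leg `2` is the collar. On the sides `|r| =
  -- bump z = -z / 2`, so `z = -2 * |r|`; on the collar `r = 0` and `z = y 2`. The bound `1 / 4`
  -- keeps `z` above `-1`.
  · have key := isPointOfType_one_of_chart (P := collaredDouble R ht)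
      (fun q => (κ (q.2, q.1 0 - q.1 1), q.1 2 - 2 * (q.1 0 + q.1 1)))
      (fun p => (![max (l p.1).2 0, max (-(l p.1).2) 0, max p.2 0], (l p.1).1))
      ((hκ.comp (IsPL.snd.prodMk (((IsPL.apply 0).comp IsPL.fst).sub
        ((IsPL.apply 1).comp IsPL.fst)))).prodMk (((IsPL.apply 2).comp IsPL.fst).sub
        ((((IsPL.apply 0).comp IsPL.fst).add ((IsPL.apply 1).comp IsPL.fst)).const_mul 2)))
      (ε := min ε (1 / 4)) (by simp [hε])
      (fun y t hy hyε ht' => by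
        simp only [le_min_iff] at hyε ht'
        have hy0 := hy.1
        have e0 := hyε 0
        have e1 := hyε 1
        have e2 := hyε 2
        have p0 := hy0 0
        have p1 := hy0 1
        have p2 := hy0 2
        have hlegs : y 1 = 0 ∧ y 2 = 0 ∨ y 0 = 0 ∧ y 2 = 0 ∨ y 0 = 0 ∧ y 1 = 0 := by
          obtain ⟨-, i, j, hij, hi, hj⟩ := isLeg_iff.1 hy
          fin_cases i <;> fin_cases j <;> simp_all
        obtain ⟨h5, h6, h7⟩ := h1 t (y 0 - y 1) ht'.1 (by rw [abs_le]; constructor <;> linarith)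
        have hb : |y 0 - y 1| = bump (y 2 - 2 * (y 0 + y 1)) := by
          rcases hlegs with ⟨a, b⟩ | ⟨a, b⟩ | ⟨a, b⟩
          · rw [a, b, bump_upper (by linarith) (by linarith), sub_zero, abs_of_nonneg p0]
            ring
          · rw [a, b, bump_upper (by linarith) (by linarith), zero_sub, abs_neg, abs_of_nonneg p1]
            ring
          · rw [a, b, bump_of_nonneg (by linarith)]
            simp
        refine ⟨⟨h5, ⟨?_, ?_⟩, h6.trans hb⟩, ?_⟩
        · dsimp only; linarith
        · dsimp only; linarith
        · simp only [h7, Prod.mk.injEq, and_true]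
          ext m
          rcases hlegs with ⟨a, b⟩ | ⟨a, b⟩ | ⟨a, b⟩ <;> fin_cases m <;>
            simp [a, b, p0, p1, p2])
      (by
        refine ContinuousAt.prodMk (continuousAt_pi.2 fun m => ?_) (by fun_prop)
        fin_cases m
        · change ContinuousAt (fun p : E × ℝ => max (l p.1).2 0) _
          fun_prop
        · change ContinuousAt (fun p : E × ℝ => max (-(l p.1).2) 0) _
          fun_prop
        · change ContinuousAt (fun p : E × ℝ => max p.2 0) _
          fun_prop)
      (by
        simp only [Prod.fst_zero, Prod.snd_zero, Pi.zero_apply, sub_zero, add_zero, mul_zero]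
        have h4 : ∀ᶠ p : E × ℝ in 𝓝 (κ (0, 0), 0), p.1 ∈ R →
            κ (l p.1) = p.1 ∧ ht p.1 = |(l p.1).2| :=
          (continuousAt_fst : ContinuousAt Prod.fst (κ 0, (0 : ℝ))).eventually h3
        have h5 : ∀ᶠ p : E × ℝ in 𝓝 (κ (0, 0), 0), -1 < p.2 :=
          continuousAt_const.eventually_lt continuousAt_snd (by simp)
        filter_upwards [nhdsWithin_le_nhds h4, nhdsWithin_le_nhds h5, self_mem_nhdsWithin]
          with p hp hp1 hpR
        obtain ⟨h6, h7⟩ := hp hpR.1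
        rw [hpR.2.2] at h7
        have h8 : max (l p.1).2 0 - max (-(l p.1).2) 0 = (l p.1).2 := max_zero_sub_max_neg_zero_eq_self _
        have h9 : max (l p.1).2 0 + max (-(l p.1).2) 0 = |(l p.1).2| :=
          max_zero_add_max_neg_zero_eq_abs_self _
        refine ⟨isLeg_iff.2 ⟨fun i => by fin_cases i <;> simp, ?_⟩, ?_⟩
        · rcases le_total 0 p.2 with hz | hz
          · rw [bump_of_nonneg hz] at h7
            have : (l p.1).2 = 0 := abs_eq_zero.1 h7.symm
            exact ⟨0, 1, by simp, by simp [this], by simp [this]⟩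
          · rcases le_total 0 (l p.1).2 with hr | hr
            · exact ⟨1, 2, by simp, by simp [hr], by simp [hz]⟩
            · exact ⟨0, 2, by simp, by simp [hr], by simp [hz]⟩
        · ext1
          · simp [h8, h6]
          · simp only [Matrix.cons_val, h9]
            rcases le_total 0 p.2 with hz | hz
            · rw [← h7, bump_of_nonneg hz, max_eq_left hz]; ring
            · rw [← h7, bump_upper hz hp1.le, max_eq_right hz]; ring)
    have e : ((0 : ℝ), (0 : ℝ)) = 0 := rfl
    simpa [e] using key
  -- Near `z = -2` only the lower branch of `bump` occurs, so `z = -2 + 2 * |r|` is a function on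
  -- the two-sided neighbourhood.
  · have key := isPointOfType_zero_of_chart (P := collaredDouble R ht)
      (fun q => (κ q, -2 + 2 * |q.2|)) (fun p => l p.1)
      (hκ.prodMk ((IsPL.const (-2)).add (IsPL.snd.abs.const_mul 2)))
      (ε := min ε (1 / 4)) (by simp [hε])
      (fun s r hs hr => by
        simp only [le_min_iff] at hs hr
        obtain ⟨h5, h6, h7⟩ := h1 s r hs.1 hr.1
        have := abs_nonneg r
        refine ⟨⟨h5, ⟨?_, ?_⟩, ?_⟩, h7⟩
        · dsimp only; linarith
        · dsimp only; linarith
        · rw [h6, bump_lower (by linarith) (by linarith)]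
          dsimp only
          ring)
      (by fun_prop)
      (by
        simp only [Prod.snd_zero, abs_zero, mul_zero, add_zero]
        have h4 : ∀ᶠ p : E × ℝ in 𝓝 (κ 0, -2), p.1 ∈ R →
            κ (l p.1) = p.1 ∧ ht p.1 = |(l p.1).2| :=
          (continuousAt_fst : ContinuousAt Prod.fst (κ 0, (-2 : ℝ))).eventually h3
        have h5 : ∀ᶠ p : E × ℝ in 𝓝 (κ 0, -2), p.2 < -1 :=
          continuousAt_snd.eventually_lt continuousAt_const (by norm_num)
        filter_upwards [nhdsWithin_le_nhds h4, nhdsWithin_le_nhds h5, self_mem_nhdsWithin]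
          with p hp hp1 hpR
        obtain ⟨h6, h7⟩ := hp hpR.1
        rw [hpR.2.2, bump_lower hpR.2.1.1 hp1.le] at h7
        ext1
        · exact h6
        · simp only [← h7]; ring)
    simpa using key

/-- The height on a union of three quadrants with coordinates `(y i, y (i + 1))`. -/
noncomputable def sectorHeight (y : Fin 3 → ℝ) : ℝ :=
  min (y 0) (y 1) + min (y 1) (y 2) + min (y 2) (y 0)

lemma sectorHeight_nonneg {y : Fin 3 → ℝ} (hy : ∀ i, 0 ≤ y i) : 0 ≤ sectorHeight y :=
  add_nonneg (add_nonneg (le_min (hy 0) (hy 1)) (le_min (hy 1) (hy 2))) (le_min (hy 2) (hy 0))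

lemma sectorHeight_le {y : Fin 3 → ℝ} {δ : ℝ} (hy : ∀ i, y i ≤ δ) : sectorHeight y ≤ 3 * δ := by
  have a := (min_le_left (y 0) (y 1)).trans (hy 0)
  have b := (min_le_left (y 1) (y 2)).trans (hy 1)
  have c := (min_le_left (y 2) (y 0)).trans (hy 2)
  rw [sectorHeight]
  linarith

@[simp] lemma sectorHeight_zero : sectorHeight 0 = 0 := by simp [sectorHeight]

lemma sectorHeight_eq_zero {y : Fin 3 → ℝ} (hy : ∀ i, 0 ≤ y i) :
    sectorHeight y = 0 ↔ (y 0 = 0 ∧ y 1 = 0) ∨ (y 1 = 0 ∧ y 2 = 0) ∨ (y 0 = 0 ∧ y 2 = 0) := by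
  have q0 := hy 0
  have q1 := hy 1
  have q2 := hy 2
  constructor
  · intro h
    have m0 := le_min q0 q1
    have m1 := le_min q1 q2
    have m2 := le_min q2 q0
    rw [sectorHeight] at h
    have c0 : min (y 0) (y 1) = 0 := by linarith
    have c1 : min (y 1) (y 2) = 0 := by linarith
    have c2 : min (y 2) (y 0) = 0 := by linarith
    have d0 := min_choice (y 0) (y 1)
    have d1 := min_choice (y 1) (y 2)
    have d2 := min_choice (y 2) (y 0)
    rw [c0] at d0
    rw [c1] at d1
    rw [c2] at d2
    simp only [eq_comm (a := (0 : ℝ))] at d0 d1 d2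
    tauto
  · rintro (⟨a, b⟩ | ⟨a, b⟩ | ⟨a, b⟩) <;> simp [sectorHeight, a, b, q0, q1, q2]

lemma IsPL.sectorHeight [FiniteDimensional ℝ E] {f : E → Fin 3 → ℝ} (hf : IsPL f) :
    IsPL (fun x => sectorHeight (f x)) := by
  have h : ∀ i, IsPL fun x => f x i := fun i => (IsPL.apply i).comp hf
  exact (((h 0).min (h 1)).add ((h 1).min (h 2))).add ((h 2).min (h 0))

lemma exists_pair_fin_four {p : Fin 4 → Prop} : (∃ i j, i ≠ j ∧ p i ∧ p j) ↔
    (p 3 ∧ (p 0 ∨ p 1 ∨ p 2)) ∨ (p 0 ∧ p 1) ∨ (p 1 ∧ p 2) ∨ (p 0 ∧ p 2) := by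
  constructor
  · rintro ⟨i, j, hij, hi, hj⟩
    fin_cases i <;> fin_cases j <;> simp_all
  · rintro (⟨h, h' | h' | h'⟩ | ⟨h, h'⟩ | ⟨h, h'⟩ | ⟨h, h'⟩)
    exacts [⟨3, 0, by decide, h, h'⟩, ⟨3, 1, by decide, h, h'⟩, ⟨3, 2, by decide, h, h'⟩,
      ⟨0, 1, by decide, h, h'⟩, ⟨1, 2, by decide, h, h'⟩, ⟨0, 2, by decide, h, h'⟩]

/-- The vertex singularity as a disc with three fins: for `c = 0` the pairs among the first three
legs are three sectors filling a disc, and for `c > 0` there is a fin over each axis, the axes being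
the locus of sector height zero. -/
lemma isLeg_two_iff {y : Fin 3 → ℝ} {c : ℝ} : IsLeg 2 ![y 0, y 1, y 2, c] ↔
    (∀ i, 0 ≤ y i) ∧ 0 ≤ c ∧ ((c = 0 ∧ ∃ i, y i = 0) ∨ sectorHeight y = 0) := by
  rw [isLeg_iff (k := 2), exists_pair_fin_four, ← and_assoc]
  have h : (∀ i : Fin (2 + 2), 0 ≤ (![y 0, y 1, y 2, c] : Fin 4 → ℝ) i) ↔
      (∀ i, 0 ≤ y i) ∧ 0 ≤ c := by
    simp [Fin.forall_fin_succ, and_assoc]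
  rw [h]
  refine and_congr_right fun hy => ?_
  rw [sectorHeight_eq_zero hy.1]
  simp [Fin.exists_fin_succ]

/-- The surface of heights consists of three sectors near `ψ 0`. -/
structure IsSectorChart (R : Set E) (ht : E → ℝ) (ψ : (Fin 3 → ℝ) → E) (l : E → Fin 3 → ℝ)
    (ε : ℝ) : Prop where
  isPL : IsPL ψ
  continuous : Continuous l
  pos : 0 < ε
  mem : ∀ y, (∀ i, 0 ≤ y i) → (∃ i, y i = 0) → (∀ i, y i ≤ ε) →
    ψ y ∈ R ∧ ht (ψ y) = sectorHeight y ∧ l (ψ y) = y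
  eventually : ∀ᶠ X in 𝓝 (ψ 0), X ∈ R → (∀ i, 0 ≤ l X i) ∧ (∃ i, l X i = 0) ∧ ψ (l X) = X

lemma IsSectorChart.eventually_height {ψ : (Fin 3 → ℝ) → E} {l : E → Fin 3 → ℝ} {ε : ℝ}
    (h : IsSectorChart R ht ψ l ε) (z : ℝ) : ∀ᶠ p : E × ℝ in 𝓝 (ψ 0, z), p.1 ∈ R →
      (∀ i, 0 ≤ l p.1 i) ∧ (∃ i, l p.1 i = 0) ∧ ψ (l p.1) = p.1 ∧
        ht p.1 = sectorHeight (l p.1) := by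
  have hl0 : l (ψ 0) = 0 := (h.mem 0 (by simp) ⟨0, rfl⟩ (by simpa using h.pos.le)).2.2
  have h4 : ∀ᶠ X in 𝓝 (ψ 0), ‖l X‖ < ε := by
    refine h.continuous.norm.continuousAt.eventually_lt continuousAt_const ?_
    rw [hl0]
    simpa using h.pos
  have h5 : ∀ᶠ X in 𝓝 (ψ 0), X ∈ R → (∀ i, 0 ≤ l X i) ∧ (∃ i, l X i = 0) ∧ ψ (l X) = X ∧
      ht X = sectorHeight (l X) := ?_
  · exact (continuousAt_fst : ContinuousAt Prod.fst (ψ 0, z)).eventually h5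
  filter_upwards [h.eventually, h4] with X hX hX' hR
  obtain ⟨h5, h6, h7⟩ := hX hR
  have h8 := h.mem (l X) h5 h6
    fun i => (le_abs_self _).trans ((norm_le_pi_norm (l X) i).trans hX'.le)
  rw [h7] at h8
  exact ⟨h5, h6, h7, h8.2.1⟩

lemma IsSectorChart.isPointOfType_two {ψ : (Fin 3 → ℝ) → E} {l : E → Fin 3 → ℝ} {ε : ℝ}
    (h : IsSectorChart R ht ψ l ε) : IsPointOfType 2 2 (collaredDouble R ht) (ψ 0, 0) := by
  set ι : (Fin 4 → ℝ) → (Fin 3 → ℝ) := fun y => ![y 0, y 1, y 2] with hι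
  have hιpl : IsPL ι := IsPL.pi fun i => by
    fin_cases i
    · exact IsPL.apply 0
    · exact IsPL.apply 1
    · exact IsPL.apply 2
  have hι0 : ι 0 = 0 := by ext i; fin_cases i <;> rfl
  -- On the sectors `y 3 = 0` and `z` is minus twice the height; on the fins the height is zero and
  -- `z = y 3`. The bound `1 / 8` gives height at most `3 / 8`, which keeps `z` above `-1`.
  have key := isPointOfType_two_of_chart (P := collaredDouble R ht)
    (fun y => (ψ (ι y), y 3 - 2 * sectorHeight (ι y)))
    (fun p => ![l p.1 0, l p.1 1, l p.1 2, max p.2 0])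
    ((h.isPL.comp hιpl).prodMk ((IsPL.apply 3).sub (hιpl.sectorHeight.const_mul 2)))
    (ε := min ε (1 / 8)) (by simp [h.pos])
    (fun y hy hyε => by
      have hyy : y = ![ι y 0, ι y 1, ι y 2, y 3] := by ext i; fin_cases i <;> rfl
      have hleg := hy
      rw [hyy] at hleg
      obtain ⟨hι', p3, hor⟩ := isLeg_two_iff.1 hleg
      have hιε : ∀ i, ι y i ≤ min ε (1 / 8) := fun i => by
        fin_cases i <;> exact hyε _
      have hz : ∃ i, ι y i = 0 := by
        rcases hor with h | h
        · exact h.2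
        · rcases (sectorHeight_eq_zero hι').1 h with h | h | h
          exacts [⟨_, h.1⟩, ⟨_, h.1⟩, ⟨_, h.1⟩]
      obtain ⟨h5, h6, h7⟩ := h.mem (ι y) hι' hz fun i => (hιε i).trans (min_le_left _ _)
      have hmm := sectorHeight_nonneg hι'
      have hmm' := sectorHeight_le fun i => (hιε i).trans (min_le_right _ _)
      have p3' := (hyε 3).trans (min_le_right _ _)
      refine ⟨⟨h5, ⟨?_, ?_⟩, h6.trans ?_⟩, ?_⟩
      · dsimp only; linarith
      · dsimp only; linarith
      · rcases hor with ⟨h, -⟩ | h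
        · rw [h, bump_upper (by linarith) (by linarith)]; ring
        · rw [h, bump_of_nonneg (by linarith)]
      · have h8 : max (y 3 - 2 * sectorHeight (ι y)) 0 = y 3 := by
          rcases hor with ⟨h, -⟩ | h
          · rw [h, max_eq_right (by linarith)]
          · rw [h, max_eq_left (by linarith)]; ring
        simp only [h7, h8]
        exact hyy.symm)
    (by
      have hl := h.continuous
      refine continuousAt_pi.2 fun i => ?_
      fin_cases i
      · change ContinuousAt (fun p : E × ℝ => l p.1 0) _
        fun_prop
      · change ContinuousAt (fun p : E × ℝ => l p.1 1) _
        fun_prop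
      · change ContinuousAt (fun p : E × ℝ => l p.1 2) _
        fun_prop
      · change ContinuousAt (fun p : E × ℝ => max p.2 0) _
        fun_prop)
    (by
      simp only [hι0, sectorHeight_zero, Pi.zero_apply, mul_zero, sub_zero]
      have h5 : ∀ᶠ p : E × ℝ in 𝓝 (ψ 0, 0), -1 < p.2 :=
        continuousAt_const.eventually_lt continuousAt_snd (by simp)
      filter_upwards [nhdsWithin_le_nhds (h.eventually_height 0), nhdsWithin_le_nhds h5,
        self_mem_nhdsWithin] with p hp hp1 hpR
      obtain ⟨h6, h7, h8, h9⟩ := hp hpR.1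
      rw [hpR.2.2] at h9
      have hιl : ι ![l p.1 0, l p.1 1, l p.1 2, max p.2 0] = l p.1 := by
        ext i
        fin_cases i <;> rfl
      refine ⟨isLeg_two_iff.2 ⟨h6, le_max_right _ _, ?_⟩, ?_⟩
      · rcases le_total 0 p.2 with hz | hz
        · rw [bump_of_nonneg hz] at h9
          exact Or.inr h9.symm
        · exact Or.inl ⟨max_eq_right hz, h7⟩
      · ext1
        · simp only [hιl, h8]
        · simp only [hιl, ← h9, Matrix.cons_val]
          rcases le_total 0 p.2 with hz | hz
          · rw [bump_of_nonneg hz, max_eq_left hz]; ring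
          · rw [bump_upper hz hp1.le, max_eq_right hz]; ring)
  simpa [hι0] using key

/-- The three sectors are flattened onto the plane by the differences `y 0 - y 2` and `y 1 - y 2`.
The inverse adds to `(s, t, 0)` the constant that makes the smallest coordinate zero. -/
lemma IsSectorChart.isPointOfType_zero {ψ : (Fin 3 → ℝ) → E} {l : E → Fin 3 → ℝ} {ε : ℝ}
    (h : IsSectorChart R ht ψ l ε) : IsPointOfType 2 0 (collaredDouble R ht) (ψ 0, -2) := by
  set ι : ℝ × ℝ → (Fin 3 → ℝ) := fun q =>
    ![q.1 - min 0 (min q.1 q.2), q.2 - min 0 (min q.1 q.2), -min 0 (min q.1 q.2)] with hι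
  have hmin : IsPL fun q : ℝ × ℝ => min 0 (min q.1 q.2) :=
    (IsPL.const 0).min (IsPL.fst.min IsPL.snd)
  have hιpl : IsPL ι := IsPL.pi fun i => by
    fin_cases i
    · exact IsPL.fst.sub hmin
    · exact IsPL.snd.sub hmin
    · exact hmin.neg
  have hι0 : ι 0 = 0 := by ext i; fin_cases i <;> simp [hι]
  have key := isPointOfType_zero_of_chart (P := collaredDouble R ht)
    (fun q => (ψ (ι q), -2 + 2 * sectorHeight (ι q)))
    (fun p => (l p.1 0 - l p.1 2, l p.1 1 - l p.1 2))
    ((h.isPL.comp hιpl).prodMk ((IsPL.const (-2)).add (hιpl.sectorHeight.const_mul 2)))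
    (ε := min (ε / 2) (1 / 16)) (by simp [h.pos])
    (fun s t hs ht' => by
      simp only [le_min_iff, abs_le] at hs ht'
      have n0 : min 0 (min s t) ≤ 0 := min_le_left _ _
      have n1 : min 0 (min s t) ≤ s := (min_le_right _ _).trans (min_le_left _ _)
      have n2 : min 0 (min s t) ≤ t := (min_le_right _ _).trans (min_le_right _ _)
      have n3 : -(ε / 2) ≤ min 0 (min s t) :=
        le_min (by linarith [h.pos]) (le_min hs.1.1 ht'.1.1)
      have n4 : -(1 / 16) ≤ min 0 (min s t) := le_min (by norm_num) (le_min hs.2.1 ht'.2.1)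
      have hι' : ∀ i, 0 ≤ ι (s, t) i := fun i => by fin_cases i <;> simp [hι, n1, n2]
      have hιε : ∀ i, ι (s, t) i ≤ min ε (1 / 8) := fun i => by
        fin_cases i <;> refine le_min ?_ ?_ <;> simp only [hι, Fin.zero_eta, Fin.mk_one,
          Fin.reduceFinMk, Matrix.cons_val] <;> linarith
      have hz : ∃ i, ι (s, t) i = 0 := by
        rcases min_choice 0 (min s t) with h | h
        · exact ⟨2, by simp only [hι, Matrix.cons_val]; linarith⟩
        rcases min_choice s t with h' | h'
        · exact ⟨0, by simp only [hι, Matrix.cons_val]; linarith⟩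
        · exact ⟨1, by simp only [hι, Matrix.cons_val]; linarith⟩
      obtain ⟨h5, h6, h7⟩ := h.mem (ι (s, t)) hι' hz fun i => (hιε i).trans (min_le_left _ _)
      have hmm := sectorHeight_nonneg hι'
      have hmm' := sectorHeight_le fun i => (hιε i).trans (min_le_right _ _)
      refine ⟨⟨h5, ⟨?_, ?_⟩, h6.trans ?_⟩, ?_⟩
      · dsimp only; linarith
      · dsimp only; linarith
      · rw [bump_lower (by linarith) (by linarith)]
        dsimp only
        ring
      · simp only [h7]
        simp only [hι, Matrix.cons_val]
        ext1 <;> dsimp only <;> ring)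
    (by
      have h5 : ∀ i, Continuous fun p : E × ℝ => l p.1 i := fun i =>
        ((continuous_apply i).comp h.continuous).comp continuous_fst
      exact (((h5 0).sub (h5 2)).prodMk ((h5 1).sub (h5 2))).continuousAt)
    (by
      simp only [hι0, sectorHeight_zero, mul_zero, add_zero]
      have h5 : ∀ᶠ p : E × ℝ in 𝓝 (ψ 0, -2), p.2 < -1 :=
        continuousAt_snd.eventually_lt continuousAt_const (by norm_num)
      filter_upwards [nhdsWithin_le_nhds (h.eventually_height (-2)), nhdsWithin_le_nhds h5,
        self_mem_nhdsWithin] with p hp hp1 hpR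
      obtain ⟨h6, ⟨i, hi⟩, h8, h9⟩ := hp hpR.1
      rw [hpR.2.2, bump_lower hpR.2.1.1 hp1.le] at h9
      have q0 := h6 0
      have q1 := h6 1
      have q2 := h6 2
      have hmn : min 0 (min (l p.1 0 - l p.1 2) (l p.1 1 - l p.1 2)) = -l p.1 2 := by
        apply le_antisymm
        · fin_cases i
          · refine (min_le_right _ _).trans ((min_le_left _ _).trans ?_)
            simp only [Fin.zero_eta] at hi
            linarith
          · refine (min_le_right _ _).trans ((min_le_right _ _).trans ?_)
            simp only [Fin.mk_one] at hi
            linarith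
          · refine (min_le_left _ _).trans ?_
            simp only [Fin.reduceFinMk] at hi
            linarith
        · exact le_min (by linarith) (le_min (by linarith) (by linarith))
      have hιl : ι (l p.1 0 - l p.1 2, l p.1 1 - l p.1 2) = l p.1 := by
        ext i
        fin_cases i <;> simp [hι, hmn]
      ext1
      · simp only [hιl, h8]
      · simp only [hιl, ← h9]; ring)
  simpa [hι0] using key

/-! ### The collar -/

/-- It serves the collar twice: with `J' = [-1, 1]` inside and with `J' = [0, 1]` at the outer end.
-/
lemma HasModelNhd.prod {F : Type*} [NormedAddCommGroup F] [NormedSpace ℝ F]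
    [FiniteDimensional ℝ E] {P : Set E} {x : E} {Q : Set F} {y : F} (h : HasModelNhd P x Q y)
    {S : Set (E × ℝ)} {z c : ℝ} {J J' : Set ℝ} (hJ : IsPolytopal J) {α : ℝ → ℝ} (hα : IsPL α)
    (hb : BijOn α J J') (hz : α z = c) (hsub : P ×ˢ J ⊆ S) (hnhd : P ×ˢ J ∈ 𝓝[S] (x, z)) :
    HasModelNhd S (x, z) (Q ×ˢ J') (y, c) := by
  obtain ⟨N, hNP, hN, f, hf, hbf, hfx⟩ := h
  have hprod := hf.isPolytopal.prod hJ
  refine ⟨N ×ˢ J, (prod_mono_left hNP).trans hsub, ?_, fun p => (f p.1, α p.2), ?_, ?_, ?_⟩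
  · obtain ⟨U, hU, hUN⟩ := mem_nhdsWithin_iff_exists_mem_nhds_inter.1 hN
    have h1 : ∀ᶠ p in 𝓝 (x, z), p.1 ∈ U := continuousAt_fst.eventually_mem hU
    filter_upwards [hnhd, nhdsWithin_le_nhds h1] with p hp hpU
    exact ⟨hUN ⟨hpU, hp.1⟩, hp.2⟩
  · exact (hf.comp (IsPL.fst.isPLOn hprod) fun p hp => hp.1).prodMk
      ((hα.comp IsPL.snd).isPLOn hprod)
  · exact hbf.prodMap hb
  · rw [← hfx, ← hz]

lemma HasModelNhd.congr_model {F F' : Type*} [NormedAddCommGroup F] [NormedSpace ℝ F]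
    [NormedAddCommGroup F'] [NormedSpace ℝ F'] [FiniteDimensional ℝ E] {P : Set E} {x : E}
    {Q : Set F} {y : F} (h : HasModelNhd P x Q y) {Q' : Set F'} (hQ : IsPolytopal Q)
    (A : F →ₗ[ℝ] F') (hA : BijOn A Q Q') : HasModelNhd P x Q' (A y) := by
  obtain ⟨N, hNP, hN, f, hf, hbf, hfx⟩ := h
  exact ⟨N, hNP, hN, A ∘ f, ((IsPL.of_linear A).isPLOn hQ).comp hf hbf.mapsTo, hA.comp hbf,
    by rw [Function.comp_apply, hfx]⟩

lemma bijOn_appendCoord {n k : ℕ} (h : k ≤ n) :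
    BijOn (appendCoord n k h) (model n k ×ˢ Icc (-1) 1) (model (n + 1) k) := by
  refine ⟨fun p hp => ?_, (Function.LeftInverse.injective (splitCoord_appendCoord h)).injOn,
    fun q hq => ⟨splitCoord n k h q, (splitCoord_mem h q).2 hq, appendCoord_splitCoord h q⟩⟩
  rw [← splitCoord_mem h, splitCoord_appendCoord]
  exact hp

lemma isPointOfType_collaredDouble_of_collar [FiniteDimensional ℝ E] {k : ℕ} (hk : k ≤ 1) {X : E}
    (h : IsPointOfType 1 k {X | X ∈ R ∧ ht X = 0} X) {z : ℝ} (hz : 0 < z) (hz' : z < 1) :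
    IsPointOfType 2 k (collaredDouble R ht) (X, z) := by
  have hδ : 0 < min z (1 - z) := lt_min hz (by linarith)
  obtain ⟨δ, hδ1, hδ2, hδ3⟩ : ∃ δ : ℝ, 0 < δ ∧ δ ≤ z ∧ δ ≤ 1 - z :=
    ⟨_, hδ, min_le_left _ _, min_le_right _ _⟩
  have key := HasModelNhd.prod h (S := collaredDouble R ht) (z := z) (c := 0)
    (J := Icc (z - δ) (z + δ)) (J' := Icc (-1) 1) (isPolytope_Icc _ _).isPolytopal
    (α := fun s => (s - z) / δ) ((IsPL.of_linear LinearMap.id).sub (IsPL.const z) |>.div_const δ)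
    ⟨fun s hs => ?_, fun s _ t _ he => ?_, fun s hs => ⟨z + δ * s, ?_, ?_⟩⟩ (by simp) ?_ ?_
  · have := HasModelNhd.congr_model key
      ((isPolytopal_model 1 k).prod (isPolytope_Icc _ _).isPolytopal)
      (appendCoord 1 k hk) (bijOn_appendCoord hk)
    rwa [← splitCoord_centre hk, appendCoord_splitCoord] at this
  · rw [mem_Icc, le_div_iff₀ hδ1, div_le_iff₀ hδ1]
    constructor <;> linarith [hs.1, hs.2]
  · simpa [hδ1.ne'] using he
  · constructor <;> nlinarith [hs.1, hs.2]
  · simp [hδ1.ne']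
  · rintro ⟨Y, s⟩ ⟨hY, hs⟩
    have hs1 : z - δ ≤ s := hs.1
    have hs2 : s ≤ z + δ := hs.2
    refine ⟨hY.1, ⟨by dsimp only; linarith, by dsimp only; linarith⟩, ?_⟩
    rw [bump_of_nonneg (by linarith)]
    exact hY.2
  · have h1 : ∀ᶠ p : E × ℝ in 𝓝 (X, z), p.2 ∈ Icc (z - δ) (z + δ) :=
      continuousAt_snd.eventually_mem (Icc_mem_nhds (by simp [hδ1]) (by simp [hδ1]))
    filter_upwards [nhdsWithin_le_nhds h1, self_mem_nhdsWithin] with p hp hpR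
    have hs1 : z - δ ≤ p.2 := hp.1
    exact ⟨⟨hpR.1, by rw [hpR.2.2, bump_of_nonneg (by linarith)]⟩, hp⟩

lemma isBoundaryPointOfType_collaredDouble [FiniteDimensional ℝ E] {k : ℕ} {X : E}
    (h : IsPointOfType 1 k {X | X ∈ R ∧ ht X = 0} X) :
    IsBoundaryPointOfType 2 k (collaredDouble R ht) (X, 1) := by
  refine HasModelNhd.prod h (S := collaredDouble R ht) (z := 1) (c := 0)
    (J := Icc 0 1) (J' := Icc 0 1) (isPolytope_Icc _ _).isPolytopal
    (α := fun s => 1 - s) ((IsPL.const 1).sub (IsPL.of_linear LinearMap.id))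
    ⟨fun s hs => ?_, fun s _ t _ he => ?_, fun s hs => ⟨1 - s, ?_, ?_⟩⟩ (by simp) ?_ ?_
  · constructor <;> linarith [hs.1, hs.2]
  · simpa using he
  · constructor <;> linarith [hs.1, hs.2]
  · simp
  · rintro ⟨Y, s⟩ ⟨hY, hs⟩
    refine ⟨hY.1, ⟨by linarith [hs.1], hs.2⟩, ?_⟩
    rw [bump_of_nonneg hs.1]
    exact hY.2
  · have h1 : ∀ᶠ p : E × ℝ in 𝓝 (X, 1), 0 < p.2 :=
      continuousAt_const.eventually_lt continuousAt_snd (by simp)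
    filter_upwards [nhdsWithin_le_nhds h1, self_mem_nhdsWithin] with p hp hpR
    exact ⟨⟨hpR.1, by rw [hpR.2.2, bump_of_nonneg hp.le]⟩, hp.le, hpR.2.1.2⟩

end CollaredDouble

end PLTop

namespace PLTop

/-! ### Ribbon surfaces of graphs with cyclically ordered edges. -/

section Ribbon

variable {V : Type*} [DecidableEq V]

/-! ### The ribbon surface of a graph -/

/-- The point dividing the edge from the vertex `v` to the vertex `w` in the ratio `s : 1 - s`. -/
def edgePoint (v w : V) (s : ℝ) : V → ℝ := Pi.single v (1 - s) + Pi.single w s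

lemma edgePoint_comm (v w : V) (s : ℝ) : edgePoint w v (1 - s) = edgePoint v w s := by
  rw [edgePoint, edgePoint, add_comm, sub_sub_cancel]

lemma edgePoint_zero (v w : V) : edgePoint v w 0 = Pi.single v 1 := by simp [edgePoint]

lemma edgePoint_left {v w : V} (h : v ≠ w) (s : ℝ) : edgePoint v w s v = 1 - s := by
  simp [edgePoint, h]

lemma edgePoint_right {v w : V} (h : v ≠ w) (s : ℝ) : edgePoint v w s w = s := by
  simp [edgePoint, h.symm]

lemma edgePoint_of_ne {v w u : V} (h : u ≠ v) (h' : u ≠ w) (s : ℝ) : edgePoint v w s u = 0 := by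
  simp [edgePoint, h, h']

/-- The path formed by an edge from `v` to `w` for `0 ≤ s` and one from `v` to `w'` for `s ≤ 0`. -/
def bend (v w w' : V) (s : ℝ) : V → ℝ :=
  Pi.single v (1 - |s|) + Pi.single w (max s 0) + Pi.single w' (max (-s) 0)

lemma bend_of_nonneg (v w w' : V) {s : ℝ} (hs : 0 ≤ s) : bend v w w' s = edgePoint v w s := by
  simp [bend, edgePoint, abs_of_nonneg hs, hs]

lemma bend_of_nonpos (v w w' : V) {s : ℝ} (hs : s ≤ 0) : bend v w w' s = edgePoint v w' (-s) := by
  simp [bend, edgePoint, abs_of_nonpos hs, hs]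

/-- The corner at `v` adjacent to the side `b` of the edge from `v` to `w`. -/
def corner (prv : V → V → V) (v w : V) (b : Bool) : V × V := (v, if b then w else prv v w)

/-- On a strip of height `h`, the part of the height carried by the far end. -/
noncomputable def slide (s h : ℝ) : ℝ := max 0 (min h (s - (1 - h) / 2))

@[simp] lemma slide_zero (s : ℝ) : slide s 0 = 0 := max_eq_left (min_le_left _ _)

/-- As `s` crosses the interval of length `h` centred at `1 / 2`, `slide s h` rises linearly from
`0` to `h`; the symmetry `s ↦ 1 - s` exchanges the shares of the two ends. -/
lemma slide_add {s h : ℝ} (hh : 0 ≤ h) : slide (1 - s) h + slide s h = h := by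
  rw [slide, slide]
  rcases le_total h (s - (1 - h) / 2) with h1 | h1
  · rw [min_eq_left h1, max_eq_right hh, min_eq_right (by linarith), max_eq_left (by linarith)]
    ring
  · rcases le_total 0 (s - (1 - h) / 2) with h2 | h2
    · rw [min_eq_right h1, max_eq_right h2, min_eq_right (by linarith),
        max_eq_right (by linarith)]
      ring
    · rw [min_eq_right h1, max_eq_left h2, min_eq_left (by linarith), max_eq_right hh, add_zero]

/-- For `h ≤ 1 / 2` the sliding takes place within `[1/4, 3/4]`; hence the constants `1 / 4` and `3
/ 4` in the description of stars of vertices. -/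
lemma slide_of_le {s h : ℝ} (hs : s ≤ 1 / 4) (hh : h ≤ 1 / 2) : slide s h = 0 :=
  max_eq_left ((min_le_right _ _).trans (by linarith))

lemma slide_of_ge {s h : ℝ} (hs : s ≤ 1 / 4) (hh : h ≤ 1 / 2) (h0 : 0 ≤ h) :
    slide (1 - s) h = h := by
  have := slide_add (s := s) h0
  rwa [slide_of_le hs hh, add_zero] at this

/-- The side `b` of the edge from `v` to `w`, with coordinates `(s, h)`. -/
noncomputable def strip (prv : V → V → V) (v w : V) (b : Bool) (q : ℝ × ℝ) :
    (V → ℝ) × (V × V → ℝ) :=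
  (edgePoint v w q.1, Pi.single (corner prv v w b) (slide (1 - q.1) q.2) +
    Pi.single (corner prv w v !b) (slide q.1 q.2))

lemma strip_fst (prv : V → V → V) (v w : V) (b : Bool) (q : ℝ × ℝ) :
    (strip prv v w b q).1 = edgePoint v w q.1 := rfl

/-- The ribbon surface of a graph with neighbours of each vertex cyclically permuted. -/
def ribbon (G : SimpleGraph V) (prv : V → V → V) : Set ((V → ℝ) × (V × V → ℝ)) :=
  {X | ∃ v w b s h, G.Adj v w ∧ s ∈ Icc (0 : ℝ) 1 ∧ h ∈ Icc (0 : ℝ) (1 / 2) ∧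
    X = strip prv v w b (s, h)}

/-- The map `prv` permutes cyclically the two or three neighbours of each vertex. -/
def IsRotation (G : SimpleGraph V) (prv : V → V → V) : Prop :=
  ∀ v, (∃ w : Fin 2 → V, Function.Injective w ∧ (∀ u, G.Adj v u ↔ ∃ i, w i = u) ∧
      ∀ i, prv v (w (i + 1)) = w i) ∨
    (∃ w : Fin 3 → V, Function.Injective w ∧ (∀ u, G.Adj v u ↔ ∃ i, w i = u) ∧
      ∀ i, prv v (w (i + 1)) = w i)

lemma strip_comm (prv : V → V → V) (v w : V) (b : Bool) (s h : ℝ) :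
    strip prv w v (!b) (1 - s, h) = strip prv v w b (s, h) := by
  simp only [strip, edgePoint_comm, sub_sub_cancel, Bool.not_not]
  rw [add_comm]

/-- Near `v` all height sits at one corner of `v`. Two sides with a common corner therefore agree
along `s = 0`, which is how strips are glued around a vertex. -/
lemma strip_star (prv : V → V → V) (v w : V) (b : Bool) {s h : ℝ} (hs : s ≤ 1 / 4)
    (hh : h ∈ Icc (0 : ℝ) (1 / 2)) :
    strip prv v w b (s, h) = (edgePoint v w s, Pi.single (corner prv v w b) h) := by
  simp [strip, slide_of_le hs hh.2, slide_of_ge hs hh.2 hh.1]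

@[simp] lemma strip_zero (prv : V → V → V) (v w : V) (b : Bool) (s : ℝ) :
    strip prv v w b (s, 0) = (edgePoint v w s, 0) := by
  simp [strip]

section Local

variable {G : SimpleGraph V} {prv : V → V → V}

lemma star_mem_ribbon {v w : V} (b : Bool) {s h : ℝ} (hvw : G.Adj v w)
    (hs : s ∈ Icc (0 : ℝ) (1 / 4)) (hh : h ∈ Icc (0 : ℝ) (1 / 2)) :
    (edgePoint v w s, Pi.single (corner prv v w b) h) ∈ ribbon G prv :=
  ⟨v, w, b, s, h, hvw, ⟨hs.1, hs.2.trans (by norm_num)⟩, hh, (strip_star prv v w b hs.2 hh).symm⟩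

/-- The part of the ribbon surface near a vertex. -/
lemma exists_star_of_mem_ribbon {X : (V → ℝ) × (V × V → ℝ)} (hX : X ∈ ribbon G prv) {v : V}
    (hv : 3 / 4 < X.1 v) : ∃ w b s h, G.Adj v w ∧ s ∈ Icc (0 : ℝ) (1 / 4) ∧
      h ∈ Icc (0 : ℝ) (1 / 2) ∧ X = (edgePoint v w s, Pi.single (corner prv v w b) h) := by
  have key : ∀ w b s h, G.Adj v w → s ∈ Icc (0 : ℝ) 1 → h ∈ Icc (0 : ℝ) (1 / 2) →
      X = strip prv v w b (s, h) → ∃ w b s h, G.Adj v w ∧ s ∈ Icc (0 : ℝ) (1 / 4) ∧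
      h ∈ Icc (0 : ℝ) (1 / 2) ∧ X = (edgePoint v w s, Pi.single (corner prv v w b) h) := by
    intro w b s h hvw hs hh hXs
    have h1 : X.1 v = 1 - s := by rw [hXs, strip_fst, edgePoint_left hvw.ne]
    have h2 : s ≤ 1 / 4 := by linarith
    exact ⟨w, b, s, h, hvw, ⟨hs.1, h2⟩, hh, hXs.trans (strip_star prv v w b h2 hh)⟩
  obtain ⟨v', w', b, s, h, hadj, hs, hh, hXs⟩ := hX
  by_cases h1 : v = v'
  · subst h1
    exact key w' b s h hadj hs hh hXs
  by_cases h2 : v = w'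
  · subst h2
    exact key v' (!b) (1 - s) h hadj.symm ⟨by linarith [hs.2], by linarith [hs.1]⟩ hh
      (hXs.trans (strip_comm prv v' v b s h).symm)
  · rw [hXs, strip_fst, edgePoint_of_ne h1 h2] at hv
    linarith

/-- The part of the ribbon surface near an edge. -/
lemma exists_strip_of_mem_ribbon {X : (V → ℝ) × (V × V → ℝ)} (hX : X ∈ ribbon G prv) {v w : V}
    (hvw : v ≠ w) (hv : 0 < X.1 v) (hw : 0 < X.1 w) : ∃ b s h, s ∈ Icc (0 : ℝ) 1 ∧
      h ∈ Icc (0 : ℝ) (1 / 2) ∧ X = strip prv v w b (s, h) := by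
  obtain ⟨v', w', b, s, h, hadj, hs, hh, hXs⟩ := hX
  have key : ∀ u, 0 < X.1 u → u = v' ∨ u = w' := fun u hu => by
    by_contra! hcon
    rw [hXs, strip_fst, edgePoint_of_ne hcon.1 hcon.2] at hu
    exact hu.false
  rcases key v hv with rfl | rfl
  · obtain rfl := (key w hw).resolve_left hvw.symm
    exact ⟨b, s, h, hs, hh, hXs⟩
  · obtain rfl := (key w hw).resolve_right hvw.symm
    exact ⟨!b, 1 - s, h, ⟨by linarith [hs.2], by linarith [hs.1]⟩, hh,
      hXs.trans (strip_comm _ _ _ _ _ _).symm⟩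

/-- A corner is named after the earlier of two consecutive neighbours: `(v, w i)` lies on side
`true` of the edge to `w i`, on side `false` of the edge to `w (i + 1)`, and on no other side. The
argument only needs `1 ≠ 0` in `Fin n`, so it covers both degrees. -/
lemma IsRotation.exists_corner (hG : IsRotation G prv) {v u : V} {b : Bool} (h : G.Adj v u) :
    ∃ w w', G.Adj v w ∧ G.Adj v w' ∧ w ≠ w' ∧ corner prv v w true = corner prv v u b ∧
      corner prv v w' false = corner prv v u b ∧ ∀ u' b', G.Adj v u' →
        corner prv v u' b' = corner prv v u b → (u' = w ∧ b' = true) ∨ (u' = w' ∧ b' = false) := by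
  have key : ∀ (n : ℕ) [NeZero n] (w : Fin n → V), (1 : Fin n) ≠ 0 → Function.Injective w →
      (∀ u, G.Adj v u ↔ ∃ i, w i = u) → (∀ i, prv v (w (i + 1)) = w i) →
    ∃ w w', G.Adj v w ∧ G.Adj v w' ∧ w ≠ w' ∧ corner prv v w true = corner prv v u b ∧
      corner prv v w' false = corner prv v u b ∧ ∀ u' b', G.Adj v u' →
        corner prv v u' b' = corner prv v u b →
          (u' = w ∧ b' = true) ∨ (u' = w' ∧ b' = false) := by
    intro n _ w h10 hinj hadj hprv
    have hprv' : ∀ i, prv v (w i) = w (i - 1) := fun i => by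
      simpa using hprv (i - 1)
    obtain ⟨i, hi⟩ : ∃ i, corner prv v u b = (v, w i) := by
      obtain ⟨j, rfl⟩ := (hadj u).1 h
      cases b
      · exact ⟨j - 1, by simp [corner, hprv']⟩
      · exact ⟨j, by simp [corner]⟩
    refine ⟨w i, w (i + 1), (hadj _).2 ⟨_, rfl⟩, (hadj _).2 ⟨_, rfl⟩, ?_, ?_, ?_, ?_⟩
    · exact fun he => h10 (by simpa using hinj he)
    · rw [hi]; simp [corner]
    · rw [hi]; simp [corner, hprv]
    · intro u' b' hu' he
      obtain ⟨j, rfl⟩ := (hadj u').1 hu'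
      rw [hi] at he
      cases b'
      · simp only [corner, Bool.false_eq_true, if_false, hprv', Prod.mk.injEq, true_and] at he
        exact Or.inr ⟨by rw [← hinj he, sub_add_cancel], rfl⟩
      · simp only [corner, if_true, Prod.mk.injEq, true_and] at he
        exact Or.inl ⟨he, rfl⟩
  rcases hG v with ⟨w, h1, h2, h3⟩ | ⟨w, h1, h2, h3⟩
  · exact key 2 w (by decide) h1 h2 h3
  · exact key 3 w (by decide) h1 h2 h3

lemma IsRotation.corner_ne (hG : IsRotation G prv) {v u : V} (h : G.Adj v u) :
    corner prv v u true ≠ corner prv v u false := by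
  obtain ⟨w, w', -, -, hne, -, -, h1⟩ := hG.exists_corner (b := true) h
  intro he
  rcases h1 u true h rfl with ⟨a, -⟩ | ⟨-, a⟩
  · rcases h1 u false h he.symm with ⟨-, c⟩ | ⟨c, -⟩
    · cases c
    · exact hne (a.symm.trans c)
  · cases a

/-- The part of the height on the side `b` of the edge from `v` to `w`. -/
def sideHeight (prv : V → V → V) (v w : V) (b : Bool) (X : (V → ℝ) × (V × V → ℝ)) : ℝ :=
  X.2 (corner prv v w b) + X.2 (corner prv w v !b)

/-- The two sides of an edge use four distinct corners, so their heights are read off separately,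
and the side of a point of positive height is recovered. -/
lemma sideHeight_strip (hG : IsRotation G prv) {v w : V} (h : G.Adj v w) (b b' : Bool) {s r : ℝ}
    (hr : 0 ≤ r) :
    sideHeight prv v w b (strip prv v w b' (s, r)) = if b = b' then r else 0 := by
  have h1 : ∀ b b', corner prv v w b ≠ corner prv w v b' := fun b b' he =>
    h.ne (congrArg Prod.fst he)
  have h2 := hG.corner_ne h
  have h3 := hG.corner_ne h.symm
  have h4 := slide_add (s := s) hr
  have h1' := fun b b' => (h1 b b').symm
  cases b <;> cases b' <;> simp [sideHeight, strip, h1, h1', h2, h3, h2.symm, h3.symm, h4]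

end Local

/-! ### Charts of the ribbon surface -/

section Charts

variable [Fintype V] {G : SimpleGraph V} {prv : V → V → V}

/-- The total height of a point of the ribbon surface. -/
def height (X : (V → ℝ) × (V × V → ℝ)) : ℝ := ∑ c, X.2 c

@[simp] lemma height_single (x : V → ℝ) (c : V × V) (h : ℝ) : height (x, Pi.single c h) = h := by
  simp [height]

lemma height_strip (v w : V) (b : Bool) (s : ℝ) {h : ℝ} (hh : 0 ≤ h) :
    height (strip prv v w b (s, h)) = h := by
  simp [height, strip, Finset.sum_add_distrib, slide_add hh]

lemma IsPL.single {E : Type*} [NormedAddCommGroup E] [NormedSpace ℝ E]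
    [FiniteDimensional ℝ E] {f : E → ℝ} (hf : IsPL f) (v : V) :
    IsPL (fun x => (Pi.single v (f x) : V → ℝ)) :=
  (IsPL.of_linear (LinearMap.single ℝ (fun _ : V => ℝ) v)).comp hf

lemma isPL_edgePoint (v w : V) : IsPL (edgePoint v w) :=
  (((IsPL.const 1).sub (IsPL.of_linear LinearMap.id)).single v).add
    ((IsPL.of_linear LinearMap.id).single w)

lemma IsPL.slide {E : Type*} [NormedAddCommGroup E] [NormedSpace ℝ E] [FiniteDimensional ℝ E]
    {f g : E → ℝ} (hf : IsPL f) (hg : IsPL g) : IsPL (fun x => slide (f x) (g x)) :=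
  (IsPL.const 0).max (hg.min (hf.sub (((IsPL.const 1).sub hg).div_const 2)))

lemma isPL_strip (v w : V) (b : Bool) : IsPL (strip prv v w b) :=
  ((isPL_edgePoint v w).comp IsPL.fst).prodMk
    (((((IsPL.const 1).sub IsPL.fst).slide IsPL.snd).single _).add
      ((IsPL.fst.slide IsPL.snd).single _))

lemma isPL_bend (v w w' : V) : IsPL (bend v w w') := by
  have h : IsPL fun s : ℝ => s := IsPL.of_linear LinearMap.id
  exact ((((IsPL.const 1).sub h.abs).single v).add ((h.max (IsPL.const 0)).single w)).add
    ((h.neg.max (IsPL.const 0)).single w')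

/-- Points in the interior of a strip. -/
lemma isPointOfType_of_strip (hG : IsRotation G prv) {v w : V} (h : G.Adj v w) (b : Bool)
    {s z : ℝ} (hs : 0 < s) (hs' : s < 1) (hz : -2 < z) (hz' : z < 0) :
    IsPointOfType 2 0 (collaredDouble (ribbon G prv) height) (strip prv v w b (s, bump z), z) := by
  have hb := bump_pos hz hz'
  refine isPointOfType_collaredDouble_of_strip (l := fun X => X.1 w) (isPL_strip v w b)
    (by fun_prop) (ε := min s (1 - s)) (by simp [hs, hs']) hz hz' ?_ ?_
  · intro t r ht hr
    have ht1 := abs_le.1 (ht.trans (min_le_left _ _))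
    have ht2 := abs_le.1 (ht.trans (min_le_right _ _))
    exact ⟨⟨v, w, b, t, r, h, ⟨by linarith, by linarith⟩, hr, rfl⟩, height_strip v w b t hr.1,
      edgePoint_right h.ne t⟩
  · have h1 : ∀ᶠ X : (V → ℝ) × (V × V → ℝ) in 𝓝 (strip prv v w b (s, bump z)), 0 < X.1 v :=
      ContinuousAt.eventually_lt (by fun_prop) (by fun_prop)
        (by rw [strip_fst, edgePoint_left h.ne]; simpa using hs')
    have h2 : ∀ᶠ X : (V → ℝ) × (V × V → ℝ) in 𝓝 (strip prv v w b (s, bump z)), 0 < X.1 w :=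
      ContinuousAt.eventually_lt (by fun_prop) (by fun_prop)
        (by rw [strip_fst, edgePoint_right h.ne]; simpa using hs)
    have h3 : ∀ᶠ X : (V → ℝ) × (V × V → ℝ) in 𝓝 (strip prv v w b (s, bump z)),
        0 < sideHeight prv v w b X :=
      ContinuousAt.eventually_lt (by fun_prop) (by unfold sideHeight; fun_prop)
        (by rw [sideHeight_strip hG h _ _ hb.le]; simpa using hb)
    filter_upwards [h1, h2, h3] with X hX1 hX2 hX3 hX
    obtain ⟨b', t, r, ht, hr, rfl⟩ := exists_strip_of_mem_ribbon hX h.ne hX1 hX2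
    rw [sideHeight_strip hG h _ _ hr.1] at hX3
    have hbb : b = b' := by
      by_contra hne
      simp [hne] at hX3
    rw [height_strip v w b' t hr.1, hbb]
    simp only [strip, edgePoint_right h.ne]

/-- Points in the corners. -/
lemma isPointOfType_of_corner (hG : IsRotation G prv) {v u : V} (h : G.Adj v u) (b : Bool)
    {z : ℝ} (hz : -2 < z) (hz' : z < 0) :
    IsPointOfType 2 0 (collaredDouble (ribbon G prv) height)
      ((Pi.single v 1, Pi.single (corner prv v u b) (bump z)), z) := by
  have hb := bump_pos hz hz'
  obtain ⟨w, w', hw, hw', hne, hc, hc', huniq⟩ := hG.exists_corner (b := b) h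
  set c := corner prv v u b with hcdef
  -- The two sides that share the corner join along `s = 0` into a single strip, parametrized by the
  -- bent path from `w'` to `w`.
  have key := isPointOfType_collaredDouble_of_strip (R := ribbon G prv) (ht := height)
    (G := fun q => (bend v w w' q.1, Pi.single c q.2)) (l := fun X => X.1 w - X.1 w')
    (((isPL_bend v w w').comp IsPL.fst).prodMk (IsPL.snd.single c))
    (by fun_prop) (s₀ := 0) (ε := 1 / 4) (by norm_num) hz hz' ?_ ?_
  · simpa [bend] using key
  · intro s r hs hr
    rw [sub_zero, abs_le] at hs
    rcases le_total 0 s with h0 | h0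
    · simp only [bend_of_nonneg v w w' h0, height_single, edgePoint_right hw.ne,
        edgePoint_of_ne hw'.ne' hne.symm, sub_zero, and_true]
      rw [← hc]
      exact star_mem_ribbon true hw ⟨h0, hs.2⟩ hr
    · simp only [bend_of_nonpos v w w' h0, height_single, edgePoint_right hw'.ne,
        edgePoint_of_ne hw.ne' hne, zero_sub, neg_neg, and_true]
      rw [← hc']
      exact star_mem_ribbon false hw' ⟨by linarith, by linarith⟩ hr
  · set X₀ : (V → ℝ) × (V × V → ℝ) := (bend v w w' 0, Pi.single c (bump z)) with hX₀
    have h1 : ∀ᶠ X : (V → ℝ) × (V × V → ℝ) in 𝓝 X₀, 3 / 4 < X.1 v :=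
      ContinuousAt.eventually_lt (by fun_prop) (by fun_prop)
        (by simp only [hX₀, bend_of_nonneg _ _ _ le_rfl, edgePoint_left hw.ne]; norm_num)
    have h2 : ∀ᶠ X : (V → ℝ) × (V × V → ℝ) in 𝓝 X₀, 0 < X.2 c :=
      ContinuousAt.eventually_lt (by fun_prop) (by fun_prop) (by simpa [hX₀] using hb)
    filter_upwards [h1, h2] with X hX1 hX2 hX
    obtain ⟨u', b', s, r, hu', hs, hr, rfl⟩ := exists_star_of_mem_ribbon hX hX1
    have hcc : corner prv v u' b' = c := by
      by_contra hne'
      simp [Ne.symm hne'] at hX2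
    rcases huniq u' b' hu' hcc with ⟨rfl, rfl⟩ | ⟨rfl, rfl⟩
    · simp only [height_single, edgePoint_right hw.ne, edgePoint_of_ne hw'.ne' hne.symm, sub_zero,
        bend_of_nonneg _ _ _ hs.1, hcc]
    · simp only [height_single, edgePoint_right hw'.ne, edgePoint_of_ne hw.ne' hne, zero_sub,
        bend_of_nonpos _ _ _ (neg_nonpos.2 hs.1), neg_neg, hcc]

/-- Points in the interior of an edge. -/
lemma isPointOfType_of_edge (hG : IsRotation G prv) {v w : V} (h : G.Adj v w)
    {s : ℝ} (hs : 0 < s) (hs' : s < 1) :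
    IsPointOfType 2 1 (collaredDouble (ribbon G prv) height) ((edgePoint v w s, 0), 0) ∧
      IsPointOfType 2 0 (collaredDouble (ribbon G prv) height) ((edgePoint v w s, 0), -2) := by
  -- The two sides of the edge are joined by means of a signed height, positive on side `true`.
  set κ : ℝ × ℝ → (V → ℝ) × (V × V → ℝ) := fun q => (edgePoint v w (s + q.1),
    (strip prv v w true (s + q.1, max q.2 0)).2 + (strip prv v w false (s + q.1, max (-q.2) 0)).2)
    with hκ
  have hκ1 : ∀ t r, 0 ≤ r → κ (t, r) = strip prv v w true (s + t, r) := by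
    intro t r hr
    simp [hκ, hr, strip]
  have hκ2 : ∀ t r, r ≤ 0 → κ (t, r) = strip prv v w false (s + t, -r) := by
    intro t r hr
    simp [hκ, hr, strip]
  set l : (V → ℝ) × (V × V → ℝ) → ℝ × ℝ := fun X =>
    (X.1 w - s, sideHeight prv v w true X - sideHeight prv v w false X) with hl
  have hl1 : ∀ t r, 0 ≤ r → l (strip prv v w true (t, r)) = (t - s, r) := by
    intro t r hr
    simp only [hl, sideHeight_strip hG h _ _ hr]
    simp [strip, edgePoint_right h.ne]
  have hl2 : ∀ t r, 0 ≤ r → l (strip prv v w false (t, r)) = (t - s, -r) := by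
    intro t r hr
    simp only [hl, sideHeight_strip hG h _ _ hr]
    simp [strip, edgePoint_right h.ne]
  have hκ0 : κ 0 = (edgePoint v w s, 0) := by
    rw [show (0 : ℝ × ℝ) = (0, 0) from rfl, hκ1 0 0 le_rfl]
    simp
  have hX : IsPL fun q : ℝ × ℝ => s + q.1 := (IsPL.const s).add IsPL.fst
  rw [← hκ0]
  refine isPointOfType_collaredDouble_of_twoSided (l := l)
    (((isPL_edgePoint v w).comp hX).prodMk ((IsPL.snd.comp ((isPL_strip v w true).comp
      (hX.prodMk (IsPL.snd.max (IsPL.const 0))))).add (IsPL.snd.comp ((isPL_strip v w false).comp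
      (hX.prodMk (IsPL.snd.neg.max (IsPL.const 0)))))))
    (by unfold l sideHeight; fun_prop) (ε := min (1 / 2) (min s (1 - s))) (by simp [hs, hs']) ?_ ?_
  · intro t r ht hr
    simp only [le_min_iff, abs_le] at ht hr
    rcases le_total 0 r with h0 | h0
    · rw [hκ1 t r h0, hl1 _ _ h0, height_strip _ _ _ _ h0, abs_of_nonneg h0, add_sub_cancel_left]
      exact ⟨⟨v, w, true, _, _, h, ⟨by linarith, by linarith⟩, ⟨h0, by linarith⟩, rfl⟩, rfl, rfl⟩
    · rw [hκ2 t r h0, hl2 _ _ (neg_nonneg.2 h0), height_strip _ _ _ _ (neg_nonneg.2 h0),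
        abs_of_nonpos h0, add_sub_cancel_left, neg_neg]
      exact ⟨⟨v, w, false, _, _, h, ⟨by linarith, by linarith⟩, ⟨by linarith, by linarith⟩, rfl⟩,
        rfl, rfl⟩
  · have h1 : ∀ᶠ X : (V → ℝ) × (V × V → ℝ) in 𝓝 (κ 0), 0 < X.1 v :=
      ContinuousAt.eventually_lt (by fun_prop) (by fun_prop)
        (by simpa [hκ0, edgePoint_left h.ne] using hs')
    have h2 : ∀ᶠ X : (V → ℝ) × (V × V → ℝ) in 𝓝 (κ 0), 0 < X.1 w :=
      ContinuousAt.eventually_lt (by fun_prop) (by fun_prop)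
        (by simpa [hκ0, edgePoint_right h.ne] using hs)
    filter_upwards [h1, h2] with X hX1 hX2 hX
    obtain ⟨b, t, r, ht, hr, rfl⟩ := exists_strip_of_mem_ribbon hX h.ne hX1 hX2
    cases b
    · rw [hl2 _ _ hr.1, hκ2 _ _ (neg_nonpos.2 hr.1), add_sub_cancel, neg_neg]
    · rw [hl1 _ _ hr.1, hκ1 _ _ hr.1, add_sub_cancel]

/-- Vertices with two neighbours. -/
lemma isPointOfType_of_degree_two {v : V} {w : Fin 2 → V} (hinj : Function.Injective w)
    (hadj : ∀ u, G.Adj v u ↔ ∃ i, w i = u) (hprv : ∀ i, prv v (w (i + 1)) = w i) :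
    IsPointOfType 2 1 (collaredDouble (ribbon G prv) height) ((Pi.single v 1, 0), 0) ∧
      IsPointOfType 2 0 (collaredDouble (ribbon G prv) height) ((Pi.single v 1, 0), -2) := by
  have hne : w 0 ≠ w 1 := hinj.ne (by decide)
  have h0 : G.Adj v (w 0) := (hadj _).2 ⟨0, rfl⟩
  have h1 : G.Adj v (w 1) := (hadj _).2 ⟨1, rfl⟩
  have hp0 : prv v (w 1) = w 0 := hprv 0
  have hp1 : prv v (w 0) = w 1 := hprv 1
  -- At a vertex of degree two the corners `(v, w 0)` and `(v, w 1)` are the two sides of the bent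
  -- path, and the signed height is distributed between them.
  set side : ℝ → V × V → ℝ := fun r =>
    Pi.single (v, w 0) (max r 0) + Pi.single (v, w 1) (max (-r) 0) with hside
  have hs1 : ∀ {r}, 0 ≤ r → side r = Pi.single (v, w 0) r := fun hr => by simp [hside, hr]
  have hs2 : ∀ {r}, r ≤ 0 → side r = Pi.single (v, w 1) (-r) := fun hr => by simp [hside, hr]
  have hspl : IsPL side := by
    have h : IsPL fun s : ℝ => s := IsPL.of_linear LinearMap.id
    exact ((h.max (IsPL.const 0)).single _).add ((h.neg.max (IsPL.const 0)).single _)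
  set κ : ℝ × ℝ → (V → ℝ) × (V × V → ℝ) := fun q => (bend v (w 0) (w 1) q.1, side q.2) with hκ
  have hκ0 : κ 0 = (Pi.single v 1, 0) := by simp [hκ, bend, hside]
  set l : (V → ℝ) × (V × V → ℝ) → ℝ × ℝ := fun X =>
    (X.1 (w 0) - X.1 (w 1), X.2 (v, w 0) - X.2 (v, w 1)) with hl
  rw [← hκ0]
  refine isPointOfType_collaredDouble_of_twoSided (l := l)
    (((isPL_bend v (w 0) (w 1)).comp IsPL.fst).prodMk (hspl.comp IsPL.snd))
    (by unfold l; fun_prop) (ε := 1 / 4) (by norm_num) ?_ ?_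
  · intro s r hs hr
    rw [abs_le] at hs hr
    have key : ∀ i b t a, t ∈ Icc (0 : ℝ) (1 / 4) → a ∈ Icc (0 : ℝ) (1 / 2) →
        (edgePoint v (w i) t, Pi.single (corner prv v (w i) b) a) ∈ ribbon G prv :=
      fun i b t a ht ha => star_mem_ribbon b ((hadj _).2 ⟨i, rfl⟩) ht ha
    rcases le_total 0 s with hs0 | hs0 <;> rcases le_total 0 r with hr0 | hr0
    · refine ⟨?_, by simp [hκ, hs1 hr0, abs_of_nonneg hr0], ?_⟩
      · have := key 0 true s r ⟨hs0, hs.2⟩ ⟨hr0, by linarith⟩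
        simpa [hκ, bend_of_nonneg _ _ _ hs0, hs1 hr0, corner] using this
      · simp [hκ, hl, bend_of_nonneg _ _ _ hs0, hs1 hr0, edgePoint_right h0.ne,
          edgePoint_of_ne h1.ne' hne.symm, hne.symm]
    · refine ⟨?_, by simp [hκ, hs2 hr0, abs_of_nonpos hr0], ?_⟩
      · have := key 0 false s (-r) ⟨hs0, hs.2⟩ ⟨by linarith, by linarith⟩
        simpa [hκ, bend_of_nonneg _ _ _ hs0, hs2 hr0, corner, hp1] using this
      · simp [hκ, hl, bend_of_nonneg _ _ _ hs0, hs2 hr0, edgePoint_right h0.ne,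
          edgePoint_of_ne h1.ne' hne.symm, hne]
    · refine ⟨?_, by simp [hκ, hs1 hr0, abs_of_nonneg hr0], ?_⟩
      · have := key 1 false (-s) r ⟨by linarith, by linarith⟩ ⟨hr0, by linarith⟩
        simpa [hκ, bend_of_nonpos _ _ _ hs0, hs1 hr0, corner, hp0] using this
      · simp [hκ, hl, bend_of_nonpos _ _ _ hs0, hs1 hr0, edgePoint_right h1.ne,
          edgePoint_of_ne h0.ne' hne, hne.symm]
    · refine ⟨?_, by simp [hκ, hs2 hr0, abs_of_nonpos hr0], ?_⟩
      · have := key 1 true (-s) (-r) ⟨by linarith, by linarith⟩ ⟨by linarith, by linarith⟩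
        simpa [hκ, bend_of_nonpos _ _ _ hs0, hs2 hr0, corner] using this
      · simp [hκ, hl, bend_of_nonpos _ _ _ hs0, hs2 hr0, edgePoint_right h1.ne,
          edgePoint_of_ne h0.ne' hne, hne]
  · have h2 : ∀ᶠ X : (V → ℝ) × (V × V → ℝ) in 𝓝 (κ 0), 3 / 4 < X.1 v :=
      ContinuousAt.eventually_lt (by fun_prop) (by fun_prop) (by rw [hκ0]; norm_num)
    filter_upwards [h2] with X hX1 hX
    obtain ⟨u, b, s, r, hu, hs, hr, rfl⟩ := exists_star_of_mem_ribbon hX hX1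
    have hs' := neg_nonpos.2 hs.1
    have hr' := neg_nonpos.2 hr.1
    obtain ⟨i, rfl⟩ := (hadj u).1 hu
    fin_cases i <;> cases b
    · simp [hκ, hl, corner, hp1, edgePoint_right h0.ne, edgePoint_of_ne h1.ne' hne.symm,
        bend_of_nonneg _ _ _ hs.1, hne, hs2 hr']
    · simp [hκ, hl, corner, edgePoint_right h0.ne, edgePoint_of_ne h1.ne' hne.symm,
        bend_of_nonneg _ _ _ hs.1, hne.symm, hs1 hr.1]
    · simp [hκ, hl, corner, hp0, edgePoint_right h1.ne, edgePoint_of_ne h0.ne' hne,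
        bend_of_nonpos _ _ _ hs', hne.symm, hs1 hr.1]
    · simp [hκ, hl, corner, edgePoint_right h1.ne, edgePoint_of_ne h0.ne' hne,
        bend_of_nonpos _ _ _ hs', hne, hs2 hr']

/-- Coordinates on the two halves of each of three quadrants. -/
def sectorPoint (i : Fin 3) (b : Bool) (s h : ℝ) : Fin 3 → ℝ :=
  Pi.single i (s + h) + Pi.single (if b then i + 1 else i + 2) h

/-- Each quadrant is halved by its diagonal, the corner line `s = 0`: the smaller of the two
remaining coordinates is the height, the excess of the larger is the position along its edge. -/
lemma exists_eq_sectorPoint {y : Fin 3 → ℝ} (hy : ∀ i, 0 ≤ y i) {i : Fin 3} (hi : y i = 0) :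
    ∃ j b s h, 0 ≤ s ∧ 0 ≤ h ∧ s + h = y j ∧ y = sectorPoint j b s h := by
  rcases le_total (y (i + 2)) (y (i + 1)) with hle | hle
  · refine ⟨i + 1, true, y (i + 1) - y (i + 2), y (i + 2), by linarith, hy _, by ring, ?_⟩
    ext j
    fin_cases i <;> fin_cases j <;>
      simp_all [sectorPoint]
  · refine ⟨i + 2, false, y (i + 2) - y (i + 1), y (i + 1), by linarith, hy _, by ring, ?_⟩
    ext j
    fin_cases i <;> fin_cases j <;>
      simp_all [sectorPoint]

lemma sectorPoint_nonneg (i : Fin 3) (b : Bool) {s h : ℝ} (hs : 0 ≤ s) (hh : 0 ≤ h) (j : Fin 3) :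
    0 ≤ sectorPoint i b s h j := by
  have h1 : 0 ≤ sectorPoint i b s h :=
    add_nonneg (Pi.single_nonneg.2 (add_nonneg hs hh)) (Pi.single_nonneg.2 hh)
  exact h1 j

lemma sectorPoint_eq_zero (i : Fin 3) (b : Bool) (s h : ℝ) :
    sectorPoint i b s h (if b then i + 2 else i + 1) = 0 := by
  fin_cases i <;> cases b <;> simp [sectorPoint]

lemma sectorHeight_sectorPoint (i : Fin 3) (b : Bool) {s h : ℝ} (hs : 0 ≤ s) (hh : 0 ≤ h) :
    sectorHeight (sectorPoint i b s h) = h := by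
  have hsh := add_nonneg hs hh
  fin_cases i <;> cases b <;> simp [sectorHeight, sectorPoint, hs, hh, hsh]

lemma max_sectorPoint (i : Fin 3) (b : Bool) {s h : ℝ} (hs : 0 ≤ s) (hh : 0 ≤ h) (j : Fin 3) :
    max (sectorPoint i b s h j - sectorPoint i b s h (j + 1) - sectorPoint i b s h (j + 2)) 0 =
      (Pi.single i s : Fin 3 → ℝ) j := by
  fin_cases i <;> fin_cases j <;> cases b <;> simp [sectorPoint, hs] <;>
    linarith

lemma min_sectorPoint (i : Fin 3) (b : Bool) {s h : ℝ} (hs : 0 ≤ s) (hh : 0 ≤ h) (j : Fin 3) :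
    min (sectorPoint i b s h j) (sectorPoint i b s h (j + 1)) =
      (Pi.single (if b then i else i + 2) h : Fin 3 → ℝ) j := by
  have hsh := add_nonneg hs hh
  fin_cases i <;> fin_cases j <;> cases b <;> simp [sectorPoint, hs, hh, hsh]

lemma sectorPoint_apply (i : Fin 3) (b : Bool) (s h : ℝ) (j : Fin 3) :
    (Pi.single i s : Fin 3 → ℝ) j + (Pi.single (if b then i else i + 2) h : Fin 3 → ℝ) j +
      (Pi.single (if b then i else i + 2) h : Fin 3 → ℝ) (j + 2) = sectorPoint i b s h j := by
  fin_cases i <;> fin_cases j <;> cases b <;> simp [sectorPoint]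

lemma sum_single_single {W : Type*} [DecidableEq W] (e : Fin 3 → W) (i : Fin 3) (a : ℝ) :
    ∑ j, Pi.single (e j) ((Pi.single i a : Fin 3 → ℝ) j) = (Pi.single (e i) a : W → ℝ) := by
  rw [Finset.sum_eq_single i (fun j _ hj => by rw [Pi.single_eq_of_ne hj, Pi.single_zero])
    (by simp), Pi.single_eq_same]

/-- Vertices with three neighbours. -/
lemma exists_isSectorChart {v : V} {w : Fin 3 → V} (hinj : Function.Injective w)
    (hadj : ∀ u, G.Adj v u ↔ ∃ i, w i = u) (hprv : ∀ i, prv v (w (i + 1)) = w i) :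
    ∃ ψ l ε, IsSectorChart (ribbon G prv) (height (V := V)) ψ l ε ∧ ψ 0 = (Pi.single v 1, 0) := by
  have hvw : ∀ i, G.Adj v (w i) := fun i => (hadj _).2 ⟨i, rfl⟩
  have hcor : ∀ i b, corner prv v (w i) b = (v, w (if b then i else i + 2)) := fun i b => by
    have h1 := hprv (i + 2)
    rw [show i + 2 + 1 = i by fin_cases i <;> rfl] at h1
    cases b <;> simp [corner, h1]
  -- One formula in `max` and `min` for all six half-quadrants makes `ψ` piecewise linear
  -- everywhere. At `sectorPoint i b s h` the sums reduce to the position `s` on edge `i` and the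
  -- height `h` at the corner.
  set ψ : (Fin 3 → ℝ) → (V → ℝ) × (V × V → ℝ) := fun y =>
    (Pi.single v (1 - ∑ i, max (y i - y (i + 1) - y (i + 2)) 0) +
      ∑ i, Pi.single (w i) (max (y i - y (i + 1) - y (i + 2)) 0),
      ∑ i, Pi.single (v, w i) (min (y i) (y (i + 1)))) with hψ
  -- Coordinate `i` is the position along edge `i` plus the heights at the two corners adjacent to
  -- it.
  set l : (V → ℝ) × (V × V → ℝ) → Fin 3 → ℝ := fun X i =>
    X.1 (w i) + X.2 (v, w i) + X.2 (v, w (i + 2)) with hl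
  have hψp : ∀ i b s h, 0 ≤ s → 0 ≤ h → ψ (sectorPoint i b s h) =
      (edgePoint v (w i) s, Pi.single (corner prv v (w i) b) h) := by
    intro i b s h hs hh
    simp only [hψ, max_sectorPoint i b hs hh, min_sectorPoint i b hs hh, hcor]
    rw [sum_single_single w, sum_single_single fun i => (v, w i)]
    simp [edgePoint]
  have hlp : ∀ i b s h, l (edgePoint v (w i) s, Pi.single (corner prv v (w i) b) h) =
      sectorPoint i b s h := by
    intro i b s h
    have h1 : ∀ j, edgePoint v (w i) s (w j) = (Pi.single i s : Fin 3 → ℝ) j := by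
      intro j
      by_cases hij : j = i
      · subst hij
        rw [edgePoint_right (hvw j).ne, Pi.single_eq_same]
      · rw [edgePoint_of_ne (hvw j).ne' (hinj.ne hij), Pi.single_eq_of_ne hij]
    have h2 : ∀ i j, (Pi.single (v, w i) h : V × V → ℝ) (v, w j) =
        (Pi.single i h : Fin 3 → ℝ) j := by
      intro i j
      simp [Pi.single_apply, hinj.eq_iff]
    ext j
    simp only [hl, hcor, h1, h2, sectorPoint_apply]
  have hψ0 : ψ 0 = (Pi.single v 1, 0) := by simp [hψ]
  refine ⟨ψ, l, 1 / 4, ⟨?_, ?_, by norm_num, ?_, ?_⟩, hψ0⟩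
  · have hf : ∀ i : Fin 3, IsPL fun y : Fin 3 → ℝ => max (y i - y (i + 1) - y (i + 2)) 0 :=
      fun i => (((IsPL.apply i).sub (IsPL.apply (i + 1))).sub (IsPL.apply (i + 2))).max
        (IsPL.const 0)
    have hg : ∀ i : Fin 3, IsPL fun y : Fin 3 → ℝ => min (y i) (y (i + 1)) :=
      fun i => (IsPL.apply i).min (IsPL.apply (i + 1))
    exact ((((IsPL.const 1).sub (IsPL.sum _ fun i _ => hf i)).single v).add
      (IsPL.sum _ fun i _ => (hf i).single _)).prodMk (IsPL.sum _ fun i _ => (hg i).single _)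
  · unfold l
    fun_prop
  · intro y hy0 ⟨i, hi⟩ hyε
    obtain ⟨j, b, s, h, hs, hh, hsh, rfl⟩ := exists_eq_sectorPoint hy0 hi
    have h1 := hyε j
    rw [← hsh] at h1
    rw [hψp j b s h hs hh, hlp, height_single, sectorHeight_sectorPoint j b hs hh]
    exact ⟨star_mem_ribbon b (hvw j) ⟨hs, by linarith⟩ ⟨hh, by linarith⟩, rfl, rfl⟩
  · have h1 : ∀ᶠ X : (V → ℝ) × (V × V → ℝ) in 𝓝 (ψ 0), 3 / 4 < X.1 v :=
      ContinuousAt.eventually_lt (by fun_prop) (by fun_prop) (by rw [hψ0]; norm_num)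
    filter_upwards [h1] with X hX1 hX
    obtain ⟨u, b, s, h, hu, hs, hh, rfl⟩ := exists_star_of_mem_ribbon hX hX1
    obtain ⟨i, rfl⟩ := (hadj u).1 hu
    rw [hlp, hψp i b s h hs.1 hh.1]
    exact ⟨sectorPoint_nonneg i b hs.1 hh.1, ⟨_, sectorPoint_eq_zero i b s h⟩, rfl⟩

/-! ### The surface bounded by a graph -/

/-- Each side of each edge contributes the image of a rectangle with coordinates `(s, z)`, the
height being `bump z`. -/
lemma isPolytopal_collaredDouble :
    IsPolytopal (collaredDouble (ribbon G prv) (height (V := V))) := by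
  have h : collaredDouble (ribbon G prv) (height (V := V)) =
      ⋃ i ∈ {i : V × V × Bool | G.Adj i.1 i.2.1},
        (fun q : ℝ × ℝ => (strip prv i.1 i.2.1 i.2.2 (q.1, bump q.2), q.2)) ''
          (Icc (0 : ℝ) 1 ×ˢ Icc (-2 : ℝ) 1) := by
    ext ⟨X, z⟩
    simp only [mem_iUnion, mem_image, Prod.exists, exists_prop, Prod.mk.injEq]
    constructor
    · rintro ⟨⟨v, w, b, s, h, hadj, hs, hh, hX⟩, hz, hXz⟩
      dsimp only at hX hXz hz
      rw [hX, height_strip _ _ _ _ hh.1] at hXz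
      exact ⟨v, w, b, hadj, s, z, ⟨hs, hz⟩, by rw [hX, hXz], rfl⟩
    · rintro ⟨v, w, b, hadj, s, z, ⟨hs, hz⟩, rfl, rfl⟩
      exact ⟨⟨v, w, b, s, _, hadj, hs, ⟨bump_nonneg _, bump_le⟩, rfl⟩, hz,
        height_strip _ _ _ _ (bump_nonneg _)⟩
  rw [h]
  refine IsPolytopal.biUnion (toFinite _) fun i _ => IsPLOn.image_isPolytopal (IsPL.isPLOn ?_
    ((isPolytope_Icc _ _).isPolytopal.prod (isPolytope_Icc _ _).isPolytopal))
  exact ((isPL_strip _ _ _).comp (IsPL.fst.prodMk IsPL.snd.bump)).prodMk IsPL.snd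

lemma isPointOfType_of_vertex (hG : IsRotation G prv) (v : V) :
    (∃ k ≤ 2, IsPointOfType 2 k (collaredDouble (ribbon G prv) height) ((Pi.single v 1, 0), 0)) ∧
      IsPointOfType 2 0 (collaredDouble (ribbon G prv) height) ((Pi.single v 1, 0), -2) := by
  rcases hG v with ⟨w, h1, h2, h3⟩ | ⟨w, h1, h2, h3⟩
  · have h := isPointOfType_of_degree_two h1 h2 h3
    exact ⟨⟨1, by norm_num, h.1⟩, h.2⟩
  · obtain ⟨ψ, l, ε, h, h0⟩ := exists_isSectorChart h1 h2 h3
    rw [← h0]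
    exact ⟨⟨2, le_rfl, h.isPointOfType_two⟩, h.isPointOfType_zero⟩

/-- For `z > 0` the local structure is that of the zero locus times an interval. For `z ≤ 0` it
depends on whether the point lies over a vertex, a corner line, an open edge or the inside of a
strip, and on whether `z` is `-2`, `0` or in between. -/
theorem fills_collaredDouble (hG : IsRotation G prv)
    (h : ∀ X ∈ ribbon G prv, height X = 0 →
      ∃ k ≤ 1, IsPointOfType 1 k {X | X ∈ ribbon G prv ∧ height X = 0} X) :
    Fills (collaredDouble (ribbon G prv) height)
      ({X | X ∈ ribbon G prv ∧ height X = 0} ×ˢ {(1 : ℝ)}) := by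
  refine ⟨isPolytopal_collaredDouble, ?_, ?_, ?_⟩
  · rintro ⟨X, z⟩ ⟨hX, rfl⟩
    exact ⟨hX.1, by norm_num, by rw [bump_of_nonneg zero_le_one]; exact hX.2⟩
  · rintro ⟨X, z⟩ ⟨hX, rfl⟩
    obtain ⟨k, hk, hX'⟩ := h X hX.1 hX.2
    exact ⟨k, by omega, isBoundaryPointOfType_collaredDouble hX'⟩
  · rintro ⟨X, z⟩ ⟨hX, hz, hXz⟩ hXB
    dsimp only at hX hz hXz
    rcases lt_or_ge 0 z with hz0 | hz0
    · rw [bump_of_nonneg hz0.le] at hXz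
      obtain ⟨k, hk, hX'⟩ := h X hX hXz
      refine ⟨k, by omega, isPointOfType_collaredDouble_of_collar hk hX' hz0
        (lt_of_le_of_ne hz.2 ?_)⟩
      rintro rfl
      exact hXB ⟨⟨hX, hXz⟩, rfl⟩
    obtain ⟨v, w, b, s, r, hadj, hs, hr, rfl⟩ := hX
    rw [height_strip _ _ _ _ hr.1] at hXz
    subst hXz
    -- it suffices to treat the half of the strip not containing the far end
    wlog hs1 : s < 1 generalizing v w b s
    · have := this w v (!b) (1 - s) hadj.symm ⟨by linarith [hs.2], by linarith [hs.1]⟩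
      rw [strip_comm] at this
      exact this hXB (by linarith)
    rcases hs.1.eq_or_lt with rfl | hs0
    · rcases hz.1.eq_or_lt with rfl | hz2
      · rw [show bump (-2) = 0 by norm_num [bump], strip_zero, edgePoint_zero]
        exact ⟨0, by norm_num, (isPointOfType_of_vertex hG v).2⟩
      rcases hz0.eq_or_lt with rfl | hz0
      · rw [bump_of_nonneg le_rfl, strip_zero, edgePoint_zero]
        exact (isPointOfType_of_vertex hG v).1
      · rw [strip_star _ _ _ _ (by norm_num) hr, edgePoint_zero]
        exact ⟨0, by norm_num, isPointOfType_of_corner hG hadj b hz2 hz0⟩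
    · rcases hz.1.eq_or_lt with rfl | hz2
      · rw [show bump (-2) = 0 by norm_num [bump], strip_zero]
        exact ⟨0, by norm_num, (isPointOfType_of_edge hG hadj hs0 hs1).2⟩
      rcases hz0.eq_or_lt with rfl | hz0
      · rw [bump_of_nonneg le_rfl, strip_zero]
        exact ⟨1, by norm_num, (isPointOfType_of_edge hG hadj hs0 hs1).1⟩
      · exact ⟨0, by norm_num, isPointOfType_of_strip hG hadj b hs0 hs1 hz2 hz0⟩

end Charts

end Ribbon

end PLTop

namespace PLTop

/-! ### Fillings of trivalent graphs. -/

section Bordism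

variable {E F : Type*} [NormedAddCommGroup E] [NormedSpace ℝ E]
  [NormedAddCommGroup F] [NormedSpace ℝ F]

/-! ### Trivalent graphs bound -/

lemma IsPLOn.tendsto_nhdsWithin [FiniteDimensional ℝ E] {P : Set E} {Q : Set F} {f : E → F}
    (hf : IsPLOn f P) (hb : MapsTo f P Q) {x : E} (hx : x ∈ P) :
    Filter.Tendsto f (𝓝[P] x) (𝓝[Q] (f x)) :=
  tendsto_nhdsWithin_iff.2 ⟨hf.continuousOn x hx, by
    filter_upwards [self_mem_nhdsWithin] with y hy using hb hy⟩

/-- Model neighbourhoods are preserved by piecewise linear isomorphisms. -/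
lemma HasModelNhd.of_bijOn {H : Type*} [NormedAddCommGroup H] [NormedSpace ℝ H]
    [FiniteDimensional ℝ E] [FiniteDimensional ℝ F] {P : Set E} {P' : Set F} {L : E → F}
    (hL : IsPLOn L P) (hb : BijOn L P P') {x : E} (hx : x ∈ P) {Q : Set H} {y : H}
    (h : HasModelNhd P' (L x) Q y) : HasModelNhd P x Q y := by
  obtain ⟨N, hNP, hN, f, hf, hbf, hfx⟩ := h
  obtain ⟨g, hg, hgb, hgL, hLg⟩ := hL.exists_inverse hb
  have hgN : IsPLOn g N := hg.mono hf.isPolytopal hNP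
  have hsub : g '' N ⊆ P := (image_mono hNP).trans hgb.mapsTo.image_subset
  have hmaps : MapsTo L (g '' N) N := by
    rintro _ ⟨z, hz, rfl⟩
    rwa [hLg z (hNP hz)]
  refine ⟨g '' N, hsub, ?_, f ∘ L, hf.comp (hL.mono hgN.image_isPolytopal hsub) hmaps, ?_, hfx⟩
  · filter_upwards [IsPLOn.tendsto_nhdsWithin hL hb.mapsTo hx hN, self_mem_nhdsWithin]
      with p hp hpP
    exact ⟨L p, hp, hgL p hpP⟩
  · refine hbf.comp ⟨hmaps, hb.injOn.mono hsub, fun z hz => ?_⟩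
    exact ⟨g z, mem_image_of_mem _ hz, hLg z (hNP hz)⟩

lemma PLIsomorphic.image {G : Type*} [NormedAddCommGroup G] [NormedSpace ℝ G]
    [FiniteDimensional ℝ E] [FiniteDimensional ℝ G] {B : Set E} {T : Set F}
    (h : PLIsomorphic B T) (j : E →ᵃ[ℝ] G) (l : G →ᵃ[ℝ] E) (hl : ∀ p, l (j p) = p) :
    PLIsomorphic (j '' B) T := by
  obtain ⟨f, hf, hb⟩ := h
  have hlb : BijOn l (j '' B) B := by
    refine ⟨?_, ?_, fun p hp => ⟨j p, mem_image_of_mem _ hp, hl p⟩⟩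
    · rintro _ ⟨p, hp, rfl⟩
      rwa [hl]
    · rintro _ ⟨p, hp, rfl⟩ _ ⟨q, hq, rfl⟩ he
      rw [hl, hl] at he
      rw [he]
  exact ⟨f ∘ l, hf.comp ((IsPL.of_affine l).isPLOn (hf.isPolytopal.image j)) hlb.mapsTo,
    hb.comp hlb⟩

/-- Any enumeration of the neighbours provides a cyclic order, and no compatibility between vertices
is required. -/
lemma exists_isRotation {V : Type*} {G : SimpleGraph V}
    (h : ∀ v, ∃ d : ℕ, (d = 2 ∨ d = 3) ∧ ∃ w : Fin d → V, Function.Injective w ∧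
      ∀ u, G.Adj v u ↔ ∃ i, w i = u) : ∃ prv, IsRotation G prv := by
  have key : ∀ (n : ℕ) [NeZero n] (w : Fin n → V), Function.Injective w →
      ∃ p : V → V, ∀ i, p (w (i + 1)) = w i := by
    intro n _ w hw
    refine ⟨fun u => w (Function.invFun w u - 1), fun i => ?_⟩
    dsimp only
    rw [Function.leftInverse_invFun hw, add_sub_cancel_right]
  have h' : ∀ v, ∃ p : V → V, (∃ w : Fin 2 → V, Function.Injective w ∧
      (∀ u, G.Adj v u ↔ ∃ i, w i = u) ∧ ∀ i, p (w (i + 1)) = w i) ∨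
    (∃ w : Fin 3 → V, Function.Injective w ∧ (∀ u, G.Adj v u ↔ ∃ i, w i = u) ∧
      ∀ i, p (w (i + 1)) = w i) := by
    intro v
    obtain ⟨d, rfl | rfl, w, hw, hadj⟩ := h v
    · obtain ⟨p, hp⟩ := key 2 w hw
      exact ⟨p, Or.inl ⟨w, hw, hadj, hp⟩⟩
    · obtain ⟨p, hp⟩ := key 3 w hw
      exact ⟨p, Or.inr ⟨w, hw, hadj, hp⟩⟩
  choose prv hprv using h'
  exact ⟨prv, hprv⟩

/-- The points of height zero of the ribbon surface form a copy of the graph. -/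
lemma mem_zeroSection {V : Type*} [DecidableEq V] [Fintype V] {G : SimpleGraph V}
    {prv : V → V → V} {X : (V → ℝ) × (V × V → ℝ)} : X ∈ ribbon G prv ∧ height X = 0 ↔
      ∃ v w s, G.Adj v w ∧ s ∈ Icc (0 : ℝ) 1 ∧ X = (edgePoint v w s, 0) := by
  constructor
  · rintro ⟨⟨v, w, b, s, h, hadj, hs, hh, rfl⟩, h0⟩
    rw [height_strip _ _ _ _ hh.1] at h0
    exact ⟨v, w, s, hadj, hs, by rw [h0, strip_zero]⟩
  · rintro ⟨v, w, s, hadj, hs, rfl⟩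
    exact ⟨⟨v, w, true, s, 0, hadj, hs, by norm_num, (strip_zero _ _ _ _ _).symm⟩, by
      simp [height]⟩

lemma isPolytopal_zeroSection {V : Type*} [DecidableEq V] [Fintype V] {G : SimpleGraph V}
    {prv : V → V → V} : IsPolytopal {X | X ∈ ribbon G prv ∧ height X = 0} := by
  have h : {X | X ∈ ribbon G prv ∧ height X = 0} = ⋃ e ∈ {e : V × V | G.Adj e.1 e.2},
      (fun s : ℝ => ((edgePoint e.1 e.2 s, 0) : (V → ℝ) × (V × V → ℝ))) '' Icc (0 : ℝ) 1 := by
    ext X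
    simp only [Set.mem_ofPred_eq, mem_zeroSection, mem_iUnion, mem_image, Prod.exists, exists_prop]
    constructor
    · rintro ⟨v, w, s, hadj, hs, rfl⟩
      exact ⟨v, w, hadj, s, hs, rfl⟩
    · rintro ⟨v, w, hadj, s, hs, rfl⟩
      exact ⟨v, w, s, hadj, hs, rfl⟩
  rw [h]
  exact IsPolytopal.biUnion (toFinite _) fun e _ => IsPLOn.image_isPolytopal
    (((isPL_edgePoint _ _).prodMk (IsPL.const 0)).isPLOn (isPolytope_Icc _ _).isPolytopal)

/-- The realization of the corner graph is piecewise linearly isomorphic to the trivalent graph. -/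
lemma exists_bijOn_zeroSection [FiniteDimensional ℝ E] {T : Set E} (hT : IsFiniteTrivalentGraph T)
    [Fintype (corners T)] [DecidableEq (corners T)] (prv : corners T → corners T → corners T) :
    ∃ L : (corners T → ℝ) × (corners T × corners T → ℝ) →ₗ[ℝ] E,
      BijOn L {X | X ∈ ribbon (cornerGraph T) prv ∧ height X = 0} T := by
  -- Each basis vector of the first factor goes to the corner that it names, so edges go affinely
  -- onto the segments of `T`.
  set L : (corners T → ℝ) × (corners T × corners T → ℝ) →ₗ[ℝ] E :=
    (Fintype.linearCombination ℝ ((↑) : corners T → E)) ∘ₗ LinearMap.fst ℝ _ _ with hL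
  have hLe : ∀ v w s, L (edgePoint v w s, 0) = (1 - s) • (v : E) + s • (w : E) := by
    intro v w s
    simp [hL, edgePoint, Fintype.linearCombination_apply_single]
  have hseg : ∀ {v w : corners T} {s : ℝ}, s ∈ Icc (0 : ℝ) 1 →
      (1 - s) • (v : E) + s • (w : E) ∈ segment ℝ (v : E) w := fun hs =>
    ⟨_, _, by linarith [hs.2], hs.1, by ring, rfl⟩
  refine ⟨L, ?_, ?_, ?_⟩
  · intro X hX
    obtain ⟨v, w, s, hadj, hs, rfl⟩ := mem_zeroSection.1 hX
    rw [hLe]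
    exact hadj.2.1 (hseg hs)
  · intro X hX X' hX' he
    obtain ⟨v, w, s, hadj, hs, rfl⟩ := mem_zeroSection.1 hX
    obtain ⟨v', w', s', hadj', hs', rfl⟩ := mem_zeroSection.1 hX'
    rw [hLe, hLe] at he
    have hinj : ∀ {v w : corners T} {s s' : ℝ}, v ≠ w →
        (1 - s) • (v : E) + s • (w : E) = (1 - s') • (v : E) + s' • (w : E) → s = s' := by
      intro v w s s' hne h
      have h1 : (s - s') • ((w : E) - v) = 0 := by
        rw [← sub_eq_zero] at h
        rw [← h]
        module
      rcases smul_eq_zero.1 h1 with h2 | h2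
      · exact sub_eq_zero.1 h2
      · exact absurd (Subtype.ext (sub_eq_zero.1 h2)) hne.symm
    -- the case of an end point
    have hend : ∀ {v v' w' : corners T} {s' : ℝ}, (cornerGraph T).Adj v' w' →
        s' ∈ Icc (0 : ℝ) 1 → (v : E) = (1 - s') • (v' : E) + s' • (w' : E) →
        edgePoint v' w' s' = Pi.single v 1 := by
      intro v v' w' s' hadj' hs' he
      rcases cornerGraph_mem_corners hadj' (he ▸ hseg hs') v.2 with h1 | h1
      · obtain rfl := Subtype.ext h1
        have : s' = 0 := hinj hadj'.ne (by rw [← he]; simp)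
        simp [this, edgePoint]
      · obtain rfl := Subtype.ext h1
        have : s' = 1 := hinj hadj'.ne (by rw [← he]; simp)
        simp [this, edgePoint]
    rcases hs.1.eq_or_lt with rfl | hs0
    · rw [hend hadj' hs' (v := v) (by rw [← he]; simp), edgePoint_zero]
    rcases hs.2.eq_or_lt with rfl | hs1
    · rw [hend hadj' hs' (v := w) (by rw [← he]; simp)]
      simp [edgePoint]
    have hopen : (1 - s) • (v : E) + s • (w : E) ∈ openSegment ℝ (v : E) w :=
      ⟨_, _, by linarith, hs0, by ring, rfl⟩
    rcases cornerGraph_edge_unique hadj hadj' hopen (he ▸ hseg hs') with ⟨rfl, rfl⟩ | ⟨rfl, rfl⟩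
    · rw [hinj hadj.ne he]
    · rw [add_comm ((1 - s') • _)] at he
      have : s = 1 - s' := hinj hadj.ne (by rw [he, sub_sub_cancel])
      rw [this, edgePoint_comm]
  · intro y hy
    obtain ⟨v, w, hadj, a, s, ha, hs, has, rfl⟩ := exists_edge_of_mem hT hy
    obtain rfl : a = 1 - s := by linarith
    exact ⟨_, mem_zeroSection.2 ⟨v, w, s, hadj, ⟨hs, by linarith⟩, rfl⟩, hLe v w s⟩

/-- The zero locus is piecewise linearly isomorphic to `T` and so inherits its local models, as
`fills_collaredDouble` demands; a linear isomorphism then moves the surface into a Euclidean space.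
-/
theorem exists_fills {M : ℕ} {T : Set (EuclideanSpace ℝ (Fin M))}
    (hT : IsFiniteTrivalentGraph T) : ∃ (N : ℕ) (S B : Set (EuclideanSpace ℝ (Fin N))),
      Fills S B ∧ PLIsomorphic B T := by
  classical
  have : Fintype (corners T) := (finite_corners hT).fintype
  obtain ⟨prv, hprv⟩ := exists_isRotation (exists_neighbours hT)
  obtain ⟨L, hL⟩ := exists_bijOn_zeroSection hT prv
  set Z := {X | X ∈ ribbon (cornerGraph T) prv ∧ height X = 0} with hZ
  have hLpl : IsPLOn L Z := (IsPL.of_linear L).isPLOn isPolytopal_zeroSection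
  have hfill := fills_collaredDouble hprv fun X hX hX0 => by
    obtain ⟨k, hk, h⟩ := hT.2.2 (L X) (hL.mapsTo ⟨hX, hX0⟩)
    exact ⟨k, hk, HasModelNhd.of_bijOn hLpl hL ⟨hX, hX0⟩ h⟩
  have hiso : PLIsomorphic (Z ×ˢ {(1 : ℝ)}) T := by
    refine ⟨fun p => L p.1, ((IsPL.of_linear L).comp IsPL.fst).isPLOn
      (isPolytopal_zeroSection.prod (isPolytope_singleton _).isPolytopal), ?_, ?_, ?_⟩
    · exact fun p hp => hL.mapsTo hp.1
    · rintro ⟨X, z⟩ ⟨hX, rfl⟩ ⟨X', z'⟩ ⟨hX', rfl⟩ he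
      exact congrArg (·, (1 : ℝ)) (hL.injOn hX hX' he)
    · intro y hy
      obtain ⟨X, hX, rfl⟩ := hL.surjOn hy
      exact ⟨(X, 1), ⟨hX, rfl⟩, rfl⟩
  set e := toEuclidean (E := ((corners T → ℝ) × (corners T × corners T → ℝ)) × ℝ)
  have hl : ∀ p, e.symm.toLinearMap.toAffineMap (e.toLinearMap.toAffineMap p) = p := by
    intro p
    simp
  exact ⟨_, _, _, hfill.image _ _ hl, hiso.image _ _ hl⟩

end Bordism

end PLTop

/-- Every finite trivalent graph is the boundary of a fake surface with boundary; and any two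
finite trivalent graphs are bordant, so the bordism group in dimension one is trivial. -/
theorem mainTheorem5 :
    (∀ (M : ℕ) (T : Set (EuclideanSpace ℝ (Fin M))), PLTop.IsFiniteTrivalentGraph T →
      ∃ (N : ℕ) (S : Set (EuclideanSpace ℝ (Fin N))),
        PLTop.IsFakeSurfaceWithBoundary S ∧
        PLTop.PLIsomorphic (PLTop.singularBoundary 2 S) T) ∧
    (∀ (M₁ M₂ : ℕ) (T₁ : Set (EuclideanSpace ℝ (Fin M₁))) (T₂ : Set (EuclideanSpace ℝ (Fin M₂))),
      PLTop.IsFiniteTrivalentGraph T₁ → PLTop.IsFiniteTrivalentGraph T₂ →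
      PLTop.Bordant 1 T₁ T₂) := by
  refine ⟨fun M T hT => ?_, fun M₁ M₂ T₁ T₂ hT₁ hT₂ => ?_⟩
  · obtain ⟨N, S, B, hS, hB⟩ := PLTop.exists_fills hT
    exact ⟨N, S, ⟨hS.isPolytopal.isCompact, hS.isSingularManifoldWithBoundary⟩,
      by rwa [hS.singularBoundary_eq]⟩
  · obtain ⟨N₁, S₁, B₁, hS₁, hB₁⟩ := PLTop.exists_fills hT₁
    obtain ⟨N₂, S₂, B₂, hS₂, hB₂⟩ := PLTop.exists_fills hT₂
    -- the two surfaces are placed at heights 0 and 1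
    let E₁ := EuclideanSpace ℝ (Fin N₁)
    let E₂ := EuclideanSpace ℝ (Fin N₂)
    let e := toEuclidean (E := (E₁ × E₂) × ℝ)
    let j₁ : E₁ →ᵃ[ℝ] EuclideanSpace ℝ (Fin _) := e.toLinearMap.toAffineMap.comp
      ((LinearMap.inl ℝ E₁ E₂).toAffineMap.prod (AffineMap.const ℝ E₁ (0 : ℝ)))
    let j₂ : E₂ →ᵃ[ℝ] EuclideanSpace ℝ (Fin _) := e.toLinearMap.toAffineMap.comp
      ((LinearMap.inr ℝ E₁ E₂).toAffineMap.prod (AffineMap.const ℝ E₂ (1 : ℝ)))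
    let l₁ := (LinearMap.fst ℝ E₁ E₂ ∘ₗ LinearMap.fst ℝ (E₁ × E₂) ℝ ∘ₗ
      e.symm.toLinearMap).toAffineMap
    let l₂ := (LinearMap.snd ℝ E₁ E₂ ∘ₗ LinearMap.fst ℝ (E₁ × E₂) ℝ ∘ₗ
      e.symm.toLinearMap).toAffineMap
    have h₁ : ∀ p, l₁ (j₁ p) = p := fun p => by simp [l₁, j₁]
    have h₂ : ∀ p, l₂ (j₂ p) = p := fun p => by simp [l₂, j₂]
    have hd : ∀ (A : Set E₁) (B : Set E₂), Disjoint (j₁ '' A) (j₂ '' B) := by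
      intro A B
      rw [Set.disjoint_left]
      rintro _ ⟨p, -, rfl⟩ ⟨q, -, he⟩
      have h := congrArg Prod.snd (e.injective he)
      simp at h
    have hS := (hS₁.image j₁ l₁ h₁).union (hS₂.image j₂ l₂ h₂) (hd _ _)
    exact ⟨_, _, _, _, hS.isPolytopal.isCompact, hS.isSingularManifoldWithBoundary,
      hS.singularBoundary_eq, hd _ _, hB₁.image j₁ l₁ h₁, hB₂.image j₂ l₂ h₂⟩
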